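/- Let $d,m,n\ge 0$ be integers, $D=m+n$, let $\mathcal P=\mathcal P^1\times\mathcal P^2\subset\mathbb R^D$ with $\mathcal P^1=\prod_{i=1}^m[\underline p_i,\overline p_i]$, $\mathcal P^2=\prod_{i=m+1}^{D}[\underline p_i,\overline p_i]$, $\underline p_i\le\overline p_i$ real, let $\varrho=(\varrho^1,\varrho^2)\in(1,\infty)^m\times(1,\infty)^{n}$ and $\eta\in\mathbb R^d$. For $p^1\in\mathcal P^1$ let $f^{p^1}:\mathbb R^d\to[0,\infty)$ be measurable, for $p^2\in\mathcal P^2$ let $X^{p^2}$ be an $\mathbb R^d$-valued random variable, and for $p=(p^1,p^2)\in\mathcal P$ put $\mathrm{Price}^p=E\big(f^{p^1}(X^{p^2})\big)$. Let $B([-1,1],r)$, $r>1$, be the open region of $\mathbb C$ bounded by the ellipse with foci $\pm1$ whose semi-axes sum up to $r$, let $\tau_{[a,b]}(z)=b+\frac{a-b}{2}(1-z)$, and for a hyperrectangle $\mathcal Q=\prod_i[a_i,b_i]$ let $B(\mathcal Q,r)=\prod_i\tau_{[a_i,b_i]}\big(B([-1,1],r_i)\big)$. Write, whenever the integrals converge,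 $$\widehat{f^{p^1}}(z-i\eta)=\int_{\mathbb R^d}e^{i\langle z,x\rangle}e^{\langle\eta,x\rangle}f^{p^1}(x)\,dx,\qquad \varphi^{p^2}(z+i\eta)=E\big(e^{i\langle z+i\eta,X^{p^2}\rangle}\big),\qquad z\in\mathbb R^d .$$ Assume: (A1) for every $p^1\in\mathcal P^1$ the map $x\mapsto e^{\langle\eta,x\rangle}f^{p^1}(x)$ is in $L^1(\mathbb R^d)$; (A2) for every $z\in\mathbb R^d$ the map $p^1\mapsto\widehat{f^{p^1}}(z-i\eta)$ on $\mathcal P^1$ has an analytic extension to $B(\mathcal P^1,\varrho^1)$ (denoted in the same way), and there are constants $c_1,c_2>0$ with $\sup_{p^1\in B(\mathcal P^1,\varrho^1)}|\widehat{f^{p^1}}(-z-i\eta)|\le c_1e^{c_2|z|}$ for all $z\in\mathbb R^d$; (A3) $E\big(e^{-\langle\eta,X^{p^2}\rangle}\big)<\infty$ for every $p^2\in\mathcal P^2$; (A4) for every $z\in\mathbb R^d$ the map $p^2\mapsto\varphi^{p^2}(z+i\eta)$ on $\mathcal P^2$ has an analytic extension to $B(\mathcal P^2,\varrho^2)$ (denoted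 in the same way), and there are $\alpha\in(1,2]$ and $c_1,c_2>0$ with $\sup_{p^2\in B(\mathcal P^2,\varrho^2)}|\varphi^{p^2}(z+i\eta)|\le c_1e^{-c_2|z|^\alpha}$ for all $z\in\mathbb R^d$. For $\overline N=(N_1,\dots,N_D)$ with integers $N_i\ge1$, $J=\prod_i\{0,\dots,N_i\}$ and a function $h$ on $[-1,1]^D$ let $$I_{\overline N}(h)(x)=\sum_{j\in J}c_j\prod_{i=1}^D\cos(j_i\arccos x_i),\qquad c_j=\Big(\prod_{i=1}^D\frac{2^{\mathbf 1_{\{0<j_i<N_i\}}}}{N_i}\Big)\sum_{k_1=0}^{N_1}{}^{''}\cdots\sum_{k_D=0}^{N_D}{}^{''}\,h\Big(\cos\tfrac{\pi k_1}{N_1},\dots,\cos\tfrac{\pi k_D}{N_D}\Big)\prod_{i=1}^D\cos\Big(j_i\pi\frac{k_i}{N_i}\Big),$$ where $\sum''$ means that the first and the last summand are halved; for a function on $\mathcal P$, $I_{\overline N}$ is obtained by transforming each coordinate affinely from $[-1,1]$ to $[\underline p_i,\overline p_i]$ by $\tau_{[\underline p_i,\overline p_i]}$. Then $f^{p^1}(X^{p^2})$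 is integrable for every $p\in\mathcal P$, and $p\mapsto\mathrm{Price}^p$ has a bounded analytic extension from $\mathcal P$ to $B(\mathcal P,\varrho)$ such that, whenever $V$ is a bound for the modulus of this extension on $B(\mathcal P,\varrho)$ (for instance its supremum), for all $\overline N$ as above $$\max_{p\in\mathcal P}\big|\mathrm{Price}^p-I_{\overline N}(\mathrm{Price}^{(\cdot)})(p)\big|\le 2^{\frac D2+1}\cdot V\cdot\Big(\sum_{i=1}^D\varrho_i^{-2N_i}\prod_{j=1}^D\frac1{1-\varrho_j^{-2}}\Big)^{\frac12}.$$ -/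

import Mathlib

open MeasureTheory
open scoped RealInnerProductSpace

noncomputable section

namespace ChebPrice

/-! ### Bernstein ellipses -/

/-- The open Bernstein ellipse `B([-1,1], ϱ)`: the open region bounded by the ellipse with foci
`±1` whose semi-axes sum up to `ϱ`. The semi-axes are `(ϱ + ϱ⁻¹) / 2` and `(ϱ - ϱ⁻¹) / 2`, so the
sum of the distances to the foci is less than the length `ϱ + ϱ⁻¹` of the major axis. -/
def bernstein (ϱ : ℝ) : Set ℂ :=
  {z | ‖z - 1‖ + ‖z + 1‖ < ϱ + ϱ⁻¹}

/-- The affine map of `[-1,1]` onto `[a,b]`. -/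
def tau (a b : ℝ) (x : ℝ) : ℝ := b + (a - b) / 2 * (1 - x)

/-- The affine map `tau` on complex arguments: its real part is `tau a b (re z)` and its imaginary
part is `(b - a) / 2 * im z`. -/
def tauC (a b : ℝ) (z : ℂ) : ℂ := (b : ℂ) + ((a : ℂ) - (b : ℂ)) / 2 * (1 - z)

/-- The inverse of `tau a b`. If `a = b` it is the constant `0`, which is again a preimage under
`tau a b` of the only point of `[a,b]`. -/
def tauInv (a b : ℝ) (y : ℝ) : ℝ := (2 * y - a - b) / (b - a)

/-- The generalized Bernstein ellipse `B(𝒫, ϱ)` around the hyperrectangle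
`𝒫 = ∏ i, [lo i, hi i]`. -/
def genBernstein {ι : Type*} (lo hi ϱ : ι → ℝ) : Set (ι → ℂ) :=
  Set.univ.pi fun i => tauC (lo i) (hi i) '' bernstein (ϱ i)

/-- A real parameter vector, as a complex one. -/
def toC {ι : Type*} (p : ι → ℝ) : ι → ℂ := fun i => (p i : ℂ)

/-! ### Tensorized Chebyshev interpolation -/

section Interpolation

variable {ι : Type*} [Fintype ι] [DecidableEq ι]

/-- The multi-indices `j` with `0 ≤ j i ≤ N i` for all `i`. -/
def indices (N : ι → ℕ) : Finset (ι → ℕ) :=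
  Fintype.piFinset fun i => Finset.range (N i + 1)

/-- The weight that halves the first and the last summand of a sum over `0 ≤ k ≤ N`. -/
def halfWeight (N k : ℕ) : ℝ := if k = 0 ∨ k = N then 1 / 2 else 1

/-- The Chebyshev node `p^k` in `[-1,1]^D` with the multi-index `k`. -/
def node (N k : ι → ℕ) : ι → ℝ := fun i => Real.cos (Real.pi * ((k i : ℝ) / (N i : ℝ)))

/-- The coefficient `c_j` of the Chebyshev interpolation of `h` on `[-1,1]^D`. -/
def chebCoeff (N : ι → ℕ) (h : (ι → ℝ) → ℝ) (j : ι → ℕ) : ℝ :=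
  (∏ i, (if 0 < j i ∧ j i < N i then (2 : ℝ) else 1) / (N i : ℝ)) *
    ∑ k ∈ indices N, (∏ i, halfWeight (N i) (k i)) * h (node N k) *
      ∏ i, Real.cos ((j i : ℝ) * Real.pi * ((k i : ℝ) / (N i : ℝ)))

/-- The tensorized Chebyshev polynomial `T_j` on `[-1,1]^D`. -/
def chebT (j : ι → ℕ) (x : ι → ℝ) : ℝ := ∏ i, Real.cos ((j i : ℝ) * Real.arccos (x i))

/-- The Chebyshev interpolation of `h` on `[-1,1]^D`. -/
def chebInterp (N : ι → ℕ) (h : (ι → ℝ) → ℝ) (x : ι → ℝ) : ℝ :=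
  ∑ j ∈ indices N, chebCoeff N h j * chebT j x

/-- The Chebyshev interpolation of `h` on the hyperrectangle `∏ i, [lo i, hi i]`, obtained from
the one on `[-1,1]^D` by the affine transformation `tau` in each coordinate. -/
def chebInterpOn (lo hi : ι → ℝ) (N : ι → ℕ) (h : (ι → ℝ) → ℝ) (p : ι → ℝ) : ℝ :=
  chebInterp N (fun x => h fun i => tau (lo i) (hi i) (x i))
    fun i => tauInv (lo i) (hi i) (p i)

end Interpolation

/-! ### Prices and their Fourier transforms -/

/-- The first `m` coordinates `p¹` of a parameter vector `p = (p¹, p²)` in `ℝ^(m+n)`. -/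
def fstPar {m n : ℕ} (p : Fin (m + n) → ℝ) : Fin m → ℝ := fun i => p (Fin.castAdd n i)

/-- The last `n` coordinates `p²` of a parameter vector `p = (p¹, p²)` in `ℝ^(m+n)`. -/
def sndPar {m n : ℕ} (p : Fin (m + n) → ℝ) : Fin n → ℝ := fun i => p (Fin.natAdd m i)

/-- The Fourier transform of the damped function `x ↦ exp ⟪η, x⟫ * g x` at `z`,
written `ĝ(z - iη)`. -/
def dampedFourier {d : ℕ} (η : EuclideanSpace ℝ (Fin d)) (g : EuclideanSpace ℝ (Fin d) → ℝ)
    (z : EuclideanSpace ℝ (Fin d)) : ℂ :=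
  ∫ x, Complex.exp (Complex.I * (⟪z, x⟫ : ℝ)) * ((Real.exp ⟪η, x⟫ * g x : ℝ) : ℂ)

/-- The extended characteristic function `φ(z + iη) = E exp(i⟨z + iη, X⟩)` of a random
vector `X`. -/
def dampedCharFun {d : ℕ} {Ω : Type*} [MeasurableSpace Ω] (P : Measure Ω)
    (η : EuclideanSpace ℝ (Fin d)) (X : Ω → EuclideanSpace ℝ (Fin d))
    (z : EuclideanSpace ℝ (Fin d)) : ℂ :=
  ∫ ω, Complex.exp (Complex.I * ((⟪z, X ω⟫ : ℝ) + Complex.I * (⟪η, X ω⟫ : ℝ))) ∂P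

/-- The price `E f^{p¹}(X^{p²})` for `p = (p¹, p²)`. -/
def price {d m n : ℕ} {Ω : Type*} [MeasurableSpace Ω] (P : Measure Ω)
    (f : (Fin m → ℝ) → EuclideanSpace ℝ (Fin d) → ℝ)
    (X : (Fin n → ℝ) → Ω → EuclideanSpace ℝ (Fin d)) (p : Fin (m + n) → ℝ) : ℝ :=
  ∫ ω, f (fstPar p) (X (sndPar p) ω) ∂P

/-- Condition (A1): the damped payoff is integrable for every payoff parameter. -/
def CondA1 {d m : ℕ} (lo hi : Fin m → ℝ) (η : EuclideanSpace ℝ (Fin d))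
    (f : (Fin m → ℝ) → EuclideanSpace ℝ (Fin d) → ℝ) : Prop :=
  ∀ p ∈ Set.Icc lo hi, Integrable (fun x => Real.exp ⟪η, x⟫ * f p x) volume

/-- Condition (A2): for every `z` the Fourier transform of the damped payoff is (extends to) an
analytic function of the payoff parameter in the generalized Bernstein ellipse, with an
exponential bound that is uniform there. -/
def CondA2 {d m : ℕ} (lo hi ϱ : Fin m → ℝ) (η : EuclideanSpace ℝ (Fin d))
    (f : (Fin m → ℝ) → EuclideanSpace ℝ (Fin d) → ℝ) : Prop :=
  ∃ F : (Fin m → ℂ) → EuclideanSpace ℝ (Fin d) → ℂ,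
    (∀ z, AnalyticOnNhd ℂ (fun p => F p z) (genBernstein lo hi ϱ)) ∧
    (∀ p ∈ Set.Icc lo hi, ∀ z, F (toC p) z = dampedFourier η (f p) z) ∧
    ∃ c₁ > (0 : ℝ), ∃ c₂ > (0 : ℝ), ∀ z, ∀ p ∈ genBernstein lo hi ϱ,
      ‖F p (-z)‖ ≤ c₁ * Real.exp (c₂ * ‖z‖)

/-- Condition (A3): the exponential moment condition for every model parameter. -/
def CondA3 {d n : ℕ} {Ω : Type*} [MeasurableSpace Ω] (P : Measure Ω) (lo hi : Fin n → ℝ)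
    (η : EuclideanSpace ℝ (Fin d)) (X : (Fin n → ℝ) → Ω → EuclideanSpace ℝ (Fin d)) : Prop :=
  ∀ p ∈ Set.Icc lo hi, Integrable (fun ω => Real.exp (-⟪η, X p ω⟫)) P

/-- Condition (A4): for every `z` the extended characteristic function at `z + iη` is (extends to)
an analytic function of the model parameter in the generalized Bernstein ellipse, with a bound of
exponential type that is uniform there. -/
def CondA4 {d n : ℕ} {Ω : Type*} [MeasurableSpace Ω] (P : Measure Ω) (lo hi ϱ : Fin n → ℝ)
    (η : EuclideanSpace ℝ (Fin d)) (X : (Fin n → ℝ) → Ω → EuclideanSpace ℝ (Fin d)) : Prop :=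
  ∃ Φ : (Fin n → ℂ) → EuclideanSpace ℝ (Fin d) → ℂ,
    (∀ z, AnalyticOnNhd ℂ (fun p => Φ p z) (genBernstein lo hi ϱ)) ∧
    (∀ p ∈ Set.Icc lo hi, ∀ z, Φ (toC p) z = dampedCharFun P η (X p) z) ∧
    ∃ α ∈ Set.Ioc (1 : ℝ) 2, ∃ c₁ > (0 : ℝ), ∃ c₂ > (0 : ℝ), ∀ z, ∀ p ∈ genBernstein lo hi ϱ,
      ‖Φ p z‖ ≤ c₁ * Real.exp (-c₂ * ‖z‖ ^ α)

end ChebPrice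

end

namespace ChebPrice

/-! ### Discrete trigonometric sums on equispaced nodes -/

open Finset

/-! The proof has two independent halves: a Fourier formula that extends the price analytically, and
an interpolation estimate for bounded analytic functions on a product of ellipses.

Extension. Weighting `P` by `exp (-⟪η, X⟫)` makes the law of `X` a finite measure whose
characteristic function is `z ↦ φ(z + iη)`, integrable by (A4). Such a measure is dominated by a
multiple of Lebesgue measure, so (A1) makes the payoff integrable, and the price is, up to rescaling
`z = 2πw`, the integral of `f̂(-z - iη) φ(z + iη)`, with no integrability of `f̂` required
(`integrable_and_integral_eq`). Since `α > 1`, the extended integrand is dominated on the whole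
ellipse by one integrable function of `z`. Cauchy's formula on a torus and Fubini then give
analyticity of the integral (`analyticOnNhd_integral`). Fubini needs measurability in `z` at complex
parameters, which is recovered from real ones by Laurent expansion (`measurable_of_measurable_box`).

Error in one variable. Put `q = ϱ⁻²` and let `a k` be the Laurent coefficients of `g` composed with
`w ↦ (w + w⁻¹) / 2`. They are even in `k`, and Parseval gives `∑ |a k|² ϱ^(2k) ≤ V²` over `k ≥ 0`.
If `e n` is the interpolation error of the `n`-th Chebyshev polynomial, then `g - I g = 2 ∑ a n * e
n`, so Cauchy–Schwarz leaves `∑ q^n (e n)² ≤ q^N T` with `T = (1 + q) / (1 - q)`. This is proved for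
`q^N ≤ 1/2` by summing the aliasing series in closed form (`sum_aliasError_sq_le`). For larger `q^N`
the bound `2N/3 + 1` on the squared Lebesgue constant suffices (`sum_abs_nodeKernel_sq_le`). The
result is `|g - I g| ≤ 2V √(q^N T)` (`norm_sub_interp_le`), and likewise `|I g| ≤ V √(2 / (1 - q))`
(`norm_interp_le`).

Several variables. Because `2 / (1 - q) = 1 + T`, adding one coordinate costs exactly one
Cauchy–Schwarz inequality in the plane (`norm_sub_multiInterp_le`). The factors `2` in `∏ 2 / (1 - q
i)` give `2^(D/2)` after the root. -/

/-- The `k`-th node `π k / N` on the circle. -/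
noncomputable def circleNode (N k : ℕ) : ℝ := Real.pi * ((k : ℝ) / (N : ℝ))

theorem sum_exp_circleNode {N : ℕ} (hN : 1 ≤ N) (m : ℤ) :
    ∑ k ∈ range (2 * N), Complex.exp (Complex.I * (m * circleNode N k : ℝ)) =
      if (2 * N : ℤ) ∣ m then (2 * N : ℂ) else 0 := by
  have hN0 : (N : ℂ) ≠ 0 := by exact_mod_cast (by omega : N ≠ 0)
  have hprim := Complex.isPrimitiveRoot_exp (2 * N) (by omega)
  set ω := Complex.exp (2 * Real.pi * Complex.I / ((2 * N : ℕ) : ℂ)) with hω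
  have hterm : ∀ k ∈ range (2 * N),
      Complex.exp (Complex.I * (m * circleNode N k : ℝ)) = (ω ^ m) ^ k := by
    intro k _
    rw [hω, ← Complex.exp_int_mul, ← Complex.exp_nat_mul]
    congr 1
    simp only [circleNode]
    push_cast
    field_simp
  rw [sum_congr rfl hterm]
  split_ifs with h
  · have h1 : ω ^ m = 1 := (hprim.zpow_eq_one_iff_dvd m).2 (by exact_mod_cast h)
    simp [h1]
  · have h1 : ω ^ m ≠ 1 := fun h1 => h (by exact_mod_cast (hprim.zpow_eq_one_iff_dvd m).1 h1)
    rw [geom_sum_eq h1]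
    have : (ω ^ m) ^ (2 * N) = 1 := by
      rw [← zpow_natCast, ← zpow_mul, mul_comm, zpow_mul, zpow_natCast, hprim.pow_eq_one, one_zpow]
    rw [this]; simp

theorem sum_cos_circleNode {N : ℕ} (hN : 1 ≤ N) (m : ℤ) (c : ℝ) :
    ∑ k ∈ range (2 * N), Real.cos (m * circleNode N k + c) =
      if (2 * N : ℤ) ∣ m then 2 * N * Real.cos c else 0 := by
  have h := congrArg (fun z => (Complex.exp (Complex.I * c) * z).re) (sum_exp_circleNode hN m)
  simp only [mul_sum, ← Complex.exp_add, Complex.re_sum] at h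
  have hterm : ∀ k ∈ range (2 * N), (Complex.exp
      (Complex.I * c + Complex.I * (m * circleNode N k : ℝ))).re =
        Real.cos (m * circleNode N k + c) := by
    intro k _
    rw [← Complex.exp_ofReal_mul_I_re]
    congr 2
    push_cast; ring
  rw [sum_congr rfl hterm] at h
  rw [h]
  split_ifs
  · rw [mul_comm Complex.I, ← Complex.exp_ofReal_mul_I_re]
    rw [show (2 * N : ℂ) = ((2 * N : ℝ) : ℂ) by push_cast; rfl, Complex.re_mul_ofReal]; ring
  · simp

/-- The interpolation kernel of the `2N` equispaced nodes. -/
noncomputable def nodeKernel (N : ℕ) (t : ℝ) : ℝ :=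
  (∑ j ∈ range (N + 1), (if 0 < j ∧ j < N then (2 : ℝ) else 1) * Real.cos (j * t)) / (2 * N)

/-- Orthogonality on the `2N` nodes makes the kernel reproduce frequencies below `N`. At frequency
`N` the sine part is invisible, since `sin (N t)` vanishes at every node, so only `cos c * cos (N
t)` survives. -/
theorem sum_nodeKernel_mul_cos {N : ℕ} (hN : 1 ≤ N) {l : ℕ} (hl : l ≤ N) (θ c : ℝ) :
    ∑ k ∈ range (2 * N), nodeKernel N (θ - circleNode N k) * Real.cos (l * circleNode N k + c) =
      if l = N then Real.cos c * Real.cos (N * θ) else Real.cos (l * θ + c) := by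
  have hN0 : (N : ℝ) ≠ 0 := by exact_mod_cast (by omega : N ≠ 0)
  have inner : ∀ j ∈ range (N + 1),
      ∑ k ∈ range (2 * N), Real.cos (j * (θ - circleNode N k)) *
        Real.cos (l * circleNode N k + c) =
      if j = l then N * Real.cos (l * θ + c) + (if l = 0 ∨ l = N then
        N * Real.cos (l * θ - c) else 0) else 0 := by
    intro j hj
    have hj' : j ≤ N := by simpa [Nat.lt_succ_iff] using hj
    have h1 : ∀ k, Real.cos (j * (θ - circleNode N k)) * Real.cos (l * circleNode N k + c) =
        (Real.cos (((l - j : ℤ) : ℝ) * circleNode N k + (j * θ + c)) +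
          Real.cos (((l + j : ℤ) : ℝ) * circleNode N k + (c - j * θ))) / 2 := by
      intro k
      have := Real.cos_add (j * (θ - circleNode N k)) (l * circleNode N k + c)
      have h2 := Real.cos_sub (j * (θ - circleNode N k)) (l * circleNode N k + c)
      push_cast
      rw [show ((l : ℝ) - j) * circleNode N k + (j * θ + c) =
        j * (θ - circleNode N k) + (l * circleNode N k + c) by ring,
        show ((l : ℝ) + j) * circleNode N k + (c - j * θ) =
        -(j * (θ - circleNode N k) - (l * circleNode N k + c)) by ring, Real.cos_neg, this, h2]
      ring
    simp_rw [h1]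
    rw [← sum_div, sum_add_distrib, sum_cos_circleNode hN, sum_cos_circleNode hN]
    -- As `j, l ≤ N`, the difference `l - j` is a multiple of `2N` only when it is `0`, and the sum
    -- `l + j` only when it is `0` or `2N`.
    have e1 : ((2 * N : ℤ) ∣ (l - j : ℤ)) ↔ j = l := by
      constructor
      · rintro ⟨r, hr⟩
        have : r = 0 := by
          by_contra h0
          rcases lt_or_gt_of_ne h0 with h0 | h0
          · nlinarith
          · nlinarith
        subst this; omega
      · rintro rfl; simp
    have e2 : ((2 * N : ℤ) ∣ (l + j : ℤ)) ↔ j = l ∧ (l = 0 ∨ l = N) := by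
      constructor
      · rintro ⟨r, hr⟩
        have h0 : 0 ≤ r := by
          by_contra h0
          nlinarith
        have h2 : r ≤ 1 := by
          by_contra h0
          nlinarith
        interval_cases r <;> omega
      · rintro ⟨rfl, h | h⟩
        · subst h; simp
        · subst h; exact ⟨1, by ring⟩
    simp only [e1, e2]
    by_cases hjl : j = l
    · subst hjl
      simp only [true_and, if_true]
      split_ifs
      · rw [show c - j * θ = -(j * θ - c) by ring, Real.cos_neg]; ring
      · ring
    · simp [hjl]
  have : ∀ k ∈ range (2 * N), nodeKernel N (θ - circleNode N k) *
      Real.cos (l * circleNode N k + c) = (∑ j ∈ range (N + 1),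
        (if 0 < j ∧ j < N then (2 : ℝ) else 1) * (Real.cos (j * (θ - circleNode N k)) *
        Real.cos (l * circleNode N k + c))) / (2 * N) := by
    intro k _
    rw [nodeKernel, div_mul_eq_mul_div, sum_mul]
    simp only [mul_assoc]
  rw [sum_congr rfl this, ← sum_div, sum_comm]
  simp_rw [← mul_sum]
  rw [sum_congr rfl (fun j hj => by rw [inner j hj])]
  simp only [mul_ite, mul_zero]
  rw [sum_ite_eq' , if_pos (by simp; omega)]
  rcases eq_or_ne l N with rfl | hlN
  · simp only [lt_irrefl, and_false, if_false, or_true, if_true]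
    rw [Real.cos_add, Real.cos_sub]
    field_simp; ring
  · rw [if_neg hlN]
    rcases Nat.eq_zero_or_pos l with rfl | hl0
    · simp [Real.cos_neg]; field_simp; ring
    · have : l ≠ 0 := by omega
      have h2 : 0 < l ∧ l < N := ⟨hl0, by omega⟩
      simp only [h2, this, hlN, and_self, or_self, if_true, if_false, add_zero]
      field_simp

/-! ### Weighted square sums of the kernel and the Lebesgue constant. -/

theorem sum_nodeKernel_sq {N : ℕ} (hN : 1 ≤ N) (θ : ℝ) :
    ∑ k ∈ range (2 * N), nodeKernel N (θ - circleNode N k) ^ 2 =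
      1 - Real.sin (N * θ) ^ 2 / (2 * N) := by
  have hN0 : (N : ℝ) ≠ 0 := by exact_mod_cast (by omega : N ≠ 0)
  have h1 : ∀ k ∈ range (2 * N), nodeKernel N (θ - circleNode N k) ^ 2 =
      (∑ l ∈ range (N + 1), (if 0 < l ∧ l < N then (2 : ℝ) else 1) *
        (nodeKernel N (θ - circleNode N k) * Real.cos (l * circleNode N k + -(l * θ)))) /
          (2 * N) := by
    intro k _
    -- One factor is expanded into its cosines. The other then reproduces each of them at `θ`,
    -- giving `1` for `l < N` and `cos² (N θ)` for `l = N`.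
    rw [sq]
    conv_lhs => rw [nodeKernel.eq_def N (θ - circleNode N k)]
    conv_lhs => rw [← nodeKernel.eq_def N (θ - circleNode N k)]
    nth_rewrite 2 [nodeKernel]
    rw [mul_div_assoc', mul_sum]
    congr 1
    refine sum_congr rfl fun l _ => ?_
    rw [show (l : ℝ) * circleNode N k + -(l * θ) = -(l * (θ - circleNode N k)) by ring,
      Real.cos_neg]
    ring
  rw [sum_congr rfl h1, ← sum_div, sum_comm]
  simp_rw [← mul_sum]
  rw [sum_congr rfl (fun l hl => by
    rw [sum_nodeKernel_mul_cos hN (by simpa [Nat.lt_succ_iff] using hl)])]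
  rw [sum_range_succ, sum_congr rfl (g := fun l => if l = 0 then (1 : ℝ) else 2)]
  · rw [show N = (N - 1) + 1 by omega, sum_range_succ', ← show N = (N - 1) + 1 by omega]
    have hc : ((N - 1 : ℕ) : ℝ) = N - 1 := by push_cast [Nat.cast_sub hN]; ring
    simp only [Nat.add_eq_zero_iff, one_ne_zero, and_false, if_false, if_true, lt_irrefl,
      sum_const, card_range, nsmul_eq_mul, hc, Real.cos_neg]
    have := Real.sin_sq_add_cos_sq (N * θ)
    field_simp
    nlinarith
  · intro l hl
    have hl' : l < N := by simpa using hl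
    rcases Nat.eq_zero_or_pos l with rfl | h0
    · simp [show ¬ (0 = N) by omega]
    · simp [h0, hl', hl'.ne, h0.ne']

/-- The closed form `sin (N t) cot (t / 2) / (2 N)` of the kernel, cleared of denominators so that
it also holds at the zeros of `sin (t / 2)`. The sum telescopes. -/
theorem nodeKernel_mul_sin {N : ℕ} (hN : 1 ≤ N) (t : ℝ) :
    2 * N * nodeKernel N t * Real.sin (t / 2) = Real.sin (N * t) * Real.cos (t / 2) := by
  have hN0 : (N : ℝ) ≠ 0 := by exact_mod_cast (by omega : N ≠ 0)
  rw [nodeKernel, mul_div_cancel₀ _ (by positivity)]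
  have key : ∀ n : ℕ, (1 + 2 * ∑ j ∈ range n, Real.cos ((j + 1 : ℕ) * t) +
      Real.cos ((n + 1 : ℕ) * t)) * Real.sin (t / 2) =
        Real.sin ((n + 1 : ℕ) * t) * Real.cos (t / 2) := by
    intro n
    induction n with
    | zero =>
      have h1 : t = 2 * (t / 2) := by ring
      simp only [range_zero, sum_empty, mul_zero, add_zero, zero_add, Nat.cast_one, one_mul]
      conv_lhs => rw [h1, Real.cos_two_mul]
      conv_rhs => rw [h1, Real.sin_two_mul]
      ring_nf
    | succ n ih =>
      rw [sum_range_succ]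
      have e : Real.sin ((n + 1 + 1 : ℕ) * t) * Real.cos (t / 2) -
          Real.sin ((n + 1 : ℕ) * t) * Real.cos (t / 2) =
          (Real.cos ((n + 1 : ℕ) * t) + Real.cos ((n + 1 + 1 : ℕ) * t)) * Real.sin (t / 2) := by
        have gen : ∀ a b : ℝ, Real.sin (a + b) * Real.cos b - Real.sin (a - b) * Real.cos b =
            (Real.cos (a - b) + Real.cos (a + b)) * Real.sin b := by
          intro a b
          rw [Real.sin_add, Real.sin_sub, Real.cos_add, Real.cos_sub]
          ring
        have h := gen ((n + 1 : ℕ) * t + t / 2) (t / 2)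
        rwa [show ((n + 1 : ℕ) : ℝ) * t + t / 2 + t / 2 = ((n + 1 + 1 : ℕ) : ℝ) * t by
          push_cast; ring, add_sub_cancel_right] at h
      linear_combination ih - e
  obtain ⟨n, rfl⟩ : ∃ n, N = n + 1 := ⟨N - 1, by omega⟩
  rw [← key n, sum_range_succ, sum_range_succ']
  congr 1
  rw [sum_congr rfl (g := fun j : ℕ => 2 * Real.cos ((j + 1 : ℕ) * t)), ← mul_sum]
  · simp; ring
  · intro j hj
    have : j < n := by simpa using hj
    rw [if_pos ⟨by omega, by omega⟩]

/-- The weight is `5 - 4 cos t = 1 + 8 sin² (t / 2)`. The closed form turns the second part into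
`sin² (N θ) / N² * (1 + cos t)`, where the numerator is the same at every node and the cosines sum
to zero. -/
theorem sum_nodeKernel_sq_mul {N : ℕ} (hN : 1 ≤ N) (θ : ℝ) :
    ∑ k ∈ range (2 * N), nodeKernel N (θ - circleNode N k) ^ 2 *
      (5 - 4 * Real.cos (θ - circleNode N k)) = 1 + 3 * Real.sin (N * θ) ^ 2 / (2 * N) := by
  have hN0 : (N : ℝ) ≠ 0 := by exact_mod_cast (by omega : N ≠ 0)
  have h1 : ∀ k ∈ range (2 * N), nodeKernel N (θ - circleNode N k) ^ 2 *
      (5 - 4 * Real.cos (θ - circleNode N k)) = nodeKernel N (θ - circleNode N k) ^ 2 +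
        Real.sin (N * θ) ^ 2 / N ^ 2 *
          (1 + Real.cos ((1 : ℤ) * circleNode N k + -θ)) := by
    intro k _
    have hk := nodeKernel_mul_sin hN (θ - circleNode N k)
    have hs : Real.sin (N * (θ - circleNode N k)) ^ 2 = Real.sin (N * θ) ^ 2 := by
      have : (N : ℝ) * (θ - circleNode N k) = N * θ - k * Real.pi := by
        simp only [circleNode]; field_simp
      rw [this, Real.sin_sub_nat_mul_pi, mul_pow, ← pow_mul, mul_comm k, pow_mul]; simp
    have hc : Real.cos (((1 : ℤ) : ℝ) * circleNode N k + -θ) = Real.cos (θ - circleNode N k) := by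
      rw [← Real.cos_neg]; congr 1; push_cast; ring
    rw [hc]
    set t := θ - circleNode N k
    have c1 : Real.cos t = 2 * Real.cos (t / 2) ^ 2 - 1 := by
      rw [← Real.cos_two_mul]; congr 1; ring
    have c2 := Real.sin_sq_add_cos_sq (t / 2)
    have hk2 : 4 * N ^ 2 * nodeKernel N t ^ 2 * Real.sin (t / 2) ^ 2 =
        Real.sin (N * θ) ^ 2 * Real.cos (t / 2) ^ 2 := by
      rw [← hs]
      linear_combination (2 * N * nodeKernel N t * Real.sin (t / 2) +
        Real.sin (N * t) * Real.cos (t / 2)) * hk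
    rw [c1]
    field_simp
    linear_combination 2 * hk2 + (N:ℝ) ^ 2 * nodeKernel N t ^ 2 * 8 * (-c2)
  rw [sum_congr rfl h1, sum_add_distrib, sum_nodeKernel_sq hN, ← mul_sum, sum_add_distrib,
    sum_cos_circleNode hN, if_neg]
  · simp; field_simp; ring
  · intro h
    have := Int.le_of_dvd one_pos h
    omega

/-- All the points `x` occurring here share the power `x ^ (2N) = u ^ (2N)`, so each `1 / (1 - x)`
is a finite geometric sum over `1 - u ^ (2N)`. Only the constant term survives summation over the
nodes. -/
theorem sum_inv_one_sub_root {N : ℕ} (hN : 1 ≤ N) {u : ℂ} (hu : ‖u‖ < 1) :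
    ∑ k ∈ range (2 * N), 1 / (1 - u * Complex.exp (Complex.I * (-circleNode N k : ℝ))) =
      2 * N / (1 - u ^ (2 * N)) := by
  have hN0 : (N : ℝ) ≠ 0 := by exact_mod_cast (by omega : N ≠ 0)
  have hpow : ‖u ^ (2 * N)‖ < 1 := by
    rw [norm_pow]; exact pow_lt_one₀ (norm_nonneg _) hu (by omega)
  have hne : 1 - u ^ (2 * N) ≠ 0 := by
    intro h
    rw [← sub_eq_zero.1 h] at hpow; simp at hpow
  have hterm : ∀ k ∈ range (2 * N),
      1 / (1 - u * Complex.exp (Complex.I * (-circleNode N k : ℝ))) =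
      (∑ j ∈ range (2 * N), u ^ j *
        Complex.exp (Complex.I * (((-j : ℤ) : ℝ) * circleNode N k : ℝ))) / (1 - u ^ (2 * N)) := by
    intro k _
    set x := u * Complex.exp (Complex.I * (-circleNode N k : ℝ)) with hx
    have hxn : ‖x‖ < 1 := by
      rw [hx, norm_mul, mul_comm Complex.I, Complex.norm_exp_ofReal_mul_I, mul_one]; exact hu
    have hx1 : x ≠ 1 := by rintro h; rw [h] at hxn; simp at hxn
    have hxp : x ^ (2 * N) = u ^ (2 * N) := by
      rw [hx, mul_pow, ← Complex.exp_nat_mul]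
      have : ((2 * N : ℕ) : ℂ) * (Complex.I * (-circleNode N k : ℝ)) =
          (-k : ℤ) * (2 * Real.pi * Complex.I) := by
        simp only [circleNode]; push_cast
        have : (N : ℂ) ≠ 0 := by exact_mod_cast hN0
        field_simp
      rw [this, Complex.exp_int_mul_two_pi_mul_I, mul_one]
    have hs : ∑ j ∈ range (2 * N), u ^ j *
        Complex.exp (Complex.I * (((-j : ℤ) : ℝ) * circleNode N k : ℝ)) =
        ∑ j ∈ range (2 * N), x ^ j := by
      refine sum_congr rfl fun j _ => ?_
      rw [hx, mul_pow, ← Complex.exp_nat_mul]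
      congr 2; push_cast; ring
    rw [hs, geom_sum_eq hx1, hxp]
    have : x - 1 ≠ 0 := sub_ne_zero.2 hx1
    have : 1 - x ≠ 0 := sub_ne_zero.2 hx1.symm
    field_simp
    ring
  rw [sum_congr rfl hterm, ← sum_div, sum_comm]
  congr 1
  simp_rw [← mul_sum, sum_exp_circleNode hN]
  rw [sum_eq_single 0]
  · simp
  · intro j hj h0
    rw [if_neg, mul_zero]
    rintro ⟨r, hr⟩
    have : j < 2 * N := by simpa using hj
    have h1 : r < 0 := by
      by_contra h; push Not at h
      have : (0 : ℤ) < j := by omega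
      nlinarith
    have : (j : ℤ) < 2 * N := by exact_mod_cast this
    nlinarith
  · intro h; simp at h; omega

/-- Up to the factor `3`, `1 / (5 - 4 cos t)` is the Poisson kernel of radius `1/2`, the real part
of an expression in `1 / (1 - exp (i t) / 2)`. The modulus of `u ^ (2N)` is the `4^(-N)` in the
result. -/
theorem sum_inv_five_sub {N : ℕ} (hN : 1 ≤ N) (θ : ℝ) :
    ∑ k ∈ range (2 * N), 1 / (5 - 4 * Real.cos (θ - circleNode N k)) =
      2 * N / 3 * ((1 - (1 / 4) ^ (2 * N)) /
        ((1 - (1 / 4) ^ N) ^ 2 + 4 * (1 / 4) ^ N * Real.sin (N * θ) ^ 2)) := by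
  set u : ℂ := 1 / 2 * Complex.exp (Complex.I * θ) with hu
  have hun : ‖u‖ < 1 := by
    rw [hu, norm_mul, mul_comm Complex.I, Complex.norm_exp_ofReal_mul_I]; norm_num
  have h := congrArg Complex.re (sum_inv_one_sub_root hN hun)
  rw [Complex.re_sum] at h
  have hterm : ∀ k ∈ range (2 * N), 1 / (5 - 4 * Real.cos (θ - circleNode N k)) =
      (2 * (1 / (1 - u * Complex.exp (Complex.I * (-circleNode N k : ℝ)))).re - 1) / 3 := by
    intro k _
    have e : u * Complex.exp (Complex.I * (-circleNode N k : ℝ)) =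
        1 / 2 * Complex.exp ((θ - circleNode N k : ℝ) * Complex.I) := by
      rw [hu, mul_assoc, ← Complex.exp_add]; congr 2; push_cast; ring
    rw [e]
    set t := θ - circleNode N k
    have hc := Real.cos_le_one t
    have hcs := Real.sin_sq_add_cos_sq t
    rw [one_div (1 - _ : ℂ), Complex.inv_re, Complex.exp_mul_I, ← Complex.ofReal_cos,
      ← Complex.ofReal_sin, Complex.normSq_apply]
    simp [-Complex.ofReal_cos, -Complex.ofReal_sin]
    have : (1 - 2⁻¹ * Real.cos t) * (1 - 2⁻¹ * Real.cos t) +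
        2⁻¹ * Real.sin t * (2⁻¹ * Real.sin t) = (5 - 4 * Real.cos t) / 4 := by
      linear_combination hcs / 4
    rw [this]
    have : (5 - 4 * Real.cos t) ≠ 0 := by linarith
    field_simp
    ring
  rw [sum_congr rfl hterm, ← sum_div, sum_sub_distrib, ← mul_sum, h]
  have e2 : u ^ (2 * N) = ((1 / 4 : ℝ) ^ N : ℝ) * Complex.exp ((2 * (N * θ) : ℝ) * Complex.I) := by
    rw [hu, mul_pow, ← Complex.exp_nat_mul, pow_mul]
    push_cast
    congr 2
    · norm_num
    · ring
  rw [e2, pow_mul']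
  set Y : ℝ := (1 / 4 : ℝ) ^ N
  have hY : Y < 1 := pow_lt_one₀ (by norm_num) (by norm_num) (by omega)
  have hY0 : 0 < Y := by positivity
  set v := (N : ℝ) * θ
  have hcs := Real.sin_sq_add_cos_sq v
  have hden : 0 < (1 - Y) ^ 2 + 4 * Y * Real.sin v ^ 2 := by
    have : 0 < (1 - Y) ^ 2 := by have : 0 < 1 - Y := by linarith
                                 positivity
    positivity
  have h3 : Real.cos (2 * v) = 1 - 2 * Real.sin v ^ 2 := by
    rw [Real.cos_two_mul]; linarith
  have hsq : (1 - Y * Real.cos (2 * v)) * (1 - Y * Real.cos (2 * v)) +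
        Y * Real.sin (2 * v) * (Y * Real.sin (2 * v)) =
        (1 - Y) ^ 2 + 4 * Y * Real.sin v ^ 2 := by
    have h2 := Real.sin_sq_add_cos_sq (2 * v)
    linear_combination Y ^ 2 * h2 - 2 * Y * h3
  have hre : (2 * N / (1 - (Y : ℂ) * Complex.exp ((2 * v : ℝ) * Complex.I))).re =
      2 * N * ((1 - Y * Real.cos (2 * v)) / ((1 - Y) ^ 2 + 4 * Y * Real.sin v ^ 2)) := by
    rw [div_eq_mul_inv, Complex.exp_mul_I, ← Complex.ofReal_cos, ← Complex.ofReal_sin,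
      show (2 * N : ℂ) = ((2 * N : ℝ) : ℂ) by push_cast; rfl, Complex.re_ofReal_mul,
      Complex.inv_re, Complex.normSq_apply, ← hsq]
    simp [-Complex.ofReal_cos, -Complex.ofReal_sin]
  rw [hre, h3]
  simp only [sum_const, card_range, nsmul_eq_mul]
  push_cast
  have hM := hden.ne'
  generalize hMdef : (1 - Y) ^ 2 + 4 * Y * Real.sin v ^ 2 = M at hM ⊢
  field_simp
  rw [← hMdef]
  ring

/-- Cauchy–Schwarz with the weight `5 - 4 cos t`, which penalises nodes far from `θ`. Both resulting
sums are known exactly. -/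
theorem sum_abs_nodeKernel_sq_le {N : ℕ} (hN : 1 ≤ N) (θ : ℝ) :
    (∑ k ∈ range (2 * N), |nodeKernel N (θ - circleNode N k)|) ^ 2 ≤ 2 * N / 3 + 1 := by
  have hN1 : (1 : ℝ) ≤ N := by exact_mod_cast hN
  have hpos : ∀ k, 0 < 5 - 4 * Real.cos (θ - circleNode N k) := fun k => by
    linarith [Real.cos_le_one (θ - circleNode N k)]
  have hcs := sum_mul_sq_le_sq_mul_sq (range (2 * N))
    (fun k => |nodeKernel N (θ - circleNode N k)| * √(5 - 4 * Real.cos (θ - circleNode N k)))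
    (fun k => 1 / √(5 - 4 * Real.cos (θ - circleNode N k)))
  have e1 : ∀ k ∈ range (2 * N), |nodeKernel N (θ - circleNode N k)| *
      √(5 - 4 * Real.cos (θ - circleNode N k)) * (1 / √(5 - 4 * Real.cos (θ - circleNode N k))) =
        |nodeKernel N (θ - circleNode N k)| := by
    intro k _
    have := Real.sqrt_pos.2 (hpos k)
    field_simp
  have e2 : ∀ k ∈ range (2 * N), (|nodeKernel N (θ - circleNode N k)| *
      √(5 - 4 * Real.cos (θ - circleNode N k))) ^ 2 = nodeKernel N (θ - circleNode N k) ^ 2 *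
      (5 - 4 * Real.cos (θ - circleNode N k)) := by
    intro k _
    rw [mul_pow, sq_abs, Real.sq_sqrt (hpos k).le]
  have e3 : ∀ k ∈ range (2 * N), (1 / √(5 - 4 * Real.cos (θ - circleNode N k))) ^ 2 =
      1 / (5 - 4 * Real.cos (θ - circleNode N k)) := by
    intro k _
    rw [div_pow, one_pow, Real.sq_sqrt (hpos k).le]
  rw [sum_congr rfl e1, sum_congr rfl e2, sum_congr rfl e3, sum_nodeKernel_sq_mul hN,
    sum_inv_five_sub hN, pow_mul'] at hcs
  refine hcs.trans ?_
  set Y : ℝ := (1 / 4 : ℝ) ^ N with hYdef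
  have hY0 : 0 < Y := by positivity
  -- This smallness of `N * 4^(-N)` absorbs the loss in the endpoint case `S = 0`.
  have hNY : N * Y ≤ 1 / 4 := by
    have key : ∀ n : ℕ, ((n + 1 : ℕ) : ℝ) * (1 / 4 : ℝ) ^ (n + 1) ≤ 1 / 4 := by
      intro n
      induction n with
      | zero => norm_num
      | succ n ih =>
        push_cast at ih ⊢
        have : 0 < (1 / 4 : ℝ) ^ (n + 1) := by positivity
        rw [pow_succ]
        have h0 : (0 : ℝ) ≤ n := Nat.cast_nonneg n
        nlinarith
    obtain ⟨n, rfl⟩ : ∃ n, N = n + 1 := ⟨N - 1, by omega⟩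
    exact key n
  have hY : Y ≤ 1 / 4 := by nlinarith
  have hS0 : 0 ≤ Real.sin (N * θ) ^ 2 := sq_nonneg _
  have hS1 : Real.sin (N * θ) ^ 2 ≤ 1 := Real.sin_sq_le_one _
  set S := Real.sin (N * θ) ^ 2
  have hden : 0 < (1 - Y) ^ 2 + 4 * Y * S := by
    have : 0 < (1 - Y) ^ 2 := by have : 0 < 1 - Y := by linarith
                                 positivity
    positivity
  have e : (1 + 3 * S / (2 * N)) * (2 * N / 3 * ((1 - Y ^ 2) / ((1 - Y) ^ 2 + 4 * Y * S))) =
      (2 * N + 3 * S) * (1 - Y ^ 2) / 3 / ((1 - Y) ^ 2 + 4 * Y * S) := by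
    field_simp
  rw [e, div_le_iff₀ hden]
  -- the difference is affine in `S`
  have a0 : 2 * N * (1 - Y ^ 2) / 3 ≤ (2 * N / 3 + 1) * (1 - Y) ^ 2 := by
    nlinarith [mul_nonneg hY0.le hY0.le, mul_nonneg (sub_nonneg.2 hY) hY0.le]
  have a1 : (2 * N + 3) * (1 - Y ^ 2) / 3 ≤ (2 * N / 3 + 1) * ((1 - Y) ^ 2 + 4 * Y) := by
    nlinarith [mul_nonneg hY0.le hY0.le]
  nlinarith [mul_le_mul_of_nonneg_left a1 hS0,
    mul_le_mul_of_nonneg_left a0 (sub_nonneg.2 hS1)]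

end ChebPrice

namespace ChebPrice

/-! ### One-dimensional Chebyshev interpolation weights -/

open Finset

/-- The weight of the `k`-th Chebyshev node in the interpolation of degree `N` at `x`. -/
noncomputable def interpWeight (N k : ℕ) (x : ℝ) : ℝ :=
  halfWeight N k * ∑ j ∈ range (N + 1), (if 0 < j ∧ j < N then (2 : ℝ) else 1) / N *
    Real.cos (j * Real.pi * (k / N)) * Real.cos (j * Real.arccos x)

theorem halfWeight_nonneg (N k : ℕ) : 0 ≤ halfWeight N k := by
  unfold halfWeight; split_ifs <;> norm_num

theorem interpWeight_eq {N : ℕ} (hN : 1 ≤ N) (k : ℕ) (x : ℝ) :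
    interpWeight N k x = halfWeight N k * (nodeKernel N (Real.arccos x - circleNode N k) +
      nodeKernel N (Real.arccos x - -circleNode N k)) := by
  have hN0 : (N : ℝ) ≠ 0 := by exact_mod_cast (by omega : N ≠ 0)
  rw [interpWeight, nodeKernel, nodeKernel, ← add_div, ← sum_add_distrib, sum_div]
  congr 1
  refine sum_congr rfl fun j _ => ?_
  rw [← mul_add, show (j : ℝ) * (Real.arccos x - circleNode N k) =
    j * Real.arccos x - j * Real.pi * (k / N) by simp only [circleNode]; ring,
    show (j : ℝ) * (Real.arccos x - -circleNode N k) =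
    j * Real.arccos x + j * Real.pi * (k / N) by simp only [circleNode]; ring,
    Real.cos_sub, Real.cos_add]
  field_simp
  ring

/-- Folding of the circle: the nodes `N, …, 2N - 1` are, modulo `2π`, the negatives of the nodes `1,
…, N`. The nodes `0` and `π` are fixed by the reflection, hence the halved end terms. -/
theorem sum_halfWeight_mul {N : ℕ} (hN : 1 ≤ N) (F : ℝ → ℝ)
    (hF : Function.Periodic F (2 * Real.pi)) :
    ∑ k ∈ range (N + 1), halfWeight N k * (F (circleNode N k) + F (-circleNode N k)) =
      ∑ k ∈ range (2 * N), F (circleNode N k) := by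
  have hN0 : (N : ℝ) ≠ 0 := by exact_mod_cast (by omega : N ≠ 0)
  have half : ∀ a : ℕ → ℝ, ∑ k ∈ range (N + 1), halfWeight N k * a k =
      ∑ k ∈ range N, a k + (a N - a 0) / 2 := by
    intro a
    obtain ⟨n, rfl⟩ : ∃ n, N = n + 1 := ⟨N - 1, by omega⟩
    rw [sum_range_succ, sum_range_succ', sum_range_succ', sum_congr rfl
      (g := fun k => a (k + 1))]
    · simp [halfWeight]; ring
    · intro k hk
      have : k < n := by simpa using hk
      simp [halfWeight, this.ne]
  simp_rw [mul_add]
  rw [sum_add_distrib, half (fun k => F (circleNode N k)), half (fun k => F (-circleNode N k)),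
    two_mul, sum_range_add]
  have hshift : ∑ k ∈ range N, F (circleNode N (N + k)) =
      ∑ k ∈ range N, F (-circleNode N (k + 1)) := by
    rw [← sum_range_reflect (fun k => F (-circleNode N (k + 1)))]
    refine sum_congr rfl fun k hk => ?_
    have hk' : k < N := by simpa using hk
    rw [show N - 1 - k + 1 = N - k by omega, ← hF (-circleNode N (N - k))]
    congr 1
    simp only [circleNode]
    push_cast [Nat.cast_sub hk'.le]
    field_simp; ring
  have hs := sum_range_succ' (fun k => F (-circleNode N k)) N
  rw [sum_range_succ] at hs
  have hpi : F (-circleNode N N) = F (circleNode N N) := by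
    rw [← hF]; congr 1; simp only [circleNode]; field_simp; ring
  have h0 : F (-circleNode N 0) = F (circleNode N 0) := by simp [circleNode]
  rw [hshift]
  rw [hpi, h0] at hs ⊢
  linarith

theorem nodeKernel_periodic (N : ℕ) : Function.Periodic (nodeKernel N) (2 * Real.pi) := by
  intro t
  simp only [nodeKernel]
  congr 1
  refine sum_congr rfl fun j _ => ?_
  rw [mul_add, show (j : ℝ) * (2 * Real.pi) = (j : ℕ) * (2 * Real.pi) by rfl,
    Real.cos_add_nat_mul_two_pi]

theorem sum_abs_interpWeight_sq_le {N : ℕ} (hN : 1 ≤ N) (x : ℝ) :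
    (∑ k ∈ range (N + 1), |interpWeight N k x|) ^ 2 ≤ 2 * N / 3 + 1 := by
  refine le_trans ?_ (sum_abs_nodeKernel_sq_le hN (Real.arccos x))
  rw [← sum_halfWeight_mul hN (fun t => |nodeKernel N (Real.arccos x - t)|)]
  · gcongr with k _
    rw [interpWeight_eq hN, abs_mul, abs_of_nonneg (halfWeight_nonneg N k)]
    exact mul_le_mul_of_nonneg_left (abs_add_le _ _) (halfWeight_nonneg N k)
  · intro t
    simp only
    rw [← sub_sub, (nodeKernel_periodic N).sub_eq]

theorem sum_interpWeight_mul_cos {N : ℕ} (hN : 1 ≤ N) {l : ℕ} (hl : l ≤ N) (x : ℝ) :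
    ∑ k ∈ range (N + 1), interpWeight N k x * Real.cos (l * circleNode N k) =
      Real.cos (l * Real.arccos x) := by
  have h := sum_nodeKernel_mul_cos hN hl (Real.arccos x) 0
  rw [← sum_halfWeight_mul hN
    (fun t => nodeKernel N (Real.arccos x - t) * Real.cos (l * t + 0))] at h
  · refine Eq.trans (sum_congr rfl fun k _ => ?_) (h.trans ?_)
    · rw [interpWeight_eq hN, add_zero, add_zero, mul_neg, Real.cos_neg]; ring
    · split_ifs with h'
      · simp [h']
      · simp
  · intro t
    simp only
    rw [← sub_sub, (nodeKernel_periodic N).sub_eq, mul_add, add_zero, add_zero,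
      Real.cos_add_nat_mul_two_pi]

/-! ### Aliasing of the Chebyshev polynomials of degree above `N`. -/

/-- The interpolation error of the `l`-th Chebyshev polynomial at `x`. -/
noncomputable def aliasError (N : ℕ) (x : ℝ) (l : ℕ) : ℝ :=
  Real.cos (l * Real.arccos x) -
    ∑ k ∈ range (N + 1), interpWeight N k x * Real.cos (l * circleNode N k)

theorem aliasError_of_le {N : ℕ} (hN : 1 ≤ N) {l : ℕ} (hl : l ≤ N) (x : ℝ) :
    aliasError N x l = 0 := by
  rw [aliasError, sum_interpWeight_mul_cos hN hl, sub_self]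

theorem sin_mul_circleNode {N : ℕ} (hN : 1 ≤ N) (k : ℕ) : Real.sin (N * circleNode N k) = 0 := by
  have hN0 : (N : ℝ) ≠ 0 := by exact_mod_cast (by omega : N ≠ 0)
  rw [circleNode, show (N : ℝ) * (Real.pi * (k / N)) = k * Real.pi by field_simp,
    Real.sin_nat_mul_pi]

/-- `cos ((a + N) t)` and `cos ((a - N) t)` differ by `2 sin (a t) sin (N t)`, which vanishes at the
nodes. The two polynomials therefore have the same interpolant. -/
theorem aliasError_add {N : ℕ} (hN : 1 ≤ N) (x : ℝ) (a l : ℕ)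
    (hl : a = N + l ∨ N = a + l) :
    aliasError N x (a + N) = aliasError N x l -
      2 * Real.sin (a * Real.arccos x) * Real.sin (N * Real.arccos x) := by
  have key : ∀ t : ℝ, Real.cos ((a + N : ℕ) * t) = Real.cos (l * t) -
      2 * Real.sin (a * t) * Real.sin (N * t) := by
    intro t
    have h : Real.cos (l * t) = Real.cos (a * t - N * t) := by
      rcases hl with h | h
      · rw [h]; congr 1; push_cast; ring
      · rw [h, ← Real.cos_neg]; congr 1; push_cast; ring
    rw [h, Real.cos_sub]
    push_cast
    rw [add_mul, Real.cos_add]; ring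
  rw [aliasError, aliasError, key]
  simp_rw [key, sin_mul_circleNode hN]
  simp only [mul_zero, sub_zero]
  ring

/-- The interpolation error of the Chebyshev polynomial of degree `N + l`, divided by
`-sin (N arccos x)`, as a function of `θ = arccos x` and `n = 2 N`. -/
noncomputable def aliasCoeff (n : ℕ) (θ : ℝ) (l : ℕ) : ℝ :=
  ∑ i ∈ range (l / n + 1), 2 * Real.sin ((l - n * i : ℕ) * θ)

theorem aliasCoeff_of_lt {n l : ℕ} (h : l < n) (θ : ℝ) :
    aliasCoeff n θ l = 2 * Real.sin (l * θ) := by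
  simp [aliasCoeff, Nat.div_eq_of_lt h]

theorem aliasCoeff_add {n : ℕ} (hn : 0 < n) (l : ℕ) (θ : ℝ) :
    aliasCoeff n θ (l + n) = aliasCoeff n θ l + 2 * Real.sin ((l + n : ℕ) * θ) := by
  rw [aliasCoeff, Nat.add_div_right l hn, sum_range_succ', aliasCoeff]
  congr 1
  refine sum_congr rfl fun i _ => ?_
  rw [show l + n - n * (i + 1) = l - n * i by rw [mul_add, mul_one]; omega]

/-- Induction in steps of `2N`. For `l < 2N` the reflected degree `|l - N|` is at most `N`, so it
carries no error. -/
theorem aliasError_eq {N : ℕ} (hN : 1 ≤ N) (x : ℝ) (l : ℕ) :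
    aliasError N x (N + l) =
      -Real.sin (N * Real.arccos x) * aliasCoeff (2 * N) (Real.arccos x) l := by
  induction l using Nat.strong_induction_on with
  | _ l ih =>
    rcases lt_or_ge l (2 * N) with h | h
    · rw [aliasCoeff_of_lt h, add_comm, aliasError_add hN x l (max l N - min l N),
        aliasError_of_le hN]
      · ring
      · rcases le_total l N with h' | h' <;> simp [h'] <;> omega
      · rcases le_total l N with h' | h' <;> simp [h']
    · obtain ⟨m, rfl⟩ : ∃ m, l = m + 2 * N := ⟨l - 2 * N, by omega⟩
      rw [aliasCoeff_add (by omega), mul_add, ← ih m (by omega),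
        show N + (m + 2 * N) = (m + 2 * N) + N by ring,
        aliasError_add hN x (m + 2 * N) (N + m) (Or.inl (by ring))]
      ring

theorem abs_aliasCoeff_le (n : ℕ) (θ : ℝ) (l : ℕ) :
    |aliasCoeff n θ l| ≤ 2 * (l + 1) := by
  refine (abs_sum_le_sum_abs _ _).trans ((sum_le_sum (g := fun _ => (2 : ℝ)) fun i _ => ?_).trans ?_)
  · rw [abs_mul, abs_two]
    linarith [Real.abs_sin_le_one ((l - n * i : ℕ) * θ)]
  · have : ((l / n : ℕ) : ℝ) ≤ l := by exact_mod_cast Nat.div_le_self l n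
    simp; linarith

/-! ### The weighted sum of the squared errors -/

theorem summable_geometric_mul_sq {q : ℝ} (h0 : 0 < q) (h1 : q < 1) :
    Summable fun l : ℕ => q ^ l * (2 * ((l : ℝ) + 1)) ^ 2 := by
  have hq : ‖q‖ < 1 := by rwa [Real.norm_of_nonneg h0.le]
  have a := summable_pow_mul_geometric_of_norm_lt_one 2 hq
  have b := summable_pow_mul_geometric_of_norm_lt_one 1 hq
  have c := summable_pow_mul_geometric_of_norm_lt_one 0 hq
  refine ((a.mul_left 4).add ((b.mul_left 8).add (c.mul_left 4))).congr fun l => ?_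
  ring

theorem summable_of_abs_le {q : ℝ} (h0 : 0 < q) (h1 : q < 1) {E : Type*} [NormedAddCommGroup E]
    [CompleteSpace E] {f : ℕ → E} (hf : ∀ l, ‖f l‖ ≤ q ^ l * (2 * ((l : ℝ) + 1)) ^ 2) :
    Summable f :=
  Summable.of_norm_bounded (summable_geometric_mul_sq h0 h1) hf

/-- Squaring the recursion `c (l + n) = c l + d (l + n)`, with `d l = 2 sin (l θ)`, and summing
against `q ^ (l + n)`. The first `n` terms cancel because `c = d` there. -/
theorem tsum_sq_sub_tsum_sq {q : ℝ} (h0 : 0 < q) (h1 : q < 1) {n : ℕ} (hn : 0 < n) (θ : ℝ) :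
    (1 - q ^ n) * ∑' l : ℕ, q ^ l * aliasCoeff n θ l ^ 2 =
      ∑' l : ℕ, q ^ l * (2 * Real.sin (l * θ)) ^ 2 + 2 * q ^ n *
        ∑' l : ℕ, q ^ l * (aliasCoeff n θ l * (2 * Real.sin ((l + n : ℕ) * θ))) := by
  have hd : ∀ (l : ℕ) (t : ℝ), |2 * Real.sin t| ≤ 2 * ((l : ℝ) + 1) := fun l t => by
    rw [abs_mul, abs_two]
    have := Real.abs_sin_le_one t
    have : (0 : ℝ) ≤ l := Nat.cast_nonneg l
    linarith
  have hc := abs_aliasCoeff_le n θ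
  have hql : ∀ l : ℕ, |q ^ l| = q ^ l := fun l => abs_of_pos (by positivity)
  have s1 : Summable fun l : ℕ => q ^ l * aliasCoeff n θ l ^ 2 :=
    summable_of_abs_le h0 h1 fun l => by
      rw [Real.norm_eq_abs, abs_mul, hql, abs_pow]
      gcongr
      exact hc l
  have s2 : Summable fun l : ℕ => q ^ l * (2 * Real.sin (l * θ)) ^ 2 :=
    summable_of_abs_le h0 h1 fun l => by
      rw [Real.norm_eq_abs, abs_mul, hql, abs_pow]
      gcongr
      exact hd l _
  have s3 : Summable fun l : ℕ =>
      q ^ l * (aliasCoeff n θ l * (2 * Real.sin ((l + n : ℕ) * θ))) :=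
    summable_of_abs_le h0 h1 fun l => by
      rw [Real.norm_eq_abs, abs_mul, hql, abs_mul, sq]
      gcongr
      · exact hc l
      · exact hd l _
  have e := (s1.sub s2).sum_add_tsum_nat_add n
  rw [sum_eq_zero, zero_add, s1.tsum_sub s2] at e
  · have e2 : ∀ l : ℕ, q ^ (l + n) * aliasCoeff n θ (l + n) ^ 2 -
        q ^ (l + n) * (2 * Real.sin ((l + n : ℕ) * θ)) ^ 2 =
        q ^ n * (q ^ l * aliasCoeff n θ l ^ 2 + 2 *
          (q ^ l * (aliasCoeff n θ l * (2 * Real.sin ((l + n : ℕ) * θ))))) := by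
      intro l
      rw [aliasCoeff_add hn, pow_add]; ring
    simp_rw [e2] at e
    rw [tsum_mul_left, s1.tsum_add (s3.mul_left 2), tsum_mul_left] at e
    linarith
  · intro l hl
    rw [aliasCoeff_of_lt (by simpa using hl), sub_self]

/-- The same recursion as an identity of generating functions at `q exp (i θ)`. It determines the
mixed sum left over in `tsum_sq_sub_tsum_sq`. -/
theorem tsum_aliasCoeff_mul_exp {q : ℝ} (h0 : 0 < q) (h1 : q < 1) {n : ℕ} (hn : 0 < n) (θ : ℝ) :
    (1 - q ^ n * Complex.exp ((n * θ : ℝ) * Complex.I)) *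
      ∑' l : ℕ, ((q ^ l * aliasCoeff n θ l : ℝ) : ℂ) * Complex.exp ((l * θ : ℝ) * Complex.I) =
      ∑' l : ℕ, ((q ^ l * (2 * Real.sin (l * θ)) : ℝ) : ℂ) *
        Complex.exp ((l * θ : ℝ) * Complex.I) := by
  have hd : ∀ (l : ℕ) (t : ℝ), |2 * Real.sin t| ≤ (2 * ((l : ℝ) + 1)) ^ 2 := fun l t => by
    rw [abs_mul, abs_two]
    have := Real.abs_sin_le_one t
    have : (0 : ℝ) ≤ l := Nat.cast_nonneg l
    nlinarith
  have hc : ∀ l : ℕ, |aliasCoeff n θ l| ≤ (2 * ((l : ℝ) + 1)) ^ 2 := fun l => by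
    have := abs_aliasCoeff_le n θ l
    have : (0 : ℝ) ≤ l := Nat.cast_nonneg l
    nlinarith
  have hql : ∀ l : ℕ, |q ^ l| = q ^ l := fun l => abs_of_pos (by positivity)
  have s1 : Summable fun l : ℕ =>
      ((q ^ l * aliasCoeff n θ l : ℝ) : ℂ) * Complex.exp ((l * θ : ℝ) * Complex.I) :=
    summable_of_abs_le h0 h1 fun l => by
      rw [norm_mul, Complex.norm_exp_ofReal_mul_I, mul_one, Complex.norm_real, Real.norm_eq_abs,
        abs_mul, hql]
      gcongr
      exact hc l
  have s2 : Summable fun l : ℕ => ((q ^ l * (2 * Real.sin (l * θ)) : ℝ) : ℂ) *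
      Complex.exp ((l * θ : ℝ) * Complex.I) :=
    summable_of_abs_le h0 h1 fun l => by
      rw [norm_mul, Complex.norm_exp_ofReal_mul_I, mul_one, Complex.norm_real, Real.norm_eq_abs,
        abs_mul, hql]
      gcongr
      exact hd l _
  have e := (s1.sub s2).sum_add_tsum_nat_add n
  rw [sum_eq_zero, zero_add, s1.tsum_sub s2] at e
  · have e2 : ∀ l : ℕ, ((q ^ (l + n) * aliasCoeff n θ (l + n) : ℝ) : ℂ) *
        Complex.exp (((l + n : ℕ) * θ : ℝ) * Complex.I) -
        ((q ^ (l + n) * (2 * Real.sin ((l + n : ℕ) * θ)) : ℝ) : ℂ) *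
        Complex.exp (((l + n : ℕ) * θ : ℝ) * Complex.I) =
        q ^ n * Complex.exp ((n * θ : ℝ) * Complex.I) * (((q ^ l * aliasCoeff n θ l : ℝ) : ℂ) *
          Complex.exp ((l * θ : ℝ) * Complex.I)) := by
      intro l
      have : Complex.exp (((l + n : ℕ) * θ : ℝ) * Complex.I) =
          Complex.exp ((l * θ : ℝ) * Complex.I) * Complex.exp ((n * θ : ℝ) * Complex.I) := by
        rw [← Complex.exp_add]; congr 1; push_cast; ring
      rw [this, aliasCoeff_add hn, pow_add]
      push_cast
      ring
    simp_rw [e2] at e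
    rw [tsum_mul_left] at e
    linear_combination -e
  · intro l hl
    rw [aliasCoeff_of_lt (by simpa using hl), sub_self]

/-- Since `2 sin (l θ) exp (i l θ) = -i (exp (2 i l θ) - 1)`, this is a difference of two geometric
series. -/
theorem tsum_sin_mul_exp {q : ℝ} (h0 : 0 < q) (h1 : q < 1) (θ : ℝ) :
    ∑' l : ℕ, ((q ^ l * (2 * Real.sin (l * θ)) : ℝ) : ℂ) *
        Complex.exp ((l * θ : ℝ) * Complex.I) =
      ((q * Real.sin (2 * θ) / ((1 - q) ^ 2 + 4 * q * Real.sin θ ^ 2) : ℝ) : ℂ) +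
      ((2 * q * Real.sin θ ^ 2 * (1 + q) /
        ((1 - q) * ((1 - q) ^ 2 + 4 * q * Real.sin θ ^ 2)) : ℝ) : ℂ) * Complex.I := by
  set z : ℂ := q * Complex.exp ((2 * θ : ℝ) * Complex.I) with hz
  have hzn : ‖z‖ < 1 := by
    rw [hz, norm_mul, Complex.norm_exp_ofReal_mul_I, mul_one, Complex.norm_real,
      Real.norm_of_nonneg h0.le]; exact h1
  have hqn : ‖(q : ℂ)‖ < 1 := by
    rw [Complex.norm_real, Real.norm_of_nonneg h0.le]; exact h1
  have hs := (hasSum_geometric_of_norm_lt_one hzn).sub (hasSum_geometric_of_norm_lt_one hqn)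
  have hs2 := hs.mul_left (-Complex.I)
  have hterm : (fun l : ℕ => ((q ^ l * (2 * Real.sin (l * θ)) : ℝ) : ℂ) *
      Complex.exp ((l * θ : ℝ) * Complex.I)) = fun l => -Complex.I * (z ^ l - (q : ℂ) ^ l) := by
    ext l
    have e1 : z ^ l = q ^ l * (Complex.exp ((l * θ : ℝ) * Complex.I) *
        Complex.exp ((l * θ : ℝ) * Complex.I)) := by
      rw [hz, mul_pow, ← Complex.exp_nat_mul, ← Complex.exp_add]
      congr 2; push_cast; ring
    have e2 : Complex.exp ((l * θ : ℝ) * Complex.I) * Complex.exp (-(l * θ : ℝ) * Complex.I) =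
        1 := by
      rw [← Complex.exp_add]; simp
    have e3 : ((2 * Real.sin (l * θ) : ℝ) : ℂ) = (Complex.exp (-(l * θ : ℝ) * Complex.I) -
        Complex.exp ((l * θ : ℝ) * Complex.I)) * Complex.I := by
      push_cast
      rw [Complex.sin]; ring
    rw [e1, Complex.ofReal_mul, e3]
    push_cast at e2 ⊢
    linear_combination (q : ℂ) ^ l * Complex.I * e2
  rw [hterm, hs2.tsum_eq]
  have hq1 : 0 < 1 - q := by linarith
  have hΔ : 0 < (1 - q) ^ 2 + 4 * q * Real.sin θ ^ 2 := by positivity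
  have hinv : (1 - z)⁻¹ = (((1 - q * Real.cos (2 * θ)) /
      ((1 - q) ^ 2 + 4 * q * Real.sin θ ^ 2) : ℝ) : ℂ) + ((q * Real.sin (2 * θ) /
      ((1 - q) ^ 2 + 4 * q * Real.sin θ ^ 2) : ℝ) : ℂ) * Complex.I := by
    have hns : (1 - q * Real.cos (2 * θ)) * (1 - q * Real.cos (2 * θ)) +
        q * Real.sin (2 * θ) * (q * Real.sin (2 * θ)) =
        (1 - q) ^ 2 + 4 * q * Real.sin θ ^ 2 := by
      have a := Real.sin_sq_add_cos_sq (2 * θ)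
      have b := Real.cos_two_mul θ
      have c := Real.sin_sq_add_cos_sq θ
      linear_combination q ^ 2 * a - 2 * q * b - 4 * q * c
    rw [hz, Complex.exp_mul_I, ← Complex.ofReal_cos, ← Complex.ofReal_sin]
    have hr : ∀ a b : ℝ, ((a : ℂ) + b * Complex.I).re = a := fun a b => by simp
    have hi : ∀ a b : ℝ, ((a : ℂ) + b * Complex.I).im = b := fun a b => by simp
    apply Complex.ext
    · rw [hr, Complex.inv_re, Complex.normSq_apply, ← hns]
      simp [-Complex.ofReal_cos, -Complex.ofReal_sin]
    · rw [hi, Complex.inv_im, Complex.normSq_apply, ← hns]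
      simp [-Complex.ofReal_cos, -Complex.ofReal_sin]
  rw [hinv]
  have b := Real.cos_two_mul θ
  have c := Real.sin_sq_add_cos_sq θ
  have hre : 1 / (1 - q) - (1 - q * Real.cos (2 * θ)) /
      ((1 - q) ^ 2 + 4 * q * Real.sin θ ^ 2) = 2 * q * Real.sin θ ^ 2 * (1 + q) /
        ((1 - q) * ((1 - q) ^ 2 + 4 * q * Real.sin θ ^ 2)) := by
    rw [div_sub_div _ _ hq1.ne' hΔ.ne']
    congr 1
    rw [b]; linear_combination (2 * q - 2 * q ^ 2) * c
  rw [← hre]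
  push_cast
  linear_combination ((q:ℂ) * Complex.sin (2 * θ) / ((1 - q) ^ 2 + 4 * q * Complex.sin θ ^ 2)) * (-Complex.I_sq)

/-- After `a³ b ≤ a b`, the mixed term is split by the arithmetic-geometric inequality. The weight
`27/64 = (3/4)³` is the least value of `(1 - r)³` for `r ≤ 1/4`. -/
theorem sin_sq_mul_le_of_sq_add_sq {a b r : ℝ} (ha : 0 ≤ a) (hb : 0 ≤ b) (hab : a ^ 2 + b ^ 2 = 1)
    (hr0 : 0 ≤ r) (hr : r ≤ 1 / 4) :
    a ^ 2 * (1 - r ^ 2) + 2 * r * (a ^ 3 * b) ≤ (1 - r) * ((1 - r) ^ 2 + 4 * r * a ^ 2) := by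
  have ha1 : a ≤ 1 := by nlinarith
  have h1 : a ^ 3 * b ≤ a * b := by
    have : a * b * (1 - a ^ 2) ≥ 0 := by
      have : 0 ≤ 1 - a ^ 2 := by nlinarith
      positivity
    nlinarith
  have h2 : 2 * r * (a * b) ≤ 27 / 64 * b ^ 2 + 3 / 4 * r * a ^ 2 := by
    nlinarith [sq_nonneg (b - 64 / 27 * r * a), mul_nonneg hr0 (sq_nonneg a),
      mul_nonneg (mul_nonneg hr0 (sub_nonneg.2 hr)) (sq_nonneg a)]
  have h3 : 27 / 64 * b ^ 2 + 3 / 4 * r * a ^ 2 ≤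
      (1 - r) * (b ^ 2 * (1 - r) ^ 2 + a ^ 2 * (r * (1 + r))) := by
    have e1 : 27 / 64 ≤ (1 - r) ^ 3 := by
      have : (3 / 4 : ℝ) ^ 3 ≤ (1 - r) ^ 3 := by gcongr; linarith
      linarith
    have e2 : 3 / 4 * r ≤ (1 - r) * (r * (1 + r)) := by nlinarith [mul_nonneg hr0 hr0]
    nlinarith [mul_le_mul_of_nonneg_right e1 (sq_nonneg b),
      mul_le_mul_of_nonneg_right e2 (sq_nonneg a)]
  have h4 : (1 - r) * ((1 - r) ^ 2 + 4 * r * a ^ 2) - a ^ 2 * (1 - r ^ 2) =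
      (1 - r) * (b ^ 2 * (1 - r) ^ 2 + a ^ 2 * (r * (1 + r))) := by
    rw [show b ^ 2 = 1 - a ^ 2 by linarith]; ring
  nlinarith [mul_le_mul_of_nonneg_left h1 hr0]

theorem four_mul_abs_sin_two_mul_le {q : ℝ} (h0 : 0 < q) (h1 : q < 1) (θ : ℝ) :
    4 * |q * Real.sin (2 * θ) / ((1 - q) ^ 2 + 4 * q * Real.sin θ ^ 2)| ≤
      (1 + q) / (1 - q) := by
  have hq1 : 0 < 1 - q := by linarith
  have hΔ : 0 < (1 - q) ^ 2 + 4 * q * Real.sin θ ^ 2 := by positivity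
  rw [abs_div, abs_of_pos hΔ, mul_div_assoc', div_le_div_iff₀ hΔ hq1, Real.sin_two_mul, abs_mul,
    abs_mul, abs_mul, abs_two, abs_of_pos h0, ← sq_abs (Real.sin θ)]
  have hc := Real.abs_cos_le_one θ
  set a := |Real.sin θ| with ha
  have ha0 : 0 ≤ a := abs_nonneg _
  have : 4 * (q * (2 * a * |Real.cos θ|)) * (1 - q) ≤ 8 * q * (1 - q) * a := by
    nlinarith [mul_le_mul_of_nonneg_left hc (mul_nonneg (mul_nonneg h0.le hq1.le) ha0)]
  refine this.trans ?_
  have key : 0 ≤ (1 + q) * ((1 + q) * ((1 - q) ^ 2 + 4 * q * a ^ 2) - 8 * q * (1 - q) * a) := by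
    have : (1 + q) * ((1 + q) * ((1 - q) ^ 2 + 4 * q * a ^ 2) - 8 * q * (1 - q) * a) =
        4 * q * ((1 + q) * a - (1 - q)) ^ 2 + (1 - q) ^ 2 * (1 - q) ^ 2 := by ring
    rw [this]; positivity
  have := nonneg_of_mul_nonneg_right key (by linarith : 0 < 1 + q)
  linarith

/-- Eliminating the generating function from the two recursions gives `(1 - r) M Γ = 2 A' (1 - r²) +
4 r β D` exactly, with `r = q ^ n`, `M = |1 - r exp (2 i v)|²` and `D = sin (2 v)`. Both `2 A'` and
`4 |β|` are at most `T`, which leaves an inequality in `r` and `v` alone. -/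
theorem sin_sq_mul_tsum_le {q : ℝ} (h0 : 0 < q) (h1 : q < 1) {n : ℕ} (hn : 0 < n) {θ v : ℝ}
    (hv : n * θ = 2 * v) (hr : q ^ n ≤ 1 / 4) :
    Real.sin v ^ 2 * ∑' l : ℕ, q ^ l * aliasCoeff n θ l ^ 2 ≤ (1 + q) / (1 - q) := by
  have hq1 : 0 < 1 - q := by linarith
  have hΔ : 0 < (1 - q) ^ 2 + 4 * q * Real.sin θ ^ 2 := by positivity
  have hr0 : 0 < q ^ n := by positivity
  have eΓ := tsum_sq_sub_tsum_sq h0 h1 hn θ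
  have eY := tsum_aliasCoeff_mul_exp h0 h1 hn θ
  have eY0 := tsum_sin_mul_exp h0 h1 θ
  have hβ := four_mul_abs_sin_two_mul_le h0 h1 θ
  have hd : ∀ (l : ℕ) (t : ℝ), |2 * Real.sin t| ≤ (2 * ((l : ℝ) + 1)) ^ 2 := fun l t => by
    rw [abs_mul, abs_two]
    have := Real.abs_sin_le_one t
    have : (0 : ℝ) ≤ l := Nat.cast_nonneg l
    nlinarith
  have hc : ∀ l : ℕ, |aliasCoeff n θ l| ≤ (2 * ((l : ℝ) + 1)) ^ 2 := fun l => by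
    have := abs_aliasCoeff_le n θ l
    have : (0 : ℝ) ≤ l := Nat.cast_nonneg l
    nlinarith
  have hql : ∀ l : ℕ, |q ^ l| = q ^ l := fun l => abs_of_pos (by positivity)
  have s1 : Summable fun l : ℕ =>
      ((q ^ l * aliasCoeff n θ l : ℝ) : ℂ) * Complex.exp ((l * θ : ℝ) * Complex.I) :=
    summable_of_abs_le h0 h1 fun l => by
      rw [norm_mul, Complex.norm_exp_ofReal_mul_I, mul_one, Complex.norm_real, Real.norm_eq_abs,
        abs_mul, hql]
      gcongr
      exact hc l
  have s2 : Summable fun l : ℕ => ((q ^ l * (2 * Real.sin (l * θ)) : ℝ) : ℂ) *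
      Complex.exp ((l * θ : ℝ) * Complex.I) :=
    summable_of_abs_le h0 h1 fun l => by
      rw [norm_mul, Complex.norm_exp_ofReal_mul_I, mul_one, Complex.norm_real, Real.norm_eq_abs,
        abs_mul, hql]
      gcongr
      exact hd l _
  have eA : ∑' l : ℕ, q ^ l * (2 * Real.sin (l * θ)) ^ 2 =
      2 * (∑' l : ℕ, ((q ^ l * (2 * Real.sin (l * θ)) : ℝ) : ℂ) *
        Complex.exp ((l * θ : ℝ) * Complex.I)).im := by
    rw [Complex.im_tsum s2, ← tsum_mul_left]
    congr 1; ext l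
    rw [Complex.im_ofReal_mul, Complex.exp_ofReal_mul_I_im]; ring
  have eX : ∑' l : ℕ, q ^ l * (aliasCoeff n θ l * (2 * Real.sin ((l + n : ℕ) * θ))) =
      2 * (Complex.exp ((n * θ : ℝ) * Complex.I) *
        ∑' l : ℕ, ((q ^ l * aliasCoeff n θ l : ℝ) : ℂ) *
          Complex.exp ((l * θ : ℝ) * Complex.I)).im := by
    rw [← tsum_mul_left, Complex.im_tsum (s1.mul_left _), ← tsum_mul_left]
    congr 1; ext l
    rw [mul_left_comm (Complex.exp _), ← Complex.exp_add, ← add_mul, ← Complex.ofReal_add, Complex.im_ofReal_mul,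
      Complex.exp_ofReal_mul_I_im, show (n : ℝ) * θ + l * θ = (l + n : ℕ) * θ by push_cast; ring]
    ring
  rw [eA, eX] at eΓ
  rw [eY0] at eY eΓ
  set Γ := ∑' l : ℕ, q ^ l * aliasCoeff n θ l ^ 2
  set Y := ∑' l : ℕ, ((q ^ l * aliasCoeff n θ l : ℝ) : ℂ) * Complex.exp ((l * θ : ℝ) * Complex.I)
  set β := q * Real.sin (2 * θ) / ((1 - q) ^ 2 + 4 * q * Real.sin θ ^ 2)
  set A' := 2 * q * Real.sin θ ^ 2 * (1 + q) /
        ((1 - q) * ((1 - q) ^ 2 + 4 * q * Real.sin θ ^ 2)) with hA'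
  set T := (1 + q) / (1 - q) with hT
  have hT0 : 0 < T := by positivity
  have hA0 : 0 ≤ A' := by positivity
  have hAT : 2 * A' ≤ T := by
    rw [hA', hT, mul_div_assoc', div_le_div_iff₀ (by positivity) hq1]
    have : 0 ≤ (1 + q) * (1 - q) * (1 - q) ^ 2 := by positivity
    nlinarith
  rw [hv] at eY eΓ
  set r := q ^ n
  have hr' : ((q : ℂ)) ^ n = (r : ℂ) := by push_cast [r]; rfl
  rw [hr', Complex.exp_mul_I, ← Complex.ofReal_cos, ← Complex.ofReal_sin] at eY
  rw [Complex.exp_mul_I, ← Complex.ofReal_cos, ← Complex.ofReal_sin] at eΓ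
  have hre := congrArg Complex.re eY
  have him := congrArg Complex.im eY
  simp [-Complex.ofReal_cos, -Complex.ofReal_sin] at hre him eΓ
  set p := Y.re
  set w := Y.im
  have hCD := Real.sin_sq_add_cos_sq (2 * v)
  set C := Real.cos (2 * v) with hC
  set D := Real.sin (2 * v) with hD
  set M := 1 - 2 * r * C + r ^ 2 with hM
  have hcs := Real.sin_sq_add_cos_sq v
  have hMS : M = (1 - r) ^ 2 + 4 * r * Real.sin v ^ 2 := by
    rw [hM, hC, Real.cos_two_mul]; linear_combination -4 * r * hcs
  have main : (1 - r) * M * Γ = 2 * A' * (1 - r ^ 2) + 4 * r * β * D := by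
    have hM2 : M = (1 - r * C) ^ 2 + (r * D) ^ 2 := by
      rw [hM]; linear_combination -r ^ 2 * hCD
    have hp : M * p = β * (1 - r * C) - A' * (r * D) := by
      rw [hM2]; linear_combination (1 - r * C) * hre - (r * D) * him
    have hw : M * w = A' * (1 - r * C) + β * (r * D) := by
      rw [hM2]; linear_combination (1 - r * C) * him + (r * D) * hre
    have e1 : (1 - r) * M * Γ = 2 * A' * M + 4 * r * (C * (M * w) + D * (M * p)) := by
      linear_combination M * eΓ
    rw [e1, hp, hw, hM]
    linear_combination (-4 * r ^ 2 * A') * hCD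
  have hM0 : 0 < (1 - r) * M := by
    have : 0 < 1 - r := by linarith
    rw [hMS]; positivity
  have habs := sin_sq_mul_le_of_sq_add_sq (abs_nonneg (Real.sin v)) (abs_nonneg (Real.cos v))
    (by rw [sq_abs, sq_abs]; exact hcs) hr0.le hr
  rw [sq_abs, ← hMS] at habs
  have hβD : 4 * (β * D) ≤ T * (2 * |Real.sin v| * |Real.cos v|) := by
    have : |D| = 2 * |Real.sin v| * |Real.cos v| := by
      rw [hD, Real.sin_two_mul, abs_mul, abs_mul, abs_two]
    rw [← this]
    calc 4 * (β * D) ≤ 4 * |β * D| := by gcongr; exact le_abs_self _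
      _ = (4 * |β|) * |D| := by rw [abs_mul]; ring
      _ ≤ T * |D| := by gcongr
  have hr2 : 0 ≤ 1 - r ^ 2 := by nlinarith
  have hs3 : |Real.sin v| ^ 3 = Real.sin v ^ 2 * |Real.sin v| := by
    rw [pow_succ, sq_abs]
  rw [hs3] at habs
  refine le_of_mul_le_mul_left ?_ hM0
  calc (1 - r) * M * (Real.sin v ^ 2 * Γ)
      = Real.sin v ^ 2 * (2 * A' * (1 - r ^ 2) + r * (4 * (β * D))) := by
        linear_combination Real.sin v ^ 2 * main
    _ ≤ Real.sin v ^ 2 * (T * (1 - r ^ 2) + r * (T * (2 * |Real.sin v| * |Real.cos v|))) := by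
        gcongr
    _ = T * (Real.sin v ^ 2 * (1 - r ^ 2) + 2 * r * (Real.sin v ^ 2 * |Real.sin v| *
          |Real.cos v|)) := by ring
    _ ≤ T * ((1 - r) * M) := by gcongr
    _ = (1 - r) * M * T := by ring

theorem sum_aliasError_sq_le {q : ℝ} (h0 : 0 < q) (h1 : q < 1) {N : ℕ} (hN : 1 ≤ N)
    (hy : q ^ N ≤ 1 / 2) (x : ℝ) (m : ℕ) :
    ∑ l ∈ range m, q ^ l * aliasError N x l ^ 2 ≤ q ^ N * ((1 + q) / (1 - q)) := by
  have hterm : ∀ l, 0 ≤ q ^ l * aliasError N x l ^ 2 := fun l => by positivity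
  have h2 : ∑ l ∈ range m, q ^ l * aliasError N x l ^ 2 ≤
      ∑ l ∈ range (N + m), q ^ l * aliasError N x l ^ 2 :=
    sum_le_sum_of_subset_of_nonneg (by
      intro l hl; simp at hl ⊢; omega) fun l _ _ => hterm l
  refine h2.trans ?_
  rw [sum_range_add, sum_eq_zero, zero_add]
  · have e : ∀ l ∈ range m, q ^ (N + l) * aliasError N x (N + l) ^ 2 =
        q ^ N * Real.sin (N * Real.arccos x) ^ 2 *
          (q ^ l * aliasCoeff (2 * N) (Real.arccos x) l ^ 2) := by
      intro l _
      rw [aliasError_eq hN, pow_add]; ring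
    rw [sum_congr rfl e, ← mul_sum, mul_assoc]
    gcongr
    refine le_trans ?_ (sin_sq_mul_tsum_le h0 h1 (n := 2 * N) (θ := Real.arccos x)
      (v := N * Real.arccos x) (by omega) (by push_cast; ring) ?_)
    · refine mul_le_mul_of_nonneg_left ?_ (sq_nonneg _)
      refine Summable.sum_le_tsum _ (fun l _ => by positivity) ?_
      refine summable_of_abs_le h0 h1 fun l => ?_
      rw [Real.norm_eq_abs, abs_mul, abs_of_pos (by positivity : 0 < q ^ l), abs_pow]
      gcongr
      exact abs_aliasCoeff_le _ _ l
    · rw [pow_mul']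
      -- The aliasing period is `2N`, so the hypothesis `q ^ N ≤ 1/2` supplies exactly the required
      -- `r = q ^ (2N) ≤ 1/4`.
      have : 0 ≤ q ^ N := by positivity
      nlinarith
  · intro l hl
    rw [aliasError_of_le hN (by simp at hl; omega)]; simp

end ChebPrice

namespace ChebPrice

/-! ### Laurent expansion on a Bernstein ellipse -/

open Finset

/-- The Joukowski map. -/
noncomputable def joukowski (w : ℂ) : ℂ := (w + w⁻¹) / 2

/-- `joukowski w ∓ 1 = (w ∓ 1)² / (2 w)`, and the parallelogram law adds the squares. This is why
the map sends an annulus into a confocal ellipse. -/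
theorem norm_joukowski {w : ℂ} (hw : w ≠ 0) :
    ‖joukowski w - 1‖ + ‖joukowski w + 1‖ = ‖w‖ + ‖w‖⁻¹ := by
  have e1 : joukowski w - 1 = (w - 1) ^ 2 / (2 * w) := by
    rw [joukowski]; field_simp; ring
  have e2 : joukowski w + 1 = (w + 1) ^ 2 / (2 * w) := by
    rw [joukowski]; field_simp; ring
  have hn : ‖w‖ ≠ 0 := norm_ne_zero_iff.2 hw
  rw [e1, e2, norm_div, norm_div, norm_pow, norm_pow, norm_mul, ← add_div]
  have h := parallelogram_law_with_norm ℝ w 1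
  simp only [norm_one] at h
  have : ‖w - 1‖ ^ 2 + ‖w + 1‖ ^ 2 = 2 * (‖w‖ ^ 2 + 1) := by linarith
  rw [this, Complex.norm_ofNat]
  field_simp

theorem add_inv_lt_iff {r s : ℝ} (hr : 1 < r) (hs : 0 < s) :
    s + s⁻¹ < r + r⁻¹ ↔ r⁻¹ < s ∧ s < r := by
  have hr0 : 0 < r := by linarith
  have e : r + r⁻¹ - (s + s⁻¹) = (r - s) * (s - r⁻¹) / s := by field_simp; ring
  have hr1 : r⁻¹ < r := (inv_lt_one_of_one_lt₀ hr).trans hr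
  rw [← sub_pos, e, div_pos_iff_of_pos_right hs, mul_pos_iff]
  constructor
  · rintro (⟨a, b⟩ | ⟨a, b⟩)
    · exact ⟨by linarith, by linarith⟩
    · linarith
  · rintro ⟨a, b⟩
    exact Or.inl ⟨by linarith, by linarith⟩

theorem joukowski_mem_bernstein {ϱ : ℝ} (hϱ : 1 < ϱ) {w : ℂ} (h1 : ϱ⁻¹ < ‖w‖) (h2 : ‖w‖ < ϱ) :
    joukowski w ∈ bernstein ϱ := by
  have hw : 0 < ‖w‖ := (inv_pos.2 (by linarith)).trans h1
  rw [bernstein, Set.mem_ofPred_eq, norm_joukowski (norm_pos_iff.1 hw), add_inv_lt_iff hϱ hw]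
  exact ⟨h1, h2⟩

theorem exists_joukowski_eq {ϱ : ℝ} (hϱ : 1 < ϱ) {z : ℂ} (hz : z ∈ bernstein ϱ) :
    ∃ w : ℂ, ϱ⁻¹ < ‖w‖ ∧ ‖w‖ < ϱ ∧ joukowski w = z := by
  -- With `s² = z² - 1`, the preimages of `z` are `z + s` and its inverse `z - s`.
  obtain ⟨s, hs⟩ := IsAlgClosed.exists_pow_nat_eq (z ^ 2 - 1) (n := 2) (by norm_num)
  have hinv : (z + s) * (z - s) = 1 := by linear_combination -hs
  have hw : z + s ≠ 0 := left_ne_zero_of_mul_eq_one hinv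
  have hj : joukowski (z + s) = z := by
    rw [joukowski, inv_eq_of_mul_eq_one_right hinv]; ring
  have := norm_joukowski hw
  rw [hj] at this
  rw [bernstein, Set.mem_ofPred_eq, this, add_inv_lt_iff hϱ (norm_pos_iff.2 hw)] at hz
  exact ⟨z + s, hz.1, hz.2, hj⟩

theorem isOpen_bernstein (ϱ : ℝ) : IsOpen (bernstein ϱ) :=
  isOpen_lt (by fun_prop) continuous_const

theorem ofReal_mem_bernstein {ϱ : ℝ} (hϱ : 1 < ϱ) {x : ℝ} (hx : x ∈ Set.Icc (-1 : ℝ) 1) :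
    (x : ℂ) ∈ bernstein ϱ := by
  rw [bernstein, Set.mem_ofPred_eq]
  have e1 : ‖(x : ℂ) - 1‖ = 1 - x := by
    rw [← Complex.ofReal_one, ← Complex.ofReal_sub, Complex.norm_real, Real.norm_eq_abs,
      abs_of_nonpos (by linarith [hx.2])]; ring
  have e2 : ‖(x : ℂ) + 1‖ = x + 1 := by
    rw [← Complex.ofReal_one, ← Complex.ofReal_add, Complex.norm_real, Real.norm_eq_abs,
      abs_of_nonneg (by linarith [hx.1])]
  rw [e1, e2]
  have := (add_inv_lt_iff hϱ one_pos).2 ⟨inv_lt_one_of_one_lt₀ hϱ, hϱ⟩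
  simp at this
  linarith

instance : Fact (0 < 2 * Real.pi) := ⟨Real.two_pi_pos⟩

/-- The pull-back of `g` under the Joukowski map to the circle of radius `ρ`. -/
noncomputable def circlePullback (g : ℂ → ℂ) (ρ : ℝ) (t : AddCircle (2 * Real.pi)) : ℂ :=
  g (joukowski (ρ * (t.toCircle : ℂ)))

/-- The Laurent coefficients of `g ∘ joukowski`. -/
noncomputable def laurentCoeff (g : ℂ → ℂ) (k : ℤ) : ℂ := fourierCoeff (circlePullback g 1) k

theorem joukowski_circle_mem {ϱ ρ : ℝ} (hϱ : 1 < ϱ) (h1 : ϱ⁻¹ < ρ) (h2 : ρ < ϱ)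
    (t : AddCircle (2 * Real.pi)) : joukowski (ρ * (t.toCircle : ℂ)) ∈ bernstein ϱ := by
  have hρ : 0 < ρ := (inv_pos.2 (by linarith)).trans h1
  have : ‖(ρ : ℂ) * (t.toCircle : ℂ)‖ = ρ := by
    rw [norm_mul, Circle.norm_coe, mul_one, Complex.norm_real, Real.norm_of_nonneg hρ.le]
  exact joukowski_mem_bernstein hϱ (by rwa [this]) (by rwa [this])

theorem continuous_circlePullback {ϱ ρ : ℝ} (hϱ : 1 < ϱ) (h1 : ϱ⁻¹ < ρ) (h2 : ρ < ϱ) {g : ℂ → ℂ}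
    (hg : ContinuousOn g (bernstein ϱ)) : Continuous (circlePullback g ρ) := by
  have hρ : 0 < ρ := (inv_pos.2 (by linarith)).trans h1
  refine hg.comp_continuous ?_ (joukowski_circle_mem hϱ h1 h2)
  have hc : Continuous fun t : AddCircle (2 * Real.pi) => (ρ : ℂ) * (t.toCircle : ℂ) :=
    continuous_const.mul (continuous_subtype_val.comp AddCircle.continuous_toCircle)
  exact (hc.add (hc.inv₀ fun t => mul_ne_zero (by exact_mod_cast hρ.ne')
    (Circle.coe_ne_zero _))).div_const 2

theorem fourierCoeff_circlePullback (g : ℂ → ℂ) {ρ : ℝ} (hρ : 0 < ρ) (k : ℤ) :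
    fourierCoeff (circlePullback g ρ) k = ρ ^ k * ((2 * Real.pi * Complex.I)⁻¹ *
      ∮ w in C(0, ρ), w ^ (-k - 1) * g (joukowski w)) := by
  have hρ0 : (ρ : ℂ) ≠ 0 := by exact_mod_cast hρ.ne'
  have hpi : (Real.pi : ℂ) ≠ 0 := by exact_mod_cast Real.pi_ne_zero
  rw [fourierCoeff_eq_intervalIntegral _ _ 0, circleIntegral, zero_add]
  have : ∀ θ : ℝ, deriv (circleMap 0 ρ) θ •
      (circleMap 0 ρ θ ^ (-k - 1) * g (joukowski (circleMap 0 ρ θ))) =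
      (Complex.I * (ρ : ℂ) ^ (-k)) * (fourier (-k) (θ : AddCircle (2 * Real.pi)) •
        circlePullback g ρ (θ : AddCircle (2 * Real.pi))) := by
    intro θ
    have hexp : (AddCircle.toCircle (θ : AddCircle (2 * Real.pi)) : ℂ) = Complex.exp (θ * Complex.I) := by
      rw [AddCircle.toCircle_apply_mk, Circle.coe_exp]
      congr 1; push_cast; field_simp
    have hc : circleMap 0 ρ θ = ρ * Complex.exp (θ * Complex.I) := by simp [circleMap]
    have hne : circleMap 0 ρ θ ≠ 0 := by rw [hc]; exact mul_ne_zero hρ0 (Complex.exp_ne_zero _)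
    rw [deriv_circleMap, circlePullback, hexp, ← hc, fourier_coe_apply, smul_eq_mul, smul_eq_mul,
      zpow_sub_one₀ hne, circleMap_zero, mul_zpow, ← Complex.exp_int_mul]
    have : 2 * (Real.pi : ℂ) * Complex.I * ((-k : ℤ) : ℂ) * θ / ((2 * Real.pi : ℝ) : ℂ) =
        ((-k : ℤ) : ℂ) * (θ * Complex.I) := by
      push_cast; field_simp
    rw [this]
    have := Complex.exp_ne_zero (θ * Complex.I)
    field_simp
  simp_rw [this]
  rw [intervalIntegral.integral_const_mul, zpow_neg]
  have : (ρ : ℂ) ^ k ≠ 0 := zpow_ne_zero _ hρ0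
  rw [Complex.real_smul]
  push_cast
  field_simp

/-- By Cauchy's theorem in the annulus the contour integral does not depend on the radius. Hence one
family of coefficients, read off on the unit circle, serves every `ρ`. -/
theorem fourierCoeff_eq_mul_zpow {ϱ ρ : ℝ} (hϱ : 1 < ϱ) (h1 : ϱ⁻¹ < ρ) (h2 : ρ < ϱ) {g : ℂ → ℂ}
    (hg : DifferentiableOn ℂ g (bernstein ϱ)) (k : ℤ) :
    fourierCoeff (circlePullback g ρ) k = laurentCoeff g k * ρ ^ k := by
  have hϱ0 : 0 < ϱ⁻¹ := inv_pos.2 (by linarith)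
  have hρ : 0 < ρ := hϱ0.trans h1
  have hone : ϱ⁻¹ < 1 := inv_lt_one_of_one_lt₀ hϱ
  have key : ∀ a b : ℝ, ϱ⁻¹ < a → a ≤ b → b < ϱ →
      (∮ w in C(0, b), w ^ (-k - 1) * g (joukowski w)) =
      ∮ w in C(0, a), w ^ (-k - 1) * g (joukowski w) := by
    intro a b ha hab hb
    have hd : ∀ w : ℂ, a ≤ ‖w‖ → ‖w‖ ≤ b →
        DifferentiableAt ℂ (fun w => w ^ (-k - 1) * g (joukowski w)) w := by
      intro w hwa hwb
      have hw0 : w ≠ 0 := norm_pos_iff.1 (hϱ0.trans (ha.trans_le hwa))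
      refine (differentiableAt_zpow.2 (Or.inl hw0)).mul ?_
      refine DifferentiableAt.comp (f := joukowski) w ?_ ?_
      · exact hg.differentiableAt ((isOpen_bernstein ϱ).mem_nhds
          (joukowski_mem_bernstein hϱ (ha.trans_le hwa) (hwb.trans_lt hb)))
      · exact (differentiableAt_id.add (differentiableAt_inv hw0)).div_const 2
    refine Complex.circleIntegral_eq_of_differentiable_on_annulus_off_countable (hϱ0.trans ha) hab
      Set.countable_empty ?_ ?_
    · intro w hw
      simp at hw
      exact (hd w hw.2 hw.1).continuousAt.continuousWithinAt
    · intro w hw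
      simp at hw
      exact hd w hw.2.le hw.1.le
  rw [laurentCoeff, fourierCoeff_circlePullback g hρ, fourierCoeff_circlePullback g one_pos]
  have : (∮ w in C(0, ρ), w ^ (-k - 1) * g (joukowski w)) =
      ∮ w in C(0, 1), w ^ (-k - 1) * g (joukowski w) := by
    rcases le_total ρ 1 with h | h
    · exact (key ρ 1 h1 h hϱ).symm
    · exact key 1 ρ hone h h2
  rw [this]
  simp; ring

theorem sum_sq_fourierCoeff_le {F : C(AddCircle (2 * Real.pi), ℂ)} {V : ℝ} (hV : ∀ t, ‖F t‖ ≤ V)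
    (s : Finset ℤ) : ∑ k ∈ s, ‖fourierCoeff F k‖ ^ 2 ≤ V ^ 2 := by
  have hV0 : 0 ≤ V := (norm_nonneg _).trans (hV 0)
  have h := hasSum_sq_fourierCoeff (ContinuousMap.toLp (E := ℂ) 2 AddCircle.haarAddCircle ℂ F)
  simp_rw [fourierCoeff_toLp] at h
  refine (sum_le_hasSum s (fun _ _ => by positivity) h).trans ?_
  have hae := ContinuousMap.coeFn_toLp (p := 2) (𝕜 := ℂ) AddCircle.haarAddCircle F
  rw [integral_congr_ae (hae.mono fun t ht => by rw [ht])]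
  calc ∫ t, ‖F t‖ ^ 2 ∂AddCircle.haarAddCircle
      ≤ ∫ _, V ^ 2 ∂(AddCircle.haarAddCircle (T := 2 * Real.pi)) := by
        refine integral_mono_of_nonneg (ae_of_all _ fun t => by positivity)
          (integrable_const _) (ae_of_all _ fun t => ?_)
        exact pow_le_pow_left₀ (norm_nonneg _) (hV t) 2
    _ = V ^ 2 := by simp

theorem sum_laurentCoeff_sq_le {ϱ : ℝ} (hϱ : 1 < ϱ) {g : ℂ → ℂ} {V : ℝ}
    (hg : DifferentiableOn ℂ g (bernstein ϱ)) (hV : ∀ z ∈ bernstein ϱ, ‖g z‖ ≤ V)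
    {ρ : ℝ} (h1 : ϱ⁻¹ < ρ) (h2 : ρ < ϱ) (s : Finset ℤ) :
    ∑ k ∈ s, ‖laurentCoeff g k‖ ^ 2 * (ρ ^ k) ^ 2 ≤ V ^ 2 := by
  have hρ : 0 < ρ := (inv_pos.2 (by linarith)).trans h1
  refine le_of_eq_of_le (sum_congr rfl fun k _ => ?_) (sum_sq_fourierCoeff_le
    (F := ⟨circlePullback g ρ, continuous_circlePullback hϱ h1 h2 hg.continuousOn⟩)
    (fun t => hV _ (joukowski_circle_mem hϱ h1 h2 t)) s)
  change _ = ‖fourierCoeff (circlePullback g ρ) k‖ ^ 2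
  rw [fourierCoeff_eq_mul_zpow hϱ h1 h2 hg, norm_mul, mul_pow, norm_zpow, Complex.norm_real,
    Real.norm_of_nonneg hρ.le]

/-- Parseval on circles of radius `ρ < ϱ`, then `ρ → ϱ` in a finite sum. No boundary values of `g`
are needed. -/
theorem sum_laurentCoeff_sq_le_of_nat {ϱ : ℝ} (hϱ : 1 < ϱ) {g : ℂ → ℂ} {V : ℝ}
    (hg : DifferentiableOn ℂ g (bernstein ϱ)) (hV : ∀ z ∈ bernstein ϱ, ‖g z‖ ≤ V)
    (m : ℕ) : ∑ k ∈ range m, ‖laurentCoeff g k‖ ^ 2 * (ϱ ^ k) ^ 2 ≤ V ^ 2 := by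
  have hlim : Filter.Tendsto (fun ρ : ℝ => ∑ k ∈ range m, ‖laurentCoeff g k‖ ^ 2 * (ρ ^ k) ^ 2)
      (nhdsWithin ϱ (Set.Iio ϱ)) (nhds (∑ k ∈ range m, ‖laurentCoeff g k‖ ^ 2 * (ϱ ^ k) ^ 2)) :=
    ((Continuous.tendsto (by fun_prop) ϱ)).mono_left nhdsWithin_le_nhds
  refine le_of_tendsto hlim ?_
  have hlt : ϱ⁻¹ < ϱ := (inv_lt_one_of_one_lt₀ hϱ).trans hϱ
  filter_upwards [Ioo_mem_nhdsLT hlt] with ρ hρ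
  have := sum_laurentCoeff_sq_le hϱ hg hV hρ.1 hρ.2 ((range m).map Nat.castEmbedding)
  simpa using this

theorem hasSum_laurent {ϱ : ℝ} (hϱ : 1 < ϱ) {g : ℂ → ℂ} {V : ℝ}
    (hg : DifferentiableOn ℂ g (bernstein ϱ)) (hV : ∀ z ∈ bernstein ϱ, ‖g z‖ ≤ V)
    {w : ℂ} (h1 : ϱ⁻¹ < ‖w‖) (h2 : ‖w‖ < ϱ) :
    HasSum (fun k : ℤ => laurentCoeff g k * w ^ k) (g (joukowski w)) := by
  have hϱ0 : 0 < ϱ⁻¹ := inv_pos.2 (by linarith)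
  set ρ := ‖w‖ with hρdef
  have hρ : 0 < ρ := hϱ0.trans h1
  have hV0 : 0 ≤ V := (norm_nonneg _).trans (hV _ (joukowski_mem_bernstein hϱ h1 h2))
  let F : C(AddCircle (2 * Real.pi), ℂ) :=
    ⟨circlePullback g ρ, continuous_circlePullback hϱ h1 h2 hg.continuousOn⟩
  have hF : ∀ k, fourierCoeff F k = laurentCoeff g k * ρ ^ k :=
    fun k => fourierCoeff_eq_mul_zpow hϱ h1 h2 hg k
  have hbound : ∀ σ : ℝ, ϱ⁻¹ < σ → σ < ϱ → ∀ k : ℤ, ‖laurentCoeff g k‖ * σ ^ k ≤ V := by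
    intro σ hσ1 hσ2 k
    have hσ : 0 < σ := hϱ0.trans hσ1
    have := sum_laurentCoeff_sq_le hϱ hg hV hσ1 hσ2 {k}
    rw [sum_singleton, ← mul_pow] at this
    exact (pow_le_pow_iff_left₀ (by positivity) hV0 (by norm_num)).1 this
  have hsum : Summable (fourierCoeff F) := by
    have hfun : (fourierCoeff F) = fun k => laurentCoeff g k * (ρ : ℂ) ^ k := funext hF
    rw [hfun]
    -- A slightly larger circle gives geometric decay for `k ≥ 0`, a slightly smaller one for `k ≤
    -- 0`.
    obtain ⟨σ, hσ1, hσ2⟩ := exists_between h2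
    obtain ⟨σ', hσ1', hσ2'⟩ := exists_between h1
    have hσ : 0 < σ := hρ.trans hσ1
    have hσ' : 0 < σ' := hϱ0.trans hσ1'
    refine Summable.of_nat_of_neg ?_ ?_
    · refine Summable.of_norm_bounded (g := fun n : ℕ => V * (ρ / σ) ^ n)
        ((summable_geometric_of_lt_one (by positivity) ((div_lt_one hσ).2 hσ1)).mul_left V)
        fun n => ?_
      have := hbound σ (h1.trans hσ1) hσ2 n
      rw [norm_mul, norm_zpow, Complex.norm_real, Real.norm_of_nonneg hρ.le, div_pow,
        zpow_natCast]
      rw [zpow_natCast] at this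
      rw [mul_div_assoc', le_div_iff₀ (by positivity)]
      nlinarith [pow_pos hρ n]
    · refine Summable.of_norm_bounded (g := fun n : ℕ => V * (σ' / ρ) ^ n)
        ((summable_geometric_of_lt_one (by positivity) ((div_lt_one hρ).2 hσ2')).mul_left V)
        fun n => ?_
      have := hbound σ' hσ1' (hσ2'.trans h2) (-n)
      rw [norm_mul, norm_zpow, Complex.norm_real, Real.norm_of_nonneg hρ.le, div_pow,
        zpow_neg, zpow_natCast]
      rw [zpow_neg, zpow_natCast, mul_inv_le_iff₀ (by positivity)] at this
      rw [mul_inv_le_iff₀ (by positivity)]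
      have e : V * (σ' ^ n / ρ ^ n) * ρ ^ n = V * σ' ^ n := by field_simp
      rw [e]; exact this
  have hw0 : w ≠ 0 := norm_pos_iff.1 hρ
  have hp := has_pointwise_sum_fourier_series_of_summable hsum
    ((Complex.arg w : ℝ) : AddCircle (2 * Real.pi))
  have hpi : (Real.pi : ℂ) ≠ 0 := by exact_mod_cast Real.pi_ne_zero
  have hwpol : (ρ : ℂ) * Complex.exp (Complex.arg w * Complex.I) = w :=
    Complex.norm_mul_exp_arg_mul_I w
  convert hp using 1
  · ext k
    rw [hF, fourier_coe_apply, smul_eq_mul, mul_assoc]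
    congr 1
    conv_lhs => rw [← hwpol]
    rw [mul_zpow, ← Complex.exp_int_mul]
    congr 2; push_cast; field_simp
  · change _ = g (joukowski (ρ * _))
    rw [AddCircle.toCircle_apply_mk, Circle.coe_exp]
    conv_lhs => rw [← hwpol]
    congr 4; push_cast; field_simp

/-- The Joukowski map is invariant under `w ↦ w⁻¹`, which on the unit circle is `t ↦ -t`. -/
theorem laurentCoeff_neg (g : ℂ → ℂ) (k : ℤ) : laurentCoeff g (-k) = laurentCoeff g k := by
  rw [laurentCoeff, laurentCoeff, fourierCoeff, fourierCoeff, ← integral_neg_eq_self]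
  congr 1; ext t
  rw [neg_neg]
  congr 1
  · rw [fourier_apply, fourier_apply]; congr 2; simp
  · simp only [circlePullback, joukowski, Complex.ofReal_one, one_mul, AddCircle.toCircle_neg,
      Circle.coe_inv, inv_inv]
    rw [add_comm]

end ChebPrice

namespace ChebPrice

/-! ### One-dimensional interpolation on a Bernstein ellipse -/

open Finset

/-- The Chebyshev interpolation of degree `N` of a function of one complex variable. -/
noncomputable def interp (N : ℕ) (g : ℂ → ℂ) (x : ℝ) : ℂ :=
  ∑ k ∈ range (N + 1), (interpWeight N k x : ℂ) * g (Real.cos (circleNode N k) : ℝ)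

theorem hasSum_of_eq {β : Type*} {f g : β → ℂ} {a : ℂ} (h : HasSum f a) (e : ∀ k, g k = f k) :
    HasSum g a := by rwa [funext e]

/-- Average of the Laurent series at `exp (i t)` and `exp (-i t)`, both mapped to `cos t`. -/
theorem hasSum_cos {ϱ : ℝ} (hϱ : 1 < ϱ) {g : ℂ → ℂ} {V : ℝ}
    (hg : DifferentiableOn ℂ g (bernstein ϱ)) (hV : ∀ z ∈ bernstein ϱ, ‖g z‖ ≤ V) (t : ℝ) :
    HasSum (fun k : ℤ => laurentCoeff g k * (Real.cos (k * t) : ℝ)) (g (Real.cos t : ℝ)) := by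
  have hlt : ϱ⁻¹ < 1 := inv_lt_one_of_one_lt₀ hϱ
  have h1 : ∀ s : ℝ, HasSum (fun k : ℤ => laurentCoeff g k * Complex.exp (s * Complex.I) ^ k)
      (g (Real.cos s : ℝ)) := by
    intro s
    have := hasSum_laurent hϱ hg hV (w := Complex.exp (s * Complex.I))
      (by rwa [Complex.norm_exp_ofReal_mul_I]) (by rwa [Complex.norm_exp_ofReal_mul_I])
    rwa [show joukowski (Complex.exp (s * Complex.I)) = (Real.cos s : ℝ) by
      rw [joukowski, ← Complex.exp_neg, Complex.ofReal_cos, Complex.cos, neg_mul]] at this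
  have h2 := h1 (-t)
  rw [Real.cos_neg] at h2
  have h3 := ((h1 t).add h2).mul_left (1 / 2 : ℂ)
  have hf : (fun k : ℤ => laurentCoeff g k * (Real.cos (k * t) : ℝ)) = fun k : ℤ => 1 / 2 *
      (laurentCoeff g k * Complex.exp (t * Complex.I) ^ k +
        laurentCoeff g k * Complex.exp ((-t : ℝ) * Complex.I) ^ k) := by
    ext k
    rw [← Complex.exp_int_mul, ← Complex.exp_int_mul, Complex.ofReal_cos, Complex.cos]
    push_cast
    rw [show -((k : ℂ) * t) * Complex.I = k * (-t * Complex.I) by ring, mul_assoc]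
    ring
  rw [hf, show g (Real.cos t : ℝ) = 1 / 2 * (g (Real.cos t : ℝ) + g (Real.cos t : ℝ)) by ring]
  exact h3

theorem hasSum_sub_interp {ϱ : ℝ} (hϱ : 1 < ϱ) {g : ℂ → ℂ} {V : ℝ}
    (hg : DifferentiableOn ℂ g (bernstein ϱ)) (hV : ∀ z ∈ bernstein ϱ, ‖g z‖ ≤ V)
    {N : ℕ} (hN : 1 ≤ N) {x : ℝ} (hx : x ∈ Set.Icc (-1 : ℝ) 1) :
    HasSum (fun n : ℕ => 2 * (laurentCoeff g n * aliasError N x n)) (g x - interp N g x) := by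
  have hcos : Real.cos (Real.arccos x) = x := Real.cos_arccos hx.1 hx.2
  have h1 := hasSum_cos hϱ hg hV (Real.arccos x)
  rw [hcos] at h1
  have h2 := h1.sub (hasSum_sum (s := range (N + 1)) fun k _ =>
    (hasSum_cos hϱ hg hV (circleNode N k)).mul_left (interpWeight N k x : ℂ))
  have h3 : HasSum (fun k : ℤ => laurentCoeff g k * aliasError N x k.natAbs)
      (g x - interp N g x) := by
    refine hasSum_of_eq h2 ?_
    intro k
    have hk : ∀ t : ℝ, Real.cos ((k.natAbs : ℕ) * t) = Real.cos (k * t) := by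
      intro t
      rcases Int.natAbs_eq k with h | h
      · conv_rhs => rw [h]
        norm_num
      · conv_rhs => rw [h]
        rw [← Real.cos_neg]
        congr 1; rw [Int.cast_neg, Int.cast_natCast]; ring
    rw [aliasError, hk]
    simp_rw [hk]
    rw [Complex.ofReal_sub, mul_sub, Complex.ofReal_sum, mul_sum]
    congr 1
    refine sum_congr rfl fun j _ => ?_
    rw [Complex.ofReal_mul]; ring
  -- Folding `k` with `-k` counts the index `0` twice, which is harmless since constants are
  -- interpolated exactly.
  have h4 := h3.nat_add_neg
  rw [show aliasError N x (Int.natAbs 0) = 0 from aliasError_of_le hN (by simp) x] at h4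
  simp only [laurentCoeff_neg, Int.natAbs_neg, Int.natAbs_natCast, Complex.ofReal_zero, mul_zero,
    add_zero] at h4
  refine hasSum_of_eq h4 fun n => ?_
  ring

/-- Cauchy–Schwarz with weights `ϱ ^ n` and `ϱ ^ (-n)`: Parseval bounds one factor, the aliasing
estimate the other. -/
theorem norm_sub_interp_sq_le_of_small {ϱ : ℝ} (hϱ : 1 < ϱ) {g : ℂ → ℂ} {V : ℝ}
    (hg : DifferentiableOn ℂ g (bernstein ϱ)) (hV : ∀ z ∈ bernstein ϱ, ‖g z‖ ≤ V)
    {N : ℕ} (hN : 1 ≤ N) {x : ℝ} (hx : x ∈ Set.Icc (-1 : ℝ) 1) {q : ℝ} (hq : q = (ϱ ^ 2)⁻¹)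
    (hy : q ^ N ≤ 1 / 2) :
    ‖g x - interp N g x‖ ^ 2 ≤ 4 * V ^ 2 * (q ^ N * ((1 + q) / (1 - q))) := by
  have hϱ0 : 0 < ϱ := by linarith
  have hq0 : 0 < q := by rw [hq]; positivity
  have hq1 : q < 1 := by
    rw [hq]; exact inv_lt_one_of_one_lt₀ (by nlinarith)
  have h := (hasSum_sub_interp hϱ hg hV hN hx).tendsto_sum_nat
  refine le_of_tendsto ((h.norm).pow 2) (Filter.Eventually.of_forall fun m => ?_)
  have hb := sum_laurentCoeff_sq_le_of_nat hϱ hg hV m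
  have ha := sum_aliasError_sq_le hq0 hq1 hN hy x m
  have hcs := sum_mul_sq_le_sq_mul_sq (range m) (fun n => ‖laurentCoeff g n‖ * ϱ ^ n)
    (fun n => |aliasError N x n| / ϱ ^ n)
  have e1 : ∀ n ∈ range m, ‖laurentCoeff g n‖ * ϱ ^ n * (|aliasError N x n| / ϱ ^ n) =
      ‖laurentCoeff g n * aliasError N x n‖ := by
    intro n _
    rw [norm_mul, Complex.norm_real, Real.norm_eq_abs]; field_simp
  have e2 : ∀ n ∈ range m, (|aliasError N x n| / ϱ ^ n) ^ 2 = q ^ n * aliasError N x n ^ 2 := by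
    intro n _
    rw [div_pow, sq_abs, hq, inv_pow, ← pow_mul, ← pow_mul, mul_comm n]; field_simp
  rw [sum_congr rfl e1, sum_congr rfl e2, sum_congr rfl fun n _ => mul_pow _ _ 2] at hcs
  rw [← mul_sum, norm_mul, mul_pow, Complex.norm_ofNat]
  have h1 : ‖∑ n ∈ range m, laurentCoeff g n * (aliasError N x n : ℂ)‖ ^ 2 ≤
      (∑ n ∈ range m, ‖laurentCoeff g n * (aliasError N x n : ℂ)‖) ^ 2 := by
    gcongr; exact norm_sum_le _ _
  have h2 : (∑ n ∈ range m, ‖laurentCoeff g n‖ ^ 2 * (ϱ ^ n) ^ 2) *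
      ∑ n ∈ range m, q ^ n * aliasError N x n ^ 2 ≤
      V ^ 2 * (q ^ N * ((1 + q) / (1 - q))) := by
    gcongr
  linarith

/-! ### One-dimensional bounds valid for every degree `N ≥ 1`. -/

theorem norm_interp_le_lebesgue {ϱ : ℝ} (hϱ : 1 < ϱ) {g : ℂ → ℂ} {V : ℝ}
    (hV : ∀ z ∈ bernstein ϱ, ‖g z‖ ≤ V) {N : ℕ} (hN : 1 ≤ N) (x : ℝ) :
    ‖interp N g x‖ ≤ V * √(2 * N / 3 + 1) := by
  have hV0 : 0 ≤ V := (norm_nonneg _).trans (hV _ (ofReal_mem_bernstein hϱ (x := 0) (by norm_num)))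
  have hΛ : ∑ k ∈ range (N + 1), |interpWeight N k x| ≤ √(2 * N / 3 + 1) :=
    Real.le_sqrt_of_sq_le (sum_abs_interpWeight_sq_le hN x)
  refine (norm_sum_le _ _).trans ?_
  calc ∑ k ∈ range (N + 1), ‖(interpWeight N k x : ℂ) * g (Real.cos (circleNode N k) : ℝ)‖
      ≤ ∑ k ∈ range (N + 1), |interpWeight N k x| * V := by
        refine sum_le_sum fun k _ => ?_
        rw [norm_mul, Complex.norm_real, Real.norm_eq_abs]
        gcongr
        exact hV _ (ofReal_mem_bernstein hϱ ⟨Real.neg_one_le_cos _, Real.cos_le_one _⟩)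
    _ = V * ∑ k ∈ range (N + 1), |interpWeight N k x| := by rw [← sum_mul, mul_comm]
    _ ≤ _ := by gcongr

theorem norm_sub_interp_le {ϱ : ℝ} (hϱ : 1 < ϱ) {g : ℂ → ℂ} {V : ℝ}
    (hg : DifferentiableOn ℂ g (bernstein ϱ)) (hV : ∀ z ∈ bernstein ϱ, ‖g z‖ ≤ V)
    {N : ℕ} (hN : 1 ≤ N) {x : ℝ} (hx : x ∈ Set.Icc (-1 : ℝ) 1) {q : ℝ} (hq : q = (ϱ ^ 2)⁻¹) :
    ‖g x - interp N g x‖ ≤ 2 * V * √(q ^ N * ((1 + q) / (1 - q))) := by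
  have hϱ0 : 0 < ϱ := by linarith
  have hq0 : 0 < q := by rw [hq]; positivity
  have hq1 : q < 1 := by
    rw [hq]; exact inv_lt_one_of_one_lt₀ (by nlinarith)
  have hqq : 0 < 1 - q := by linarith
  have hV0 : 0 ≤ V := (norm_nonneg _).trans (hV _ (ofReal_mem_bernstein hϱ hx))
  rcases le_or_gt (q ^ N) (1 / 2) with hy | hy
  · have := norm_sub_interp_sq_le_of_small hϱ hg hV hN hx hq hy
    refine (pow_le_pow_iff_left₀ (norm_nonneg _) (by positivity) (two_ne_zero)).1 ?_
    rw [mul_pow, Real.sq_sqrt (by positivity)]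
    linarith
  · have hN0 : (1 : ℝ) ≤ N := by exact_mod_cast hN
    -- When `q ^ N > 1/2`, Bernoulli's inequality forces `N (1 - q) ≤ q`. The right-hand side of the
    -- claim is then so large that the trivial bound through the Lebesgue constant is enough.
    have hT : 2 * (N : ℝ) + 1 ≤ (1 + q) / (1 - q) := by
      have hb := one_add_mul_le_pow (a := q⁻¹ - 1) (by
        have : 0 < q⁻¹ := inv_pos.2 hq0
        linarith) N
      rw [add_sub_cancel, inv_pow] at hb
      have h2 : (q ^ N)⁻¹ < 2 := by
        rw [inv_lt_comm₀ (by positivity) two_pos]; linarith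
      have h3 : (N : ℝ) * (q⁻¹ - 1) ≤ 1 := by linarith
      have h4 : (N : ℝ) * (1 - q) ≤ q := by
        have := mul_le_mul_of_nonneg_right h3 hq0.le
        have e : (N : ℝ) * (q⁻¹ - 1) * q = N * (1 - q) := by field_simp
        linarith
      rw [le_div_iff₀ hqq]
      linarith
    have hΛ := norm_interp_le_lebesgue hϱ hV hN x
    have hs : √(2 * (N : ℝ) / 3 + 1) ^ 2 = 2 * N / 3 + 1 := Real.sq_sqrt (by positivity)
    have h1 : ‖g x - interp N g x‖ ≤ V * (1 + √(2 * N / 3 + 1)) := by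
      refine (norm_sub_le _ _).trans ?_
      have := hV _ (ofReal_mem_bernstein hϱ hx)
      linarith
    refine h1.trans ?_
    rw [mul_comm 2 V, mul_assoc]
    gcongr
    rw [show (2 : ℝ) = √4 by rw [show (4 : ℝ) = 2 ^ 2 by norm_num]; simp, ← Real.sqrt_mul (by norm_num)]
    refine Real.le_sqrt_of_sq_le ?_
    have h5 : 1 / 2 * (2 * (N : ℝ) + 1) ≤ q ^ N * ((1 + q) / (1 - q)) := by gcongr
    rw [show √4 = 2 by rw [show (4 : ℝ) = 2 ^ 2 by norm_num]; simp]
    nlinarith [sq_nonneg (√(2 * (N : ℝ) / 3 + 1) - 1)]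

/-- By contradiction: otherwise `q < (2N - 3) / (2N + 3)`, and expanding `(1 + 6 / (2N - 3)) ^ (N -
1)` to second order shows that `q ^ (N - 1)` is too small. The first-order Bernoulli inequality is
replaced by `hbern`. -/
theorem lebesgue_le_of_one_lt {q : ℝ} (h0 : 0 < q) (h1 : q < 1) {N : ℕ} (hN : 1 ≤ N)
    (h : 1 < 4 * q ^ (N - 1) * (1 + q)) : 2 * (N : ℝ) / 3 + 1 ≤ 2 / (1 - q) := by
  have hqq : 0 < 1 - q := by linarith
  by_contra hcon
  push Not at hcon
  rw [div_lt_iff₀ hqq] at hcon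
  rcases Nat.lt_or_ge N 2 with h2 | h2
  · have : N = 1 := by omega
    subst this
    norm_num at hcon
    linarith
  have hN2 : (2 : ℝ) ≤ N := by exact_mod_cast h2
  -- `q` is less than `(2 N - 3) / (2 N + 3)`
  have hq : q * (2 * N + 3) < 2 * N - 3 := by nlinarith
  have hd : (0 : ℝ) < 2 * N - 3 := by linarith
  have hd0 := hd.ne'
  have hc : ((N - 1 : ℕ) : ℝ) = N - 1 := by push_cast [Nat.cast_sub hN]; ring
  have hx : 1 + 6 / (2 * (N : ℝ) - 3) ≤ q⁻¹ := by
    rw [le_inv_comm₀ (by positivity) h0]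
    have : (1 + 6 / (2 * (N : ℝ) - 3))⁻¹ = (2 * N - 3) / (2 * N + 3) := by
      field_simp; ring
    rw [this, le_div_iff₀ (by positivity)]
    exact hq.le
  have hbern : ∀ (x : ℝ) (n : ℕ), 0 ≤ x →
      1 + n * x + n * (n - 1) / 2 * x ^ 2 ≤ (1 + x) ^ n := by
    intro x n hx
    induction n with
    | zero => simp
    | succ n ih =>
      rw [pow_succ (1 + x)]
      have h3 : (0 : ℝ) ≤ (n : ℝ) * (n - 1) := by
        rcases n with _ | n
        · simp
        · push_cast
          have : (0 : ℝ) ≤ n := Nat.cast_nonneg n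
          nlinarith
      have h4 := mul_le_mul_of_nonneg_right ih (by linarith : 0 ≤ 1 + x)
      push_cast
      nlinarith [mul_nonneg h3 (pow_nonneg hx 3)]
  have hp : (1 + 6 / (2 * (N : ℝ) - 3)) ^ (N - 1) ≤ (q ^ (N - 1))⁻¹ := by
    rw [← inv_pow]
    gcongr
  have hb := hbern (6 / (2 * (N : ℝ) - 3)) (N - 1) (by positivity)
  rw [hc] at hb
  have hq1q : (1 + q) * (2 * N + 3) < 4 * N := by nlinarith
  have hlow : 4 * (1 + q) ≤ 1 + (N - 1) * (6 / (2 * (N : ℝ) - 3)) +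
      (N - 1) * (N - 1 - 1) / 2 * (6 / (2 * (N : ℝ) - 3)) ^ 2 := by
    have e : 1 + (N - 1) * (6 / (2 * (N : ℝ) - 3)) +
      (N - 1) * (N - 1 - 1) / 2 * (6 / (2 * (N : ℝ) - 3)) ^ 2 =
      ((2 * N - 3) ^ 2 + 6 * (N - 1) * (2 * N - 3) + 18 * (N - 1) * (N - 2)) /
        (2 * (N : ℝ) - 3) ^ 2 := by
      generalize 2 * (N : ℝ) - 3 = d at hd0 ⊢
      field_simp; ring
    have h16 : 4 * (1 + q) ≤ 16 * N / (2 * N + 3) := by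
      rw [le_div_iff₀ (by positivity)]; linarith
    refine h16.trans ?_
    rw [e, div_le_div_iff₀ (by positivity) (by positivity)]
    obtain ⟨m, hm⟩ : ∃ m : ℝ, (N : ℝ) = m + 2 ∧ 0 ≤ m := ⟨N - 2, by ring, by linarith⟩
    rw [hm.1]
    have := hm.2
    ring_nf
    nlinarith [mul_nonneg this this, mul_nonneg (mul_nonneg this this) this]
  have hfin : 4 * (1 + q) ≤ (q ^ (N - 1))⁻¹ := hlow.trans (hb.trans hp)
  rw [le_inv_comm₀ (by positivity) (by positivity), inv_eq_one_div,
    le_div_iff₀ (by positivity)] at hfin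
  linarith

/-- If `4 q ^ (N - 1) (1 + q) ≤ 1`, the error is at most `2 V s` with `s² = q / (4 (1 - q))`, and
`(1 + 2 s)² ≤ 2 + 8 s² = 2 / (1 - q)`. Otherwise the Lebesgue constant itself obeys the bound. -/
theorem norm_interp_le {ϱ : ℝ} (hϱ : 1 < ϱ) {g : ℂ → ℂ} {V : ℝ}
    (hg : DifferentiableOn ℂ g (bernstein ϱ)) (hV : ∀ z ∈ bernstein ϱ, ‖g z‖ ≤ V)
    {N : ℕ} (hN : 1 ≤ N) {x : ℝ} (hx : x ∈ Set.Icc (-1 : ℝ) 1) {q : ℝ} (hq : q = (ϱ ^ 2)⁻¹) :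
    ‖interp N g x‖ ≤ V * √(2 / (1 - q)) := by
  have hϱ0 : 0 < ϱ := by linarith
  have hq0 : 0 < q := by rw [hq]; positivity
  have hq1 : q < 1 := by
    rw [hq]; exact inv_lt_one_of_one_lt₀ (by nlinarith)
  have hqq : 0 < 1 - q := by linarith
  have hV0 : 0 ≤ V := (norm_nonneg _).trans (hV _ (ofReal_mem_bernstein hϱ hx))
  rcases le_or_gt (4 * q ^ (N - 1) * (1 + q)) 1 with h | h
  · have hy : q ^ N * ((1 + q) / (1 - q)) ≤ q / (4 * (1 - q)) := by
      rw [mul_div_assoc', div_le_div_iff₀ hqq (by positivity)]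
      have e : q ^ N = q ^ (N - 1) * q := by rw [← pow_succ, Nat.sub_add_cancel hN]
      rw [e]
      nlinarith [mul_le_mul_of_nonneg_right h (mul_nonneg hq0.le hqq.le)]
    have he := norm_sub_interp_le hϱ hg hV hN hx hq
    have h1 : ‖interp N g x‖ ≤ V * (1 + 2 * √(q / (4 * (1 - q)))) := by
      have h2 := hV _ (ofReal_mem_bernstein hϱ hx)
      have h3 : ‖interp N g x‖ ≤ ‖g x‖ + ‖g x - interp N g x‖ := by
        rw [norm_sub_rev]; exact norm_le_norm_add_norm_sub' _ _
      have h4 := Real.sqrt_le_sqrt hy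
      nlinarith [mul_le_mul_of_nonneg_left h4 hV0]
    refine h1.trans ?_
    gcongr
    refine Real.le_sqrt_of_sq_le ?_
    have hs : √(q / (4 * (1 - q))) ^ 2 = q / (4 * (1 - q)) := Real.sq_sqrt (by positivity)
    have e : 2 / (1 - q) = 2 + 8 * (q / (4 * (1 - q))) := by field_simp; ring
    rw [e]
    nlinarith [sq_nonneg (1 - 2 * √(q / (4 * (1 - q))))]
  · refine (norm_interp_le_lebesgue hϱ hV hN x).trans ?_
    gcongr
    exact lebesgue_le_of_one_lt hq0 hq1 hN h

end ChebPrice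

namespace ChebPrice

/-! ### Tensorized interpolation -/

open Finset

/-- The tensorized Chebyshev interpolation of a function of several complex variables. -/
noncomputable def multiInterp {D : ℕ} (N : Fin D → ℕ) (H : (Fin D → ℂ) → ℂ) (x : Fin D → ℝ) : ℂ :=
  ∑ k ∈ indices N, (∏ i, (interpWeight (N i) (k i) (x i) : ℂ)) * H (toC (node N k))

theorem chebInterp_eq_multiInterp {D : ℕ} (N : Fin D → ℕ) {h : (Fin D → ℝ) → ℝ}
    {H : (Fin D → ℂ) → ℂ} (hH : ∀ k, H (toC (node N k)) = h (node N k)) (x : Fin D → ℝ) :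
    (chebInterp N h x : ℂ) = multiInterp N H x := by
  have key : chebInterp N h x = ∑ k ∈ indices N, (∏ i, interpWeight (N i) (k i) (x i)) *
      h (node N k) := by
    simp only [chebInterp, chebCoeff, chebT, mul_sum, sum_mul]
    rw [sum_comm]
    refine sum_congr rfl fun k _ => ?_
    simp only [interpWeight, prod_mul_distrib]
    rw [Finset.prod_univ_sum, mul_sum, sum_mul]
    refine sum_congr rfl fun j _ => ?_
    simp only [prod_mul_distrib]
    ring
  rw [key, multiInterp]
  push_cast
  simp only [hH]

/-- The tensor weights factor, so the first coordinate can be interpolated last. This drives both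
inductions over the dimension. -/
theorem multiInterp_succ {D : ℕ} (N : Fin (D + 1) → ℕ) (H : (Fin (D + 1) → ℂ) → ℂ)
    (x : Fin (D + 1) → ℝ) :
    multiInterp N H x = interp (N 0)
      (fun ζ => multiInterp (Fin.tail N) (fun y => H (Fin.cons ζ y)) (Fin.tail x)) (x 0) := by
  simp only [interp, multiInterp, mul_sum]
  rw [← sum_product']
  refine sum_nbij' (fun k => (k 0, Fin.tail k)) (fun p => Fin.cons p.1 p.2) ?_ ?_ ?_ ?_ ?_
  · intro k hk
    simp only [indices, Fintype.mem_piFinset, mem_product] at hk ⊢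
    exact ⟨hk 0, fun i => hk i.succ⟩
  · intro p hp
    simp only [indices, Fintype.mem_piFinset, mem_product] at hp ⊢
    exact Fin.cases hp.1 hp.2
  · intro k _; simp
  · intro p _; simp
  · intro k _
    rw [Fin.prod_univ_succ, mul_assoc]
    congr 3
    ext i
    refine Fin.cases ?_ (fun i => ?_) i <;> simp [toC, node, circleNode, Fin.tail]

/-! ### Products of ellipses and the induction over the coordinates. -/

/-- The product of the open Bernstein ellipses. -/
def polyEllipse {D : ℕ} (ϱ : Fin D → ℝ) : Set (Fin D → ℂ) :=
  Set.univ.pi fun i => bernstein (ϱ i)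

theorem isOpen_polyEllipse {D : ℕ} (ϱ : Fin D → ℝ) : IsOpen (polyEllipse ϱ) :=
  isOpen_set_pi Set.finite_univ fun i _ => isOpen_bernstein (ϱ i)

theorem cons_mem_polyEllipse {D : ℕ} {ϱ : Fin (D + 1) → ℝ} {ζ : ℂ} {y : Fin D → ℂ}
    (hζ : ζ ∈ bernstein (ϱ 0)) (hy : y ∈ polyEllipse (Fin.tail ϱ)) :
    (Fin.cons ζ y : Fin (D + 1) → ℂ) ∈ polyEllipse ϱ := by
  intro i _
  refine Fin.cases ?_ (fun i => ?_) i
  · simpa using hζ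
  · exact hy i trivial

theorem toC_mem_polyEllipse {D : ℕ} {ϱ : Fin D → ℝ} (hϱ : ∀ i, 1 < ϱ i) {x : Fin D → ℝ}
    (hx : ∀ i, x i ∈ Set.Icc (-1 : ℝ) 1) : toC x ∈ polyEllipse ϱ :=
  fun i _ => ofReal_mem_bernstein (hϱ i) (hx i)

theorem node_mem_Icc {D : ℕ} (N k : Fin D → ℕ) (i : Fin D) :
    node N k i ∈ Set.Icc (-1 : ℝ) 1 :=
  ⟨Real.neg_one_le_cos _, Real.cos_le_one _⟩

theorem differentiable_cons_right {D : ℕ} (ζ : ℂ) :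
    Differentiable ℂ fun y : Fin D → ℂ => (Fin.cons ζ y : Fin (D + 1) → ℂ) := by
  refine differentiable_pi.2 fun i => ?_
  refine Fin.cases ?_ (fun i => ?_) i
  · simp
  · simpa using differentiable_apply i

theorem differentiable_cons_left {D : ℕ} (y : Fin D → ℂ) :
    Differentiable ℂ fun ζ : ℂ => (Fin.cons ζ y : Fin (D + 1) → ℂ) := by
  refine differentiable_pi.2 fun i => ?_
  refine Fin.cases ?_ (fun i => ?_) i
  · simp
  · simp

theorem differentiableOn_cons_right {D : ℕ} {ϱ : Fin (D + 1) → ℝ} {H : (Fin (D + 1) → ℂ) → ℂ}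
    (hH : DifferentiableOn ℂ H (polyEllipse ϱ)) {ζ : ℂ} (hζ : ζ ∈ bernstein (ϱ 0)) :
    DifferentiableOn ℂ (fun y => H (Fin.cons ζ y)) (polyEllipse (Fin.tail ϱ)) :=
  hH.comp (differentiable_cons_right ζ).differentiableOn fun _ hy => cons_mem_polyEllipse hζ hy

theorem differentiableOn_multiInterp_cons {D : ℕ} {ϱ : Fin (D + 1) → ℝ} (hϱ : ∀ i, 1 < ϱ i)
    {H : (Fin (D + 1) → ℂ) → ℂ} (hH : DifferentiableOn ℂ H (polyEllipse ϱ))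
    (N : Fin D → ℕ) (x : Fin D → ℝ) :
    DifferentiableOn ℂ (fun ζ => multiInterp N (fun y => H (Fin.cons ζ y)) x)
      (bernstein (ϱ 0)) := by
  refine DifferentiableOn.fun_sum fun k _ => DifferentiableOn.const_mul ?_ _
  exact hH.comp (differentiable_cons_left _).differentiableOn fun ζ hζ =>
    cons_mem_polyEllipse hζ (toC_mem_polyEllipse (fun i => hϱ i.succ) (node_mem_Icc N k))

theorem norm_multiInterp_le {D : ℕ} {ϱ : Fin D → ℝ} (hϱ : ∀ i, 1 < ϱ i) {H : (Fin D → ℂ) → ℂ}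
    {V : ℝ} (hH : DifferentiableOn ℂ H (polyEllipse ϱ)) (hV : ∀ z ∈ polyEllipse ϱ, ‖H z‖ ≤ V)
    {N : Fin D → ℕ} (hN : ∀ i, 1 ≤ N i) {x : Fin D → ℝ} (hx : ∀ i, x i ∈ Set.Icc (-1 : ℝ) 1) :
    ‖multiInterp N H x‖ ≤ V * √(∏ i, 2 / (1 - (ϱ i ^ 2)⁻¹)) := by
  induction D with
  | zero =>
    have : multiInterp N H x = H (toC x) := by
      simp only [multiInterp, indices, Finset.univ_eq_empty, Finset.prod_empty, one_mul]
      rw [Fintype.piFinset_of_isEmpty]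
      rw [Fintype.sum_unique]
      congr 1
      exact Subsingleton.elim _ _
    rw [this]
    simpa using hV _ (toC_mem_polyEllipse hϱ hx)
  | succ D ih =>
    rw [multiInterp_succ, Fin.prod_univ_succ, mul_comm (2 / _ : ℝ), Real.sqrt_mul (by
      refine Finset.prod_nonneg fun i _ => ?_
      have : (ϱ i.succ ^ 2)⁻¹ < 1 := inv_lt_one_of_one_lt₀ (by nlinarith [hϱ i.succ])
      have : 0 < 1 - (ϱ i.succ ^ 2)⁻¹ := by linarith
      positivity), ← mul_assoc]
    refine norm_interp_le (hϱ 0) (differentiableOn_multiInterp_cons hϱ hH _ _) ?_ (hN 0) (hx 0) rfl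
    intro ζ hζ
    exact ih (fun i => hϱ i.succ) (differentiableOn_cons_right hH hζ)
      (fun y hy => hV _ (cons_mem_polyEllipse hζ hy)) (fun i => hN i.succ) fun i => hx i.succ

theorem norm_sub_multiInterp_le {D : ℕ} {ϱ : Fin D → ℝ} (hϱ : ∀ i, 1 < ϱ i)
    {H : (Fin D → ℂ) → ℂ} {V : ℝ} (hH : DifferentiableOn ℂ H (polyEllipse ϱ))
    (hV : ∀ z ∈ polyEllipse ϱ, ‖H z‖ ≤ V) {N : Fin D → ℕ} (hN : ∀ i, 1 ≤ N i) {x : Fin D → ℝ}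
    (hx : ∀ i, x i ∈ Set.Icc (-1 : ℝ) 1) :
    ‖H (toC x) - multiInterp N H x‖ ≤
      2 * V * (√(∏ i, 2 / (1 - (ϱ i ^ 2)⁻¹)) * √(∑ i, (ϱ i ^ 2)⁻¹ ^ N i)) := by
  induction D with
  | zero =>
    have : multiInterp N H x = H (toC x) := by
      simp only [multiInterp, indices, Finset.univ_eq_empty, Finset.prod_empty, one_mul]
      rw [Fintype.piFinset_of_isEmpty]
      rw [Fintype.sum_unique]
      congr 1
      exact Subsingleton.elim _ _
    simp [this]
  | succ D ih =>
    have hV0 : 0 ≤ V := (norm_nonneg _).trans (hV _ (toC_mem_polyEllipse hϱ hx))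
    have hcons : (Fin.cons (x 0 : ℂ) (toC (Fin.tail x)) : Fin (D + 1) → ℂ) = toC x := by
      ext i
      refine Fin.cases ?_ (fun i => ?_) i <;> simp [toC, Fin.tail]
    have hx0 := ofReal_mem_bernstein (hϱ 0) (hx 0)
    have h1 := ih (fun i => hϱ i.succ) (differentiableOn_cons_right hH hx0)
      (fun y hy => hV _ (cons_mem_polyEllipse hx0 hy)) (fun i => hN i.succ) fun i => hx i.succ
    -- The interpolant in the remaining variables is analytic in the first one and bounded by `V
    -- √p`, so the one-dimensional error estimate applies to it.
    have h2 := norm_sub_interp_le (hϱ 0) (differentiableOn_multiInterp_cons hϱ hH (Fin.tail N)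
      (Fin.tail x)) (fun ζ hζ => norm_multiInterp_le (fun i => hϱ i.succ)
      (differentiableOn_cons_right hH hζ) (fun y hy => hV _ (cons_mem_polyEllipse hζ hy))
      (fun i => hN i.succ) fun i => hx i.succ) (hN 0) (hx 0) rfl
    rw [← multiInterp_succ] at h2
    change ‖H (Fin.cons (x 0 : ℂ) (toC (Fin.tail x))) - _‖ ≤ _ at h1
    rw [hcons] at h1
    rw [Fin.prod_univ_succ, Fin.sum_univ_succ]
    have hpos : ∀ i, 0 < 1 - (ϱ i ^ 2)⁻¹ := fun i => by
      have : (ϱ i ^ 2)⁻¹ < 1 := inv_lt_one_of_one_lt₀ (by nlinarith [hϱ i])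
      linarith
    change _ ≤ 2 * V * (√(∏ i : Fin D, 2 / (1 - (ϱ i.succ ^ 2)⁻¹)) *
      √(∑ i : Fin D, (ϱ i.succ ^ 2)⁻¹ ^ N i.succ)) at h1
    change _ ≤ 2 * (V * √(∏ i : Fin D, 2 / (1 - (ϱ i.succ ^ 2)⁻¹))) * _ at h2
    have hP : 0 ≤ ∏ i : Fin D, 2 / (1 - (ϱ i.succ ^ 2)⁻¹) :=
      Finset.prod_nonneg fun i _ => (div_pos two_pos (hpos _)).le
    have hS : 0 ≤ ∑ i : Fin D, (ϱ i.succ ^ 2)⁻¹ ^ N i.succ :=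
      Finset.sum_nonneg fun i _ => by positivity
    have hp0 := hpos 0
    have hq0 : 0 ≤ (ϱ 0 ^ 2)⁻¹ := by positivity
    generalize (∏ i : Fin D, 2 / (1 - (ϱ i.succ ^ 2)⁻¹)) = p at *
    generalize (∑ i : Fin D, (ϱ i.succ ^ 2)⁻¹ ^ N i.succ) = s at *
    generalize (ϱ 0 ^ 2)⁻¹ = q at *
    have hy : 0 ≤ q ^ N 0 := by positivity
    generalize q ^ N 0 = y at *
    have hT : 0 ≤ (1 + q) / (1 - q) := by positivity
    -- The norm factor of the new coordinate is `1 + T`, exactly what Cauchy–Schwarz for `(1, √T)`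
    -- and `(√s, √y)` needs.
    have eT : 2 / (1 - q) = 1 + (1 + q) / (1 - q) := by field_simp; ring
    rw [eT]
    generalize (1 + q) / (1 - q) = T at *
    rw [mul_comm (1 + T), Real.sqrt_mul hP, mul_assoc]
    rw [Real.sqrt_mul hy] at h2
    have hcs : √s + √y * √T ≤ √(1 + T) * √(y + s) := by
      rw [← Real.sqrt_mul (show 0 ≤ 1 + T by linarith) (y + s)]
      refine Real.le_sqrt_of_sq_le ?_
      have a := Real.sq_sqrt hS
      have b := Real.sq_sqrt hy
      have c := Real.sq_sqrt hT
      have e : (√s + √y * √T) ^ 2 + (√y - √s * √T) ^ 2 = (1 + √T ^ 2) * (√y ^ 2 + √s ^ 2) := by ring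
      rw [a, b, c] at e
      nlinarith [sq_nonneg (√y - √s * √T)]
    calc ‖H (toC x) - multiInterp N H x‖
        ≤ ‖H (toC x) - multiInterp (Fin.tail N) (fun y => H (Fin.cons (x 0 : ℂ) y)) (Fin.tail x)‖ +
          ‖multiInterp (Fin.tail N) (fun y => H (Fin.cons (x 0 : ℂ) y)) (Fin.tail x) -
            multiInterp N H x‖ := norm_sub_le_norm_sub_add_norm_sub _ _ _
      _ ≤ 2 * V * (√p * √s) + 2 * (V * √p) * (√y * √T) := add_le_add h1 h2
      _ = 2 * V * (√p * (√s + √y * √T)) := by ring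
      _ ≤ 2 * V * (√p * (√(1 + T) * √(y + s))) := by gcongr
      _ = _ := by ring

/-- The error bound on `[-1,1]^D`. -/
theorem abs_sub_chebInterp_le {D : ℕ} {ϱ : Fin D → ℝ} (hϱ : ∀ i, 1 < ϱ i)
    {H : (Fin D → ℂ) → ℂ} {V : ℝ} (hH : DifferentiableOn ℂ H (polyEllipse ϱ))
    (hV : ∀ z ∈ polyEllipse ϱ, ‖H z‖ ≤ V) {N : Fin D → ℕ} (hN : ∀ i, 1 ≤ N i)
    {h : (Fin D → ℝ) → ℝ} (hh : ∀ x, (∀ i, x i ∈ Set.Icc (-1 : ℝ) 1) → H (toC x) = h x)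
    {x : Fin D → ℝ} (hx : ∀ i, x i ∈ Set.Icc (-1 : ℝ) 1) :
    |h x - chebInterp N h x| ≤ (2 : ℝ) ^ ((D : ℝ) / 2 + 1) * V *
      √(∑ i, ϱ i ^ (-2 * (N i : ℤ)) * ∏ j, 1 / (1 - ϱ j ^ (-2 : ℤ))) := by
  have h1 := norm_sub_multiInterp_le hϱ hH hV hN hx
  rw [← chebInterp_eq_multiInterp N (fun k => hh _ (node_mem_Icc N k)), hh x hx,
    ← Complex.ofReal_sub, Complex.norm_real, Real.norm_eq_abs] at h1
  refine h1.trans_eq ?_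
  have e1 : ∀ i, ϱ i ^ (-2 : ℤ) = (ϱ i ^ 2)⁻¹ := fun i => by
    rw [zpow_neg]; norm_cast
  have e2 : ∀ i, ϱ i ^ (-2 * (N i : ℤ)) = (ϱ i ^ 2)⁻¹ ^ N i := fun i => by
    rw [zpow_mul, e1, zpow_natCast]
  have hpos : ∀ i, 0 < 1 - (ϱ i ^ 2)⁻¹ := fun i => by
    have : (ϱ i ^ 2)⁻¹ < 1 := inv_lt_one_of_one_lt₀ (by nlinarith [hϱ i])
    linarith
  simp_rw [e1, e2]
  rw [← Finset.sum_mul, Real.rpow_add_one two_ne_zero]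
  have e3 : ∏ i, 2 / (1 - (ϱ i ^ 2)⁻¹) = 2 ^ D * ∏ i, 1 / (1 - (ϱ i ^ 2)⁻¹) := by
    simp_rw [div_eq_mul_one_div (2 : ℝ)]
    rw [Finset.prod_mul_distrib]; simp
  have e4 : (2 : ℝ) ^ ((D : ℝ) / 2) = √(2 ^ D) := by
    rw [Real.sqrt_eq_rpow, ← Real.rpow_natCast, ← Real.rpow_mul (by norm_num)]
    congr 1; ring
  rw [e3, Real.sqrt_mul (by positivity), e4, Real.sqrt_mul (Finset.sum_nonneg fun i _ => by
    positivity)]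
  ring

end ChebPrice

namespace ChebPrice

/-! ### Integrals against a measure with integrable characteristic function -/

open scoped FourierTransform

section Inversion

variable {E : Type*} [NormedAddCommGroup E] [InnerProductSpace ℝ E] [FiniteDimensional ℝ E]
  [MeasurableSpace E] [BorelSpace E]

/-- The characteristic function of `μ`, rescaled by `2π`. -/
noncomputable def scaledCharFun (μ : Measure E) (w : E) : ℂ :=
  ∫ x, Complex.exp (((2 * Real.pi * ⟪x, w⟫ : ℝ) : ℂ) * Complex.I) ∂μ

/-- Fourier inversion for `ψ` followed by Fubini. The bilinear form `-innerₗ E` turns the general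
transform into the inverse one. -/
theorem integral_schwartz_eq (μ : Measure E) [IsFiniteMeasure μ] (ψ : SchwartzMap E ℂ) :
    ∫ x, ψ x ∂μ = ∫ w, 𝓕 (ψ : E → ℂ) w * scaledCharFun μ w := by
  have hc : Continuous fun p : E × E => (-innerₗ E) p.1 p.2 := by
    change Continuous fun p : E × E => -(⟪p.1, p.2⟫ : ℝ)
    fun_prop
  have h := VectorFourier.integral_fourierIntegral_smul_eq_flip (μ := volume) (ν := μ)
    (L := -innerₗ E) (e := Real.fourierChar) (f := 𝓕 (ψ : E → ℂ)) (g := fun _ => (1 : ℂ))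
    Real.continuous_fourierChar hc (by
      rw [← SchwartzMap.fourier_coe]; exact (𝓕 ψ).integrable) (integrable_const _)
  have e1 : ∀ x, VectorFourier.fourierIntegral Real.fourierChar volume (-innerₗ E)
      (𝓕 (ψ : E → ℂ)) x = ψ x := fun x => by
    change 𝓕⁻ (𝓕 (ψ : E → ℂ)) x = ψ x
    rw [Continuous.fourierInv_fourier_eq ψ.continuous ψ.integrable]
    rw [← SchwartzMap.fourier_coe]; exact (𝓕 ψ).integrable
  have e2 : ∀ w, VectorFourier.fourierIntegral Real.fourierChar μ (-innerₗ E).flip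
      (fun _ => (1 : ℂ)) w = scaledCharFun μ w := fun w => by
    simp only [VectorFourier.fourierIntegral, scaledCharFun]
    refine integral_congr_ae (Filter.Eventually.of_forall fun x => ?_)
    simp [Circle.smul_def, Real.fourierChar_apply, real_inner_comm]
  simpa only [e1, e2, smul_eq_mul, mul_one] using h

/-- The bounded density of a measure whose characteristic function is integrable. -/
noncomputable def invDensity (μ : Measure E) (x : E) : ℂ := 𝓕 (scaledCharFun μ) x

theorem integral_fourier_mul_eq {F Φ : E → ℂ} (hF : Integrable F) (hΦ : Integrable Φ) :
    ∫ w, 𝓕 F w * Φ w = ∫ x, F x * 𝓕 Φ x := by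
  have hc : Continuous fun p : E × E => (innerₗ E) p.1 p.2 := by
    change Continuous fun p : E × E => (⟪p.1, p.2⟫ : ℝ)
    fun_prop
  have h := VectorFourier.integral_fourierIntegral_smul_eq_flip (μ := volume) (ν := volume)
    (L := innerₗ E) (e := Real.fourierChar) Real.continuous_fourierChar hc hF hΦ
  rw [flip_innerₗ] at h
  exact h

theorem continuous_invDensity {μ : Measure E} (hΦ : Integrable (scaledCharFun μ)) :
    Continuous (invDensity μ) :=
  VectorFourier.fourierIntegral_continuous Real.continuous_fourierChar
    (L := innerₗ E) (by
      change Continuous fun p : E × E => (⟪p.1, p.2⟫ : ℝ)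
      fun_prop) hΦ

theorem norm_invDensity_le (μ : Measure E) (x : E) :
    ‖invDensity μ x‖ ≤ ∫ w, ‖scaledCharFun μ w‖ :=
  VectorFourier.norm_fourierIntegral_le_integral_norm _ _ _ _ _

/-- Known for smooth compactly supported functions. Both sides are continuous in `L¹(volume + μ)`,
where these are dense. -/
theorem integral_eq_integral_mul_invDensity {μ : Measure E} [IsFiniteMeasure μ]
    (hΦ : Integrable (scaledCharFun μ)) {F : E → ℂ} (hF : Integrable F) (hFμ : Integrable F μ) :
    ∫ x, F x ∂μ = ∫ x, F x * invDensity μ x := by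
  set C := ∫ w, ‖scaledCharFun μ w‖
  have hC : 0 ≤ C := integral_nonneg fun _ => norm_nonneg _
  have hmul : ∀ {u : E → ℂ}, Integrable u → Integrable fun x => u x * invDensity μ x :=
    fun hu => hu.mul_bdd (c := C) (continuous_invDensity hΦ).aestronglyMeasurable
      (Filter.Eventually.of_forall (norm_invDensity_le μ))
  refine eq_of_forall_dist_le fun ε hε => ?_
  have hsum : MemLp F 1 (volume + μ) := memLp_one_iff_integrable.2 (hF.add_measure hFμ)
  have : IsFiniteMeasureOnCompacts (volume + μ) :=
    ⟨fun K hK => by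
      rw [Measure.add_apply]; exact ENNReal.add_lt_top.2 ⟨hK.measure_lt_top, measure_lt_top μ K⟩⟩
  obtain ⟨g, hg1, hg2, hg3⟩ := hsum.exist_eLpNorm_sub_le (by simp) le_rfl
    (show 0 < ε / (1 + C) by positivity)
  have hgv : Integrable g := hg2.continuous.integrable_of_hasCompactSupport hg1
  have hgμ : Integrable g μ := hg2.continuous.integrable_of_hasCompactSupport hg1
  have hd := hF.sub hgv
  have hdμ := hFμ.sub hgμ
  have hsmall : (∫ x, ‖(F - g) x‖) + ∫ x, ‖(F - g) x‖ ∂μ ≤ ε / (1 + C) := by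
    rw [← integral_add_measure hd.norm hdμ.norm]
    rw [eLpNorm_one_eq_lintegral_enorm] at hg3
    rw [integral_norm_eq_lintegral_enorm (hd.add_measure hdμ).aestronglyMeasurable]
    exact ENNReal.toReal_le_of_le_ofReal (by positivity) hg3
  have hgeq : ∫ x, g x ∂μ = ∫ x, g x * invDensity μ x := by
    have := integral_schwartz_eq μ (hg1.toSchwartzMap hg2)
    rw [integral_fourier_mul_eq (SchwartzMap.integrable _) hΦ] at this
    exact this
  have hA : ∫ x, F x ∂μ = ∫ x, g x ∂μ + ∫ x, (F - g) x ∂μ := by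
    rw [← integral_add hgμ hdμ]; simp
  have hB : ∫ x, F x * invDensity μ x = (∫ x, g x * invDensity μ x) +
      ∫ x, (F - g) x * invDensity μ x := by
    rw [← integral_add (hmul hgv) (hmul hd)]; simp [← add_mul]
  rw [dist_eq_norm, hA, hB, hgeq, add_sub_add_left_eq_sub]
  have b1 : ‖∫ x, (F - g) x ∂μ‖ ≤ ∫ x, ‖(F - g) x‖ ∂μ := norm_integral_le_integral_norm _
  have b2 : ‖∫ x, (F - g) x * invDensity μ x‖ ≤ C * ∫ x, ‖(F - g) x‖ := by
    refine (norm_integral_le_integral_norm _).trans ?_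
    rw [← integral_const_mul]
    refine integral_mono (hmul hd).norm (hd.norm.const_mul C) fun x => ?_
    change ‖(F - g) x * invDensity μ x‖ ≤ C * ‖(F - g) x‖
    rw [norm_mul, mul_comm]
    exact mul_le_mul_of_nonneg_right (norm_invDensity_le μ x) (norm_nonneg _)
  have n1 : 0 ≤ ∫ x, ‖(F - g) x‖ := integral_nonneg fun _ => norm_nonneg _
  have n2 : 0 ≤ ∫ x, ‖(F - g) x‖ ∂μ := integral_nonneg fun _ => norm_nonneg _
  rw [le_div_iff₀ (by positivity)] at hsmall
  refine (norm_sub_le _ _).trans ?_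
  nlinarith [mul_nonneg hC n2]

/-- The density identity for indicators bounds `μ` by `C` times volume on sets of finite volume. The
constant `1 + C` is positive, so sets of infinite volume cause no trouble even if `C = 0`. -/
theorem measure_le_smul_volume {μ : Measure E} [IsFiniteMeasure μ]
    (hΦ : Integrable (scaledCharFun μ)) :
    μ ≤ ENNReal.ofReal (1 + ∫ w, ‖scaledCharFun μ w‖) • (volume : Measure E) := by
  set C := ∫ w, ‖scaledCharFun μ w‖
  have hC : 0 ≤ C := integral_nonneg fun _ => norm_nonneg _
  refine Measure.le_iff.2 fun s hs => ?_
  rw [Measure.smul_apply, smul_eq_mul]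
  by_cases hv : volume s = ⊤
  · rw [hv, ENNReal.mul_top (by simpa using by linarith)]
    exact le_top
  have hi : Integrable (s.indicator fun _ => (1 : ℂ)) :=
    (integrable_indicator_iff hs).2 (integrableOn_const hv)
  have hiμ : Integrable (s.indicator fun _ => (1 : ℂ)) μ :=
    (integrable_const _).indicator hs
  have h := integral_eq_integral_mul_invDensity hΦ hi hiμ
  rw [integral_indicator hs] at h
  have h2 : μ.real s ≤ C * volume.real s := by
    have : ‖∫ x in s, (1 : ℂ) ∂μ‖ = μ.real s := by simp
    rw [← this, h]
    have e : ∀ x, s.indicator (fun _ => (1 : ℂ)) x * invDensity μ x =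
        s.indicator (invDensity μ) x := fun x => by
      by_cases hx : x ∈ s <;> simp [hx]
    simp_rw [e]
    rw [integral_indicator hs]
    exact norm_setIntegral_le_of_norm_le_const (lt_top_iff_ne_top.2 hv)
      fun x _ => norm_invDensity_le μ x
  rw [← ENNReal.ofReal_toReal hv, ← ENNReal.ofReal_mul (by positivity),
    ← ENNReal.ofReal_toReal (measure_ne_top μ s)]
  refine ENNReal.ofReal_le_ofReal (h2.trans ?_)
  exact mul_le_mul_of_nonneg_right (by linarith) ENNReal.toReal_nonneg

theorem integrable_of_integrable_scaledCharFun {μ : Measure E} [IsFiniteMeasure μ]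
    (hΦ : Integrable (scaledCharFun μ)) {F : E → ℂ} (hF : Integrable F) : Integrable F μ :=
  (hF.smul_measure ENNReal.ofReal_ne_top).mono_measure (measure_le_smul_volume hΦ)

theorem integral_eq_integral_fourier_mul {μ : Measure E} [IsFiniteMeasure μ]
    (hΦ : Integrable (scaledCharFun μ)) {F : E → ℂ} (hF : Integrable F) :
    ∫ x, F x ∂μ = ∫ w, 𝓕 F w * scaledCharFun μ w := by
  rw [integral_fourier_mul_eq hF hΦ]
  exact integral_eq_integral_mul_invDensity hΦ hF (integrable_of_integrable_scaledCharFun hΦ hF)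

end Inversion

/-! ### The Fourier representation of an expectation -/

section Tilt

variable {d : ℕ} {Ω : Type*} [MeasurableSpace Ω] (P : Measure Ω)
  (η : EuclideanSpace ℝ (Fin d)) (Y : Ω → EuclideanSpace ℝ (Fin d))

/-- The distribution of `Y` under the tilted measure `exp (-⟪η, Y⟫) dP`. -/
noncomputable def tiltedLaw : Measure (EuclideanSpace ℝ (Fin d)) :=
  (P.withDensity fun ω => ENNReal.ofReal (Real.exp (-⟪η, Y ω⟫))).map Y

variable {P η Y}

theorem isFiniteMeasure_tiltedLaw (h : Integrable (fun ω => Real.exp (-⟪η, Y ω⟫)) P) :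
    IsFiniteMeasure (tiltedLaw P η Y) := by
  have := isFiniteMeasure_withDensity_ofReal h.2
  exact Measure.isFiniteMeasure_map _ _

theorem aemeasurable_exp_neg_inner (hY : AEMeasurable Y P) :
    AEMeasurable (fun ω => Real.exp (-⟪η, Y ω⟫)) P :=
  (Real.continuous_exp.measurable.comp
    (show Continuous fun y : EuclideanSpace ℝ (Fin d) => -⟪η, y⟫ by fun_prop).measurable).comp_aemeasurable hY

theorem integral_tiltedLaw (hY : AEMeasurable Y P) {F : EuclideanSpace ℝ (Fin d) → ℂ}
    (hF : StronglyMeasurable F) :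
    ∫ x, F x ∂tiltedLaw P η Y = ∫ ω, (Real.exp (-⟪η, Y ω⟫) : ℂ) * F (Y ω) ∂P := by
  rw [tiltedLaw, integral_map (hY.mono_ac (withDensity_absolutelyContinuous _ _))
    hF.aestronglyMeasurable, integral_withDensity_eq_integral_toReal_smul₀
    (aemeasurable_exp_neg_inner hY).ennreal_ofReal (by simp)]
  refine integral_congr_ae (Filter.Eventually.of_forall fun ω => ?_)
  simp [ENNReal.toReal_ofReal (Real.exp_pos _).le]

theorem integrable_tiltedLaw (hY : AEMeasurable Y P) {F : EuclideanSpace ℝ (Fin d) → ℂ}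
    (hF : StronglyMeasurable F) (hi : Integrable F (tiltedLaw P η Y)) :
    Integrable (fun ω => (Real.exp (-⟪η, Y ω⟫) : ℂ) * F (Y ω)) P := by
  rw [tiltedLaw, integrable_map_measure hF.aestronglyMeasurable
    (hY.mono_ac (withDensity_absolutelyContinuous _ _)),
    integrable_withDensity_iff_integrable_smul₀' 
    (aemeasurable_exp_neg_inner hY).ennreal_ofReal (by simp)] at hi
  refine hi.congr (Filter.Eventually.of_forall fun ω => ?_)
  simp [ENNReal.toReal_ofReal (Real.exp_pos _).le]

theorem scaledCharFun_tiltedLaw (hY : AEMeasurable Y P) (w : EuclideanSpace ℝ (Fin d)) :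
    scaledCharFun (tiltedLaw P η Y) w = dampedCharFun P η Y ((2 * Real.pi) • w) := by
  rw [scaledCharFun, integral_tiltedLaw hY (Continuous.stronglyMeasurable (by fun_prop)),
    dampedCharFun]
  refine integral_congr_ae (Filter.Eventually.of_forall fun ω => ?_)
  simp only [Complex.ofReal_exp, ← Complex.exp_add, inner_smul_left]
  congr 1
  rw [real_inner_comm w (Y ω)]
  push_cast
  rw [mul_add, ← mul_assoc Complex.I Complex.I, Complex.I_mul_I]
  simp
  ring

theorem fourier_damped (g : EuclideanSpace ℝ (Fin d) → ℝ) (w : EuclideanSpace ℝ (Fin d)) :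
    𝓕 (fun x => ((Real.exp ⟪η, x⟫ * g x : ℝ) : ℂ)) w =
      dampedFourier η g (-((2 * Real.pi) • w)) := by
  rw [Real.fourier_eq', dampedFourier]
  refine integral_congr_ae (Filter.Eventually.of_forall fun x => ?_)
  simp only [smul_eq_mul, inner_neg_left, inner_smul_left]
  congr 2
  rw [real_inner_comm x w]
  push_cast
  simp
  ring

/-- The factor `exp ⟪η, x⟫` of the damped payoff cancels the tilt of the law, so the expectation of
`g (Y ω)` is an integral of an `L¹` function against the tilted law. -/
theorem integrable_and_integral_eq (hY : AEMeasurable Y P)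
    (hη : Integrable (fun ω => Real.exp (-⟪η, Y ω⟫)) P)
    (hφ : Integrable fun w => dampedCharFun P η Y ((2 * Real.pi) • w))
    {g : EuclideanSpace ℝ (Fin d) → ℝ} (hg : Measurable g)
    (hgi : Integrable fun x => Real.exp ⟪η, x⟫ * g x) :
    Integrable (fun ω => g (Y ω)) P ∧ ((∫ ω, g (Y ω) ∂P : ℝ) : ℂ) =
      ∫ w, dampedFourier η g (-((2 * Real.pi) • w)) * dampedCharFun P η Y ((2 * Real.pi) • w) := by
  have := isFiniteMeasure_tiltedLaw hη
  have hΦ : Integrable (scaledCharFun (tiltedLaw P η Y)) := by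
    simpa only [← scaledCharFun_tiltedLaw hY] using hφ
  have hmeas : StronglyMeasurable fun x => ((Real.exp ⟪η, x⟫ * g x : ℝ) : ℂ) := by
    refine Measurable.stronglyMeasurable ?_
    exact Complex.measurable_ofReal.comp
      ((show Continuous fun x : EuclideanSpace ℝ (Fin d) => Real.exp ⟪η, x⟫ by
        fun_prop).measurable.mul hg)
  have hcancel : ∀ ω, (Real.exp (-⟪η, Y ω⟫) : ℂ) * ((Real.exp ⟪η, Y ω⟫ * g (Y ω) : ℝ) : ℂ) =
      (g (Y ω) : ℂ) := fun ω => by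
    rw [← Complex.ofReal_mul, ← mul_assoc, ← Real.exp_add]; simp
  have hgc : Integrable fun x => ((Real.exp ⟪η, x⟫ * g x : ℝ) : ℂ) := hgi.ofReal
  have h1 := integrable_tiltedLaw hY hmeas (integrable_of_integrable_scaledCharFun hΦ hgc)
  have h2 := integral_eq_integral_fourier_mul hΦ hgc
  rw [integral_tiltedLaw hY hmeas] at h2
  simp only [hcancel, fourier_damped, scaledCharFun_tiltedLaw hY] at h1 h2
  rw [integral_complex_ofReal] at h2
  refine ⟨?_, h2⟩
  simpa using h1.re

theorem continuous_dampedFourier {g : EuclideanSpace ℝ (Fin d) → ℝ}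
    (hgi : Integrable fun x => Real.exp ⟪η, x⟫ * g x) : Continuous (dampedFourier η g) := by
  have hgc : Integrable fun x => ((Real.exp ⟪η, x⟫ * g x : ℝ) : ℂ) := hgi.ofReal
  refine continuous_of_dominated (fun z => ?_) (fun z => ?_) hgc.norm ?_
  · exact (Continuous.aestronglyMeasurable (by fun_prop)).mul hgc.aestronglyMeasurable
  · refine Filter.Eventually.of_forall fun x => ?_
    rw [norm_mul, mul_comm Complex.I, Complex.norm_exp_ofReal_mul_I, one_mul]
  · exact Filter.Eventually.of_forall fun x => by fun_prop

theorem continuous_dampedCharFun (hY : AEMeasurable Y P)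
    (hη : Integrable (fun ω => Real.exp (-⟪η, Y ω⟫)) P) : Continuous (dampedCharFun P η Y) := by
  refine continuous_of_dominated (fun z => ?_) (fun z => ?_) hη ?_
  · refine AEMeasurable.aestronglyMeasurable ?_
    exact (show Continuous fun y : EuclideanSpace ℝ (Fin d) => Complex.exp
      (Complex.I * ((⟪z, y⟫ : ℝ) + Complex.I * (⟪η, y⟫ : ℝ))) by
        fun_prop).measurable.comp_aemeasurable hY
  · refine Filter.Eventually.of_forall fun x => ?_
    rw [Complex.norm_exp]
    simp
  · exact Filter.Eventually.of_forall fun x => by fun_prop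

end Tilt

end ChebPrice

namespace ChebPrice

/-! ### Measurability of a family of analytic functions -/

theorem joukowski_circle (w : Circle) :
    joukowski (w : ℂ) = ((w : ℂ).re : ℂ) ∧ (w : ℂ).re ∈ Set.Icc (-1 : ℝ) 1 := by
  constructor
  · rw [joukowski, ← Circle.coe_inv, Circle.coe_inv_eq_conj, Complex.add_conj]
    push_cast; ring
  · have := Complex.abs_re_le_norm (w : ℂ)
    rw [Circle.norm_coe] at this
    exact abs_le.1 this

theorem measurable_fourierCoeff {W : Type*} [MeasurableSpace W]
    {F : AddCircle (2 * Real.pi) → W → ℂ} (hc : ∀ w, Continuous fun t => F t w)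
    (hm : ∀ t, Measurable (F t)) (k : ℤ) : Measurable fun w => fourierCoeff (fun t => F t w) k := by
  have h0 : Measurable (Function.uncurry F) := measurable_uncurry_of_continuous_of_measurable hc hm
  have h1 : Measurable fun p : W × AddCircle (2 * Real.pi) => (fourier (-k) p.2 : ℂ) :=
    (fourier (-k)).continuous.measurable.comp measurable_snd
  have h2 : Measurable fun p : W × AddCircle (2 * Real.pi) => F p.2 p.1 :=
    h0.comp measurable_swap
  have h3 : StronglyMeasurable fun p : W × AddCircle (2 * Real.pi) =>
      (fourier (-k) p.2 : ℂ) * F p.2 p.1 := (h1.mul h2).stronglyMeasurable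
  exact (h3.integral_prod_right' (ν := AddCircle.haarAddCircle)).measurable

/-- A family of bounded analytic functions on a Bernstein ellipse depends measurably on its
parameter if its restriction to the segment `[-1,1]` does. -/
theorem measurable_of_measurable_segment {W : Type*} [MeasurableSpace W] {ϱ : ℝ} (hϱ : 1 < ϱ)
    {g : ℂ → W → ℂ} {V : W → ℝ} (hg : ∀ w, DifferentiableOn ℂ (fun z => g z w) (bernstein ϱ))
    (hV : ∀ w, ∀ z ∈ bernstein ϱ, ‖g z w‖ ≤ V w)
    (hm : ∀ x ∈ Set.Icc (-1 : ℝ) 1, Measurable (g x)) {z : ℂ} (hz : z ∈ bernstein ϱ) :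
    Measurable (g z) := by
  have hϱ1 : ϱ⁻¹ < 1 := inv_lt_one_of_one_lt₀ hϱ
  obtain ⟨ζ, h1, h2, rfl⟩ := exists_joukowski_eq hϱ hz
  -- The coefficients only use the unit circle, which the Joukowski map sends into `[-1,1]`.
  have hcoeff : ∀ k : ℤ, Measurable fun w => laurentCoeff (fun z => g z w) k := by
    intro k
    refine measurable_fourierCoeff (F := fun t w => circlePullback (fun z => g z w) 1 t)
      (fun w => ?_) (fun t => ?_) k
    · exact continuous_circlePullback hϱ hϱ1 hϱ (hg w).continuousOn
    · obtain ⟨e, hx⟩ := joukowski_circle (AddCircle.toCircle t)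
      simp only [circlePullback, Complex.ofReal_one, one_mul, e]
      exact hm _ hx
  refine measurable_of_tendsto_metrizable' (Filter.atTop : Filter (Finset ℤ))
    (f := fun s w => ∑ k ∈ s, laurentCoeff (fun z => g z w) k * ζ ^ k) (fun s => ?_) ?_
  · exact Finset.measurable_fun_sum _ fun k _ => (hcoeff k).mul_const _
  · exact tendsto_pi_nhds.2 fun w => hasSum_laurent hϱ (hg w) (hV w) h1 h2

theorem measurable_of_measurable_box {W : Type*} [MeasurableSpace W] {D : ℕ} {ϱ : Fin D → ℝ}
    (hϱ : ∀ i, 1 < ϱ i) {A : (Fin D → ℂ) → W → ℂ} {V : W → ℝ}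
    (hA : ∀ w, DifferentiableOn ℂ (fun x => A x w) (polyEllipse ϱ))
    (hV : ∀ w, ∀ x ∈ polyEllipse ϱ, ‖A x w‖ ≤ V w)
    (hm : ∀ x : Fin D → ℝ, (∀ i, x i ∈ Set.Icc (-1 : ℝ) 1) → Measurable (A (toC x)))
    {x : Fin D → ℂ} (hx : x ∈ polyEllipse ϱ) : Measurable (A x) := by
  -- The set `s` holds the coordinates allowed to be complex; they are released one at a time.
  have key : ∀ s : Finset (Fin D), ∀ x ∈ polyEllipse ϱ,
      (∀ i ∉ s, ∃ y ∈ Set.Icc (-1 : ℝ) 1, x i = (y : ℂ)) → Measurable (A x) := by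
    intro s
    induction s using Finset.induction_on with
    | empty =>
      intro x _ h
      choose y hy1 hy2 using fun i => h i (Finset.notMem_empty i)
      have : x = toC y := funext hy2
      rw [this]; exact hm y hy1
    | insert i s hi ih =>
      intro x hx h
      have hmem : ∀ z ∈ bernstein (ϱ i), Function.update x i z ∈ polyEllipse ϱ := by
        intro z hz j _
        rcases eq_or_ne j i with rfl | hj
        · simpa using hz
        · simpa [hj] using hx j trivial
      have := measurable_of_measurable_segment (hϱ i) (g := fun z w => A (Function.update x i z) w)
        (V := V) (fun w => (hA w).comp (fun z _ =>
          (hasDerivAt_update x i z).differentiableAt.differentiableWithinAt) hmem)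
        (fun w z hz => hV w _ (hmem z hz)) (fun y hy => ih _
          (hmem _ (ofReal_mem_bernstein (hϱ i) hy)) fun j hj => ?_) (hx i trivial)
      · simpa using this
      · rcases eq_or_ne j i with rfl | hji
        · exact ⟨y, hy, by simp⟩
        · rw [Function.update_of_ne hji]
          exact h j (by simp [hji, hj])
  exact key Finset.univ x hx fun i hi => absurd (Finset.mem_univ i) hi

end ChebPrice

namespace ChebPrice

/-! ### Cauchy's formula on a polydisc -/

/-- The closed polydisc with centre `c` and radius `r` in each coordinate. -/
def closedPolydisc {D : ℕ} (c : Fin D → ℂ) (r : ℝ) : Set (Fin D → ℂ) :=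
  Set.univ.pi fun i => Metric.closedBall (c i) r

theorem torusMap_mem_closedPolydisc {D : ℕ} (c : Fin D → ℂ) {r : ℝ} (hr : 0 ≤ r) (θ : Fin D → ℝ) :
    torusMap c (fun _ => r) θ ∈ closedPolydisc c r := fun i _ => by
  simp [torusMap, abs_of_nonneg hr]

theorem continuous_torusMap {D : ℕ} (c : Fin D → ℂ) (R : Fin D → ℝ) : Continuous (torusMap c R) := by
  unfold torusMap; fun_prop

theorem torusMap_sub_ne_zero {D : ℕ} {c x : Fin D → ℂ} {r : ℝ} (hr : 0 < r)
    (hx : ∀ i, x i ∈ Metric.ball (c i) r) (θ : Fin D → ℝ) (i : Fin D) :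
    torusMap c (fun _ => r) θ i - x i ≠ 0 := fun h => by
  have h1 := hx i
  rw [← sub_eq_zero.1 h] at h1
  simp [torusMap, abs_of_pos hr] at h1

theorem torusIntegrable_of_continuousOn {D : ℕ} {f : (Fin D → ℂ) → ℂ} {c : Fin D → ℂ} {r : ℝ}
    (hr : 0 < r) (hf : ContinuousOn f (closedPolydisc c r)) {x : Fin D → ℂ}
    (hx : ∀ i, x i ∈ Metric.ball (c i) r) :
    TorusIntegrable (fun ζ => (∏ i, (ζ i - x i)⁻¹) * f ζ) c fun _ => r := by
  refine Continuous.integrableOn_Icc ?_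
  refine Continuous.mul ?_ (hf.comp_continuous (continuous_torusMap _ _)
    (torusMap_mem_closedPolydisc c hr.le))
  refine continuous_finsetProd _ fun i _ => Continuous.inv₀ ?_ (torusMap_sub_ne_zero hr hx · i)
  have := continuous_torusMap c fun _ => r
  fun_prop

/-- The one-variable Cauchy formula, iterated over the coordinates. -/
theorem torusIntegral_prod_inv_mul {D : ℕ} {f : (Fin D → ℂ) → ℂ} {c x : Fin D → ℂ} {r : ℝ}
    (hr : 0 < r) (hf : DifferentiableOn ℂ f (closedPolydisc c r))
    (hx : ∀ i, x i ∈ Metric.ball (c i) r) :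
    torusIntegral (fun ζ => (∏ i, (ζ i - x i)⁻¹) * f ζ) c (fun _ => r) =
      (2 * Real.pi * Complex.I) ^ D * f x := by
  induction D with
  | zero => simp [Subsingleton.elim c x]
  | succ D ih =>
    rw [torusIntegral_succ (torusIntegrable_of_continuousOn hr hf.continuousOn hx)]
    have hcons : ∀ ζ ∈ Metric.closedBall (c 0) r, ∀ y ∈ closedPolydisc (c ∘ Fin.succ) r,
        (Fin.cons ζ y : Fin (D + 1) → ℂ) ∈ closedPolydisc c r := by
      intro ζ hζ y hy i _
      refine Fin.cases ?_ (fun i => ?_) i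
      · exact hζ
      · exact hy i trivial
    have inner : ∀ ζ ∈ Metric.sphere (c 0) r,
        torusIntegral (fun y => (∏ i, ((Fin.cons ζ y : Fin (D + 1) → ℂ) i - x i)⁻¹) *
          f (Fin.cons ζ y)) (c ∘ Fin.succ) ((fun _ => r) ∘ Fin.succ) =
        (ζ - x 0)⁻¹ • ((2 * Real.pi * Complex.I) ^ D * f (Fin.cons ζ (x ∘ Fin.succ))) := by
      intro ζ hζ
      rw [smul_eq_mul, ← ih (f := fun y => f (Fin.cons ζ y)) (c := c ∘ Fin.succ) (x := x ∘ Fin.succ)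
        (hf.comp (differentiable_cons_right ζ).differentiableOn
          (hcons ζ (Metric.sphere_subset_closedBall hζ))) fun i => hx i.succ,
        ← torusIntegral_const_mul]
      congr 1
      ext y
      rw [Fin.prod_univ_succ, mul_assoc]
      rfl
    rw [circleIntegral.integral_congr hr.le inner]
    have hxs : x ∘ Fin.succ ∈ closedPolydisc (c ∘ Fin.succ) r := fun i _ =>
      Metric.ball_subset_closedBall (hx i.succ)
    have hd : DifferentiableOn ℂ
        (fun ζ => (2 * Real.pi * Complex.I) ^ D * f (Fin.cons ζ (x ∘ Fin.succ)))
        (Metric.closedBall (c 0) r) :=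
      (hf.comp (differentiable_cons_left _).differentiableOn
        fun ζ hζ => hcons ζ hζ _ hxs).const_mul _
    rw [hd.circleIntegral_sub_inv_smul (hx 0), smul_eq_mul, pow_succ', mul_assoc]
    rw [show (Fin.cons (x 0) (x ∘ Fin.succ) : Fin (D + 1) → ℂ) = x from Fin.cons_self_tail x]
    ring

/-! ### Analyticity of integrals of Cauchy kernels -/

open BoundedContinuousFunction in
/-- An integral of Cauchy kernels over a torus is analytic. -/
theorem analyticAt_integral_cauchy_kernel {D : ℕ} (c : Fin D → ℂ) {r : ℝ} (hr : 0 < r)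
    {h : (Fin D → ℝ) → ℂ} {s : Set (Fin D → ℝ)} (hh : IntegrableOn h s) :
    AnalyticAt ℂ (fun x : Fin D → ℂ =>
      ∫ θ in s, (∏ i, (torusMap c (fun _ => r) θ i - x i)⁻¹) * h θ) c := by
  have hb : ∀ i, Continuous fun θ : Fin D → ℝ => (r : ℂ) * Complex.exp (θ i * Complex.I) :=
    fun i => by fun_prop
  have hn : ∀ i, ∀ θ : Fin D → ℝ, ‖(r : ℂ) * Complex.exp (θ i * Complex.I)‖ ≤ r := fun i θ => by
    simp [abs_of_pos hr]
  -- In the Banach algebra of bounded continuous functions of `θ`, the denominators are affine in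
  -- `x` and invertible at `x = c`. Inversion is analytic there, and integration against `h` is a
  -- continuous linear functional.
  let τ : Fin D → ((Fin D → ℝ) →ᵇ ℂ) := fun i => ofNormedAddCommGroup _ (hb i) r (hn i)
  have hb' : ∀ i, Continuous fun θ : Fin D → ℝ => ((r : ℂ) * Complex.exp (θ i * Complex.I))⁻¹ :=
    fun i => (hb i).inv₀ fun θ => mul_ne_zero (by exact_mod_cast hr.ne') (Complex.exp_ne_zero _)
  have hn' : ∀ i, ∀ θ : Fin D → ℝ, ‖((r : ℂ) * Complex.exp (θ i * Complex.I))⁻¹‖ ≤ r⁻¹ :=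
    fun i θ => by simp [abs_of_pos hr]
  let σ : Fin D → ((Fin D → ℝ) →ᵇ ℂ) := fun i => ofNormedAddCommGroup _ (hb' i) r⁻¹ (hn' i)
  have hunit : ∀ i, IsUnit (τ i) := fun i => by
    refine IsUnit.of_mul_eq_one (σ i) ?_
    ext θ
    exact mul_inv_cancel₀ (mul_ne_zero (by exact_mod_cast hr.ne') (Complex.exp_ne_zero _))
  let u : Fin D → (Fin D → ℂ) → ((Fin D → ℝ) →ᵇ ℂ) := fun i x =>
    τ i - algebraMap ℂ _ (x i - c i)
  have hu0 : ∀ i, u i c = τ i := fun i => by simp [u]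
  have hua : ∀ i, AnalyticAt ℂ (u i) c := fun i => by
    refine analyticAt_const.sub ?_
    exact ((Algebra.linearMap ℂ ((Fin D → ℝ) →ᵇ ℂ)).toContinuousLinearMap.analyticAt _).comp
      (((ContinuousLinearMap.proj (R := ℂ) (φ := fun _ : Fin D => ℂ) i).analyticAt _).sub
        analyticAt_const)
  have hinv : ∀ i, AnalyticAt ℂ (fun x => Ring.inverse (u i x)) c := fun i => by
    obtain ⟨v, hv⟩ := hunit i
    have := analyticAt_inverse (𝕜 := ℂ) v
    rw [hv, ← hu0 i] at this
    exact this.comp (hua i)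
  let L : ((Fin D → ℝ) →ᵇ ℂ) →ₗ[ℂ] ℂ :=
    { toFun := fun v => ∫ θ in s, v θ * h θ
      map_add' := fun v w => by
        rw [← integral_add]
        · simp [add_mul]
        · exact hh.bdd_mul v.continuous.aestronglyMeasurable
            (Filter.Eventually.of_forall v.norm_coe_le_norm)
        · exact hh.bdd_mul w.continuous.aestronglyMeasurable
            (Filter.Eventually.of_forall w.norm_coe_le_norm)
      map_smul' := fun a v => by
        rw [RingHom.id_apply, smul_eq_mul, ← integral_const_mul]
        simp [mul_assoc] }
  let L' : ((Fin D → ℝ) →ᵇ ℂ) →L[ℂ] ℂ := L.mkContinuous (∫ θ in s, ‖h θ‖) fun v => by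
    change ‖∫ θ in s, v θ * h θ‖ ≤ _
    rw [mul_comm, ← integral_const_mul]
    refine norm_integral_le_of_norm_le (hh.norm.const_mul _)
      (Filter.Eventually.of_forall fun θ => ?_)
    rw [norm_mul]
    exact mul_le_mul_of_nonneg_right (v.norm_coe_le_norm θ) (norm_nonneg _)
  have hcomp : AnalyticAt ℂ (fun x => L' (∏ i, Ring.inverse (u i x))) c :=
    (L'.analyticAt _).comp (Finset.analyticAt_fun_prod _ fun i _ => hinv i)
  refine hcomp.congr ?_
  have hev : ∀ᶠ x in nhds c, ∀ i, IsUnit (u i x) := by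
    refine Filter.eventually_all.2 fun i => ?_
    refine (hua i).continuousAt.eventually (p := IsUnit) ?_
    rw [hu0]
    exact Units.isOpen.mem_nhds (hunit i)
  filter_upwards [hev] with x hx
  change ∫ θ in s, (∏ i, Ring.inverse (u i x)) θ * h θ = _
  congr 1
  ext θ
  congr 1
  have happ : ∀ i, (Ring.inverse (u i x)) θ = (torusMap c (fun _ => r) θ i - x i)⁻¹ := fun i => by
    refine eq_inv_of_mul_eq_one_left ?_
    have h1 := DFunLike.congr_fun (Ring.inverse_mul_cancel _ (hx i)) θ
    have h2 : u i x θ = torusMap c (fun _ => r) θ i - x i := by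
      rw [BoundedContinuousFunction.sub_apply, BoundedContinuousFunction.algebraMap_apply, torusMap, smul_eq_mul, mul_one]
      change (r : ℂ) * Complex.exp (θ i * Complex.I) - _ = _
      ring
    rw [← h2]
    exact h1
  simp only [← happ]
  exact map_prod (⟨⟨⟨fun v : (Fin D → ℝ) →ᵇ ℂ => v θ, rfl⟩, fun _ _ => rfl⟩, rfl, fun _ _ => rfl⟩ :
    ((Fin D → ℝ) →ᵇ ℂ) →+* ℂ) _ _

end ChebPrice

namespace ChebPrice

/-! ### Analyticity of parametric integrals -/

theorem exists_closedPolydisc_subset {D : ℕ} {U : Set (Fin D → ℂ)} (hU : IsOpen U) {c : Fin D → ℂ}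
    (hc : c ∈ U) : ∃ r > 0, closedPolydisc c r ⊆ U := by
  obtain ⟨r, hr, h⟩ := Metric.nhds_basis_closedBall.mem_iff.1 (hU.mem_nhds hc)
  exact ⟨r, hr, by rwa [closedPolydisc, ← closedBall_pi _ hr.le]⟩

/-- Cauchy's formula writes each `A x w` as an integral over a torus. After exchanging the
integrals, `x` occurs only in the Cauchy kernel. -/
theorem analyticOnNhd_integral {W : Type*} [MeasurableSpace W] {ν : Measure W} [SFinite ν] {D : ℕ}
    {U : Set (Fin D → ℂ)} (hU : IsOpen U) {A : (Fin D → ℂ) → W → ℂ} {M : W → ℝ}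
    (hM : Integrable M ν) (hA : ∀ w, DifferentiableOn ℂ (fun x => A x w) U)
    (hb : ∀ w, ∀ x ∈ U, ‖A x w‖ ≤ M w) (hm : ∀ x ∈ U, Measurable (A x)) :
    AnalyticOnNhd ℂ (fun x => ∫ w, A x w ∂ν) U := by
  intro c hc
  obtain ⟨r, hr, hrU⟩ := exists_closedPolydisc_subset hU hc
  set T := torusMap c fun _ => r
  set K : Set (Fin D → ℝ) := Set.Icc 0 fun _ => 2 * Real.pi
  have hT : ∀ θ, T θ ∈ U := fun θ => hrU (torusMap_mem_closedPolydisc c hr.le θ)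
  have hTc : Continuous T := continuous_torusMap _ _
  have hmeas : Measurable fun z : W × (Fin D → ℝ) => A (T z.2) z.1 := by
    have : Measurable (Function.uncurry fun θ w => A (T θ) w) :=
      measurable_uncurry_of_continuous_of_measurable
        (fun w => (hA w).continuousOn.comp_continuous hTc hT) fun θ => hm _ (hT θ)
    exact this.comp measurable_swap
  have hint : ∀ q : (Fin D → ℝ) → ℂ, Continuous q →
      Integrable (fun z : W × (Fin D → ℝ) => q z.2 * A (T z.2) z.1)
        (ν.prod (volume.restrict K)) := by
    intro q hq
    have hqK : Integrable (fun θ => ‖q θ‖) (volume.restrict K) := hq.norm.integrableOn_Icc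
    refine (hM.mul_prod hqK).mono'
      (((hq.measurable.comp measurable_snd).mul hmeas).aestronglyMeasurable)
      (Filter.Eventually.of_forall fun z => ?_)
    rw [norm_mul, mul_comm]
    exact mul_le_mul_of_nonneg_right (hb _ _ (hT _)) (norm_nonneg _)
  set wt : (Fin D → ℝ) → ℂ := fun θ => ∏ i : Fin D, (r : ℂ) * Complex.exp (θ i * Complex.I) * Complex.I
  have hwt : Continuous wt := by fun_prop
  have hh : IntegrableOn (fun θ => wt θ * ∫ w, A (T θ) w ∂ν) K := by
    have := (hint wt hwt).integral_prod_right
    simp only [integral_const_mul] at this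
    exact this
  refine AnalyticAt.congr ((analyticAt_const (v := ((2 * Real.pi * Complex.I) ^ D)⁻¹)).mul
    (analyticAt_integral_cauchy_kernel c hr hh)) ?_
  have hnear : ∀ᶠ x in nhds c, ∀ i, x i ∈ Metric.ball (c i) r :=
    Filter.eventually_all.2 fun i => (continuous_apply i).continuousAt.eventually
      (Metric.ball_mem_nhds _ hr)
  filter_upwards [hnear] with x hx
  have hpi : ((2 * Real.pi * Complex.I) ^ D : ℂ) ≠ 0 :=
    pow_ne_zero _ Complex.two_pi_I_ne_zero
  rw [Pi.mul_apply, inv_mul_eq_iff_eq_mul₀ hpi, ← integral_const_mul]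
  have hq : Continuous fun θ => (∏ i, (T θ i - x i)⁻¹) * wt θ := by
    refine (continuous_finsetProd _ fun i _ => Continuous.inv₀ ?_
      (torusMap_sub_ne_zero hr hx · i)).mul hwt
    have := continuous_torusMap c fun _ => r
    fun_prop
  have hswap := integral_integral_swap (f := fun w θ => (∏ i, (T θ i - x i)⁻¹) * wt θ * A (T θ) w)
    (hint _ hq)
  simp only [integral_const_mul, mul_assoc] at hswap
  rw [← hswap]
  refine integral_congr_ae (Filter.Eventually.of_forall fun w => ?_)
  change _ = (2 * Real.pi * Complex.I) ^ D * A x w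
  rw [← torusIntegral_prod_inv_mul hr ((hA w).mono hrU) hx]
  refine integral_congr_ae (Filter.Eventually.of_forall fun θ => ?_)
  change _ = wt θ • ((∏ i, (T θ i - x i)⁻¹) * A (T θ) w)
  rw [smul_eq_mul]; ring

/-! ### Integrable bounds -/

theorem exists_sub_rpow_le {a b α : ℝ} (hb : 0 < b) (hα : 1 < α) :
    ∃ C, ∀ t, 0 ≤ t → a * t - b * t ^ α ≤ C - t := by
  -- Beyond `s` the power satisfies `b * t ^ (α - 1) ≥ a + 1`; this is where `α > 1` enters.
  obtain ⟨s, hs⟩ := (((tendsto_rpow_atTop (sub_pos.2 hα)).const_mul_atTop hb).eventually_ge_atTop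
    (a + 1)).exists_forall_of_atTop
  refine ⟨(|a| + 1) * |s|, fun t ht => ?_⟩
  rcases le_total s t with h | h
  · have h1 := mul_le_mul_of_nonneg_right (hs t h) ht
    have h2 : t ^ (α - 1) * t = t ^ α := by
      rcases ht.eq_or_lt with rfl | h0
      · rw [mul_zero, Real.zero_rpow (by linarith)]
      · rw [← Real.rpow_add_one h0.ne', sub_add_cancel]
    rw [mul_assoc, h2] at h1
    have : 0 ≤ (|a| + 1) * |s| := by positivity
    linarith
  · have h1 : 0 ≤ b * t ^ α := by positivity
    have h2 : (a + 1) * t ≤ (|a| + 1) * |s| :=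
      mul_le_mul (by linarith [le_abs_self a]) (h.trans (le_abs_self s)) ht (by positivity)
    linarith

theorem integrable_exp_sub_rpow {E : Type*} [NormedAddCommGroup E] [NormedSpace ℝ E]
    [FiniteDimensional ℝ E] [MeasurableSpace E] [BorelSpace E] {a b α : ℝ} (hb : 0 < b)
    (hα : 1 < α) (μ : Measure E) [μ.IsAddHaarMeasure] :
    Integrable (fun w : E => Real.exp (a * ‖w‖ - b * ‖w‖ ^ α)) μ := by
  obtain ⟨C, hC⟩ := exists_sub_rpow_le (a := a) hb hα
  -- The decay `exp (-‖w‖)` is weakened to a power just beyond the dimension, which is integrable.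
  set k := Module.finrank ℝ E + 1 with hk
  have hi : Integrable (fun w : E => (1 + ‖w‖) ^ (-(k : ℝ))) μ :=
    integrable_one_add_norm (by rw [hk]; push_cast; linarith)
  have hcont : Continuous fun w : E => Real.exp (a * ‖w‖ - b * ‖w‖ ^ α) := by
    have : Continuous fun w : E => ‖w‖ ^ α :=
      continuous_norm.rpow_const fun _ => Or.inr (by linarith)
    fun_prop
  refine (hi.const_mul (Real.exp (C + 1) * k.factorial)).mono' hcont.aestronglyMeasurable
    (Filter.Eventually.of_forall fun w => ?_)
  rw [Real.norm_of_nonneg (Real.exp_pos _).le, Real.rpow_neg (by positivity), Real.rpow_natCast]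
  have hpos : 0 < 1 + ‖w‖ := by positivity
  have h1 := Real.pow_div_factorial_le_exp (x := 1 + ‖w‖) hpos.le k
  have hf : (0 : ℝ) < k.factorial := by exact_mod_cast k.factorial_pos
  calc Real.exp (a * ‖w‖ - b * ‖w‖ ^ α) ≤ Real.exp (C - ‖w‖) :=
        Real.exp_le_exp.2 (hC _ (norm_nonneg w))
    _ = Real.exp (C + 1) * (Real.exp (1 + ‖w‖))⁻¹ := by
        rw [← Real.exp_neg, ← Real.exp_add]; congr 1; ring
    _ ≤ Real.exp (C + 1) * ((1 + ‖w‖) ^ k / k.factorial)⁻¹ := by gcongr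
    _ = _ := by rw [inv_div]; ring

end ChebPrice

namespace ChebPrice

/-! ### Affine transformations of the coordinates -/

/-- The inverse of `tauC a b`. -/
noncomputable def tauInvC (a b : ℝ) (y : ℂ) : ℂ := (2 * y - a - b) / (b - a)

theorem tauC_ofReal (a b x : ℝ) : tauC a b x = (tau a b x : ℂ) := by
  simp [tauC, tau]

theorem tauInvC_ofReal (a b y : ℝ) : tauInvC a b y = (tauInv a b y : ℂ) := by
  simp [tauInvC, tauInv]

theorem tau_mem_Icc {a b x : ℝ} (hab : a ≤ b) (hx : x ∈ Set.Icc (-1 : ℝ) 1) :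
    tau a b x ∈ Set.Icc a b := by
  obtain ⟨h1, h2⟩ := hx
  constructor <;> rw [tau] <;> nlinarith

theorem tau_tauInv {a b y : ℝ} (hy : y ∈ Set.Icc a b) : tau a b (tauInv a b y) = y := by
  rcases eq_or_ne b a with rfl | h
  · obtain ⟨h1, h2⟩ := hy
    simp [tau]; linarith
  · have := sub_ne_zero.2 h
    rw [tau, tauInv]; field_simp; ring

theorem tauInv_mem_Icc {a b y : ℝ} (hy : y ∈ Set.Icc a b) : tauInv a b y ∈ Set.Icc (-1 : ℝ) 1 := by
  rcases (hy.1.trans hy.2).eq_or_lt with rfl | h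
  · simp [tauInv]
  · have hpos := sub_pos.2 h
    obtain ⟨h1, h2⟩ := hy
    rw [tauInv, Set.mem_Icc, le_div_iff₀ hpos, div_le_iff₀ hpos]
    constructor <;> linarith

theorem tauInvC_mem {a b ϱ : ℝ} (hϱ : 1 < ϱ) {y : ℂ} (hy : y ∈ tauC a b '' bernstein ϱ) :
    tauInvC a b y ∈ bernstein ϱ := by
  obtain ⟨z, hz, rfl⟩ := hy
  rcases eq_or_ne a b with rfl | h
  -- For `a = b` the division by zero returns `0`, the centre of the ellipse.
  · simpa [tauInvC] using ofReal_mem_bernstein hϱ (x := 0) (by simp)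
  · have h' : (b : ℂ) - a ≠ 0 := sub_ne_zero.2 (by exact_mod_cast h.symm)
    have : tauInvC a b (tauC a b z) = z := by
      rw [tauInvC, tauC]; field_simp; ring
    rwa [this]

section Vec

variable {D : ℕ} (lo hi : Fin D → ℝ)

/-- The map `tauC` in each coordinate. -/
noncomputable def vecTauC (x : Fin D → ℂ) : Fin D → ℂ := fun i => tauC (lo i) (hi i) (x i)

/-- The map `tauInvC` in each coordinate. -/
noncomputable def vecTauInvC (y : Fin D → ℂ) : Fin D → ℂ := fun i => tauInvC (lo i) (hi i) (y i)

theorem analyticAt_coord (i : Fin D) (x : Fin D → ℂ) :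
    AnalyticAt ℂ (fun x : Fin D → ℂ => x i) x :=
  (ContinuousLinearMap.proj (R := ℂ) (φ := fun _ : Fin D => ℂ) i).analyticAt x

theorem analyticAt_vecTauC (x : Fin D → ℂ) : AnalyticAt ℂ (vecTauC lo hi) x :=
  analyticAt_pi_iff.2 fun i => analyticAt_const.add (analyticAt_const.mul
    (analyticAt_const.sub (analyticAt_coord i x)))

theorem analyticAt_vecTauInvC (x : Fin D → ℂ) : AnalyticAt ℂ (vecTauInvC lo hi) x :=
  analyticAt_pi_iff.2 fun i => (((analyticAt_const.mul (analyticAt_coord i x)).sub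
    analyticAt_const).sub analyticAt_const).div_const

variable {lo hi}

theorem vecTauC_mem {ϱ : Fin D → ℝ} {x : Fin D → ℂ} (hx : x ∈ polyEllipse ϱ) :
    vecTauC lo hi x ∈ genBernstein lo hi ϱ :=
  fun i _ => ⟨x i, hx i trivial, rfl⟩

theorem vecTauInvC_mem {ϱ : Fin D → ℝ} (hϱ : ∀ i, 1 < ϱ i) {y : Fin D → ℂ}
    (hy : y ∈ genBernstein lo hi ϱ) : vecTauInvC lo hi y ∈ polyEllipse ϱ :=
  fun i _ => tauInvC_mem (hϱ i) (hy i trivial)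

theorem vecTauC_toC (x : Fin D → ℝ) :
    vecTauC lo hi (toC x) = toC fun i => tau (lo i) (hi i) (x i) :=
  funext fun _ => tauC_ofReal _ _ _

theorem vecTauInvC_toC (y : Fin D → ℝ) :
    vecTauInvC lo hi (toC y) = toC fun i => tauInv (lo i) (hi i) (y i) :=
  funext fun _ => tauInvC_ofReal _ _ _

end Vec

/-! ### Analytic extension and interpolation of a parametric integral -/

/-- A function on a hyperrectangle that is the integral of a dominated family of functions with
analytic extensions has a bounded analytic extension, and every bound of the extension controls
the error of its Chebyshev interpolation. -/
theorem exists_analytic_extension_and_error_bound {W : Type*} [MeasurableSpace W] {ν : Measure W}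
    [SFinite ν] {D : ℕ} {lo hi ϱ : Fin D → ℝ} (hlohi : ∀ i, lo i ≤ hi i) (hϱ : ∀ i, 1 < ϱ i)
    {B : (Fin D → ℂ) → W → ℂ} {M : W → ℝ} {u : (Fin D → ℝ) → ℝ} (hM : Integrable M ν)
    (hB : ∀ w, AnalyticOnNhd ℂ (fun p => B p w) (genBernstein lo hi ϱ))
    (hBM : ∀ w, ∀ p ∈ genBernstein lo hi ϱ, ‖B p w‖ ≤ M w)
    (hBm : ∀ p ∈ Set.Icc lo hi, Measurable (B (toC p)))
    (hu : ∀ p ∈ Set.Icc lo hi, ∫ w, B (toC p) w ∂ν = (u p : ℂ)) :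
    ∃ G : (Fin D → ℂ) → ℂ,
      AnalyticOnNhd ℂ G (genBernstein lo hi ϱ) ∧
      (∀ p ∈ Set.Icc lo hi, G (toC p) = (u p : ℂ)) ∧
      BddAbove ((fun p => ‖G p‖) '' genBernstein lo hi ϱ) ∧
      ∀ V : ℝ, (∀ p ∈ genBernstein lo hi ϱ, ‖G p‖ ≤ V) →
        ∀ N : Fin D → ℕ, (∀ i, 1 ≤ N i) → ∀ p ∈ Set.Icc lo hi,
          |u p - chebInterpOn lo hi N u p| ≤ (2 : ℝ) ^ ((D : ℝ) / 2 + 1) * V *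
            √(∑ i, ϱ i ^ (-2 * (N i : ℤ)) * ∏ j, 1 / (1 - ϱ j ^ (-2 : ℤ))) := by
  have hbox : ∀ x : Fin D → ℝ, (∀ i, x i ∈ Set.Icc (-1 : ℝ) 1) →
      (fun i => tau (lo i) (hi i) (x i)) ∈ Set.Icc lo hi := fun x hx =>
    ⟨fun i => (tau_mem_Icc (hlohi i) (hx i)).1, fun i => (tau_mem_Icc (hlohi i) (hx i)).2⟩
  have hinv : ∀ p ∈ Set.Icc lo hi, ∀ i, tauInv (lo i) (hi i) (p i) ∈ Set.Icc (-1 : ℝ) 1 :=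
    fun p hp i => tauInv_mem_Icc ⟨hp.1 i, hp.2 i⟩
  have hcancel : ∀ p ∈ Set.Icc lo hi,
      (fun i => tau (lo i) (hi i) (tauInv (lo i) (hi i) (p i))) = p :=
    fun p hp => funext fun i => tau_tauInv ⟨hp.1 i, hp.2 i⟩
  have hA : ∀ w, DifferentiableOn ℂ (fun x => B (vecTauC lo hi x) w) (polyEllipse ϱ) :=
    fun w x hx => ((hB w _ (vecTauC_mem hx)).comp
      (analyticAt_vecTauC lo hi x)).differentiableAt.differentiableWithinAt
  have hAM : ∀ w, ∀ x ∈ polyEllipse ϱ, ‖B (vecTauC lo hi x) w‖ ≤ M w :=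
    fun w x hx => hBM w _ (vecTauC_mem hx)
  have hH : AnalyticOnNhd ℂ (fun x => ∫ w, B (vecTauC lo hi x) w ∂ν) (polyEllipse ϱ) :=
    analyticOnNhd_integral (isOpen_polyEllipse ϱ) hM hA hAM fun x hx =>
      measurable_of_measurable_box hϱ (A := fun x => B (vecTauC lo hi x)) hA hAM
        (fun y hy => by rw [vecTauC_toC]; exact hBm _ (hbox y hy)) hx
  -- A degenerate side makes the generalized ellipse a single point in that coordinate. Passing
  -- through `vecTauInvC`, which is constant there, makes the extension analytic on a full
  -- neighbourhood.
  have hG : AnalyticOnNhd ℂ (fun p => ∫ w, B (vecTauC lo hi (vecTauInvC lo hi p)) w ∂ν)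
      (genBernstein lo hi ϱ) := fun p hp =>
    (hH _ (vecTauInvC_mem hϱ hp)).comp (analyticAt_vecTauInvC lo hi p)
  have hGu : ∀ p ∈ Set.Icc lo hi,
      ∫ w, B (vecTauC lo hi (vecTauInvC lo hi (toC p))) w ∂ν = (u p : ℂ) := fun p hp => by
    rw [vecTauInvC_toC, vecTauC_toC, hcancel p hp, hu p hp]
  refine ⟨_, hG, hGu, ⟨∫ w, M w ∂ν, ?_⟩, fun V hV N hN p hp => ?_⟩
  · rintro _ ⟨p, hp, rfl⟩
    exact norm_integral_le_of_norm_le hM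
      (Filter.Eventually.of_forall fun w => hAM w _ (vecTauInvC_mem hϱ hp))
  · have h := abs_sub_chebInterp_le hϱ
      (fun x hx => ((hG _ (vecTauC_mem hx)).comp
        (analyticAt_vecTauC lo hi x)).differentiableAt.differentiableWithinAt)
      (fun z hz => hV _ (vecTauC_mem hz)) hN
      (h := fun x => u fun i => tau (lo i) (hi i) (x i)) (fun x hx => by
        rw [Function.comp_apply, vecTauC_toC]; exact hGu _ (hbox x hx)) (hinv p hp)
    rw [hcancel p hp] at h
    exact h

/-! ### The price -/

section Price

variable {d m n : ℕ}

theorem fst_mem_genBernstein {lo hi ϱ : Fin (m + n) → ℝ} {p : Fin (m + n) → ℂ}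
    (hp : p ∈ genBernstein lo hi ϱ) : (fun i => p (Fin.castAdd n i)) ∈
      genBernstein (fstPar lo) (fstPar hi) (fstPar ϱ) :=
  fun i _ => hp (Fin.castAdd n i) trivial

theorem snd_mem_genBernstein {lo hi ϱ : Fin (m + n) → ℝ} {p : Fin (m + n) → ℂ}
    (hp : p ∈ genBernstein lo hi ϱ) : (fun i => p (Fin.natAdd m i)) ∈
      genBernstein (sndPar lo) (sndPar hi) (sndPar ϱ) :=
  fun i _ => hp (Fin.natAdd m i) trivial

theorem fstPar_mem_Icc {lo hi p : Fin (m + n) → ℝ} (hp : p ∈ Set.Icc lo hi) :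
    fstPar p ∈ Set.Icc (fstPar lo) (fstPar hi) := ⟨fun _ => hp.1 _, fun _ => hp.2 _⟩

theorem sndPar_mem_Icc {lo hi p : Fin (m + n) → ℝ} (hp : p ∈ Set.Icc lo hi) :
    sndPar p ∈ Set.Icc (sndPar lo) (sndPar hi) := ⟨fun _ => hp.1 _, fun _ => hp.2 _⟩

end Price

end ChebPrice

theorem theorem3 {d m n : ℕ} {Ω : Type*} [MeasurableSpace Ω] (P : Measure Ω)
    [IsProbabilityMeasure P]
    -- the hyperrectangle `𝒫 = 𝒫¹ × 𝒫²`, the ellipse parameters and the weight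
    (lo hi : Fin (m + n) → ℝ) (hlohi : ∀ i, lo i ≤ hi i)
    (ϱ : Fin (m + n) → ℝ) (hϱ : ∀ i, 1 < ϱ i)
    (η : EuclideanSpace ℝ (Fin d))
    -- the payoff functions and the random vectors
    (f : (Fin m → ℝ) → EuclideanSpace ℝ (Fin d) → ℝ)
    (hf_meas : ∀ p ∈ Set.Icc (ChebPrice.fstPar lo) (ChebPrice.fstPar hi), Measurable (f p))
    (hf_nonneg : ∀ p ∈ Set.Icc (ChebPrice.fstPar lo) (ChebPrice.fstPar hi), ∀ x, 0 ≤ f p x)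
    (X : (Fin n → ℝ) → Ω → EuclideanSpace ℝ (Fin d))
    (hX : ∀ p ∈ Set.Icc (ChebPrice.sndPar lo) (ChebPrice.sndPar hi), AEMeasurable (X p) P)
    -- the conditions (A1)--(A4)
    (hA1 : ChebPrice.CondA1 (ChebPrice.fstPar lo) (ChebPrice.fstPar hi) η f)
    (hA2 : ChebPrice.CondA2 (ChebPrice.fstPar lo) (ChebPrice.fstPar hi) (ChebPrice.fstPar ϱ) η f)
    (hA3 : ChebPrice.CondA3 P (ChebPrice.sndPar lo) (ChebPrice.sndPar hi) η X)
    (hA4 : ChebPrice.CondA4 P (ChebPrice.sndPar lo) (ChebPrice.sndPar hi) (ChebPrice.sndPar ϱ) η X) :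
    -- the prices are finite
    (∀ p ∈ Set.Icc lo hi,
      Integrable (fun ω => f (ChebPrice.fstPar p) (X (ChebPrice.sndPar p) ω)) P) ∧
    -- the price extends to a bounded analytic function on the generalized Bernstein ellipse
    ∃ G : (Fin (m + n) → ℂ) → ℂ,
      AnalyticOnNhd ℂ G (ChebPrice.genBernstein lo hi ϱ) ∧
      (∀ p ∈ Set.Icc lo hi, G (ChebPrice.toC p) = (ChebPrice.price P f X p : ℂ)) ∧
      BddAbove ((fun p => ‖G p‖) '' ChebPrice.genBernstein lo hi ϱ) ∧
      -- and every bound `V` of the extension yields the error bound for the interpolation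
      ∀ V : ℝ, (∀ p ∈ ChebPrice.genBernstein lo hi ϱ, ‖G p‖ ≤ V) →
        ∀ N : Fin (m + n) → ℕ, (∀ i, 1 ≤ N i) → ∀ p ∈ Set.Icc lo hi,
          |ChebPrice.price P f X p
              - ChebPrice.chebInterpOn lo hi N (ChebPrice.price P f X) p| ≤
            (2 : ℝ) ^ (((m + n : ℕ) : ℝ) / 2 + 1) * V *
              Real.sqrt (∑ i, ϱ i ^ (-2 * (N i : ℤ)) * ∏ j, 1 / (1 - ϱ j ^ (-2 : ℤ))) := by
  open ChebPrice in
  obtain ⟨F, hFa, hFeq, a₁, ha₁, a₂, -, hFb⟩ := hA2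
  obtain ⟨Φ, hΦa, hΦeq, α, hα, b₁, hb₁, b₂, hb₂, hΦb⟩ := hA4
  have h2π : (0 : ℝ) ≤ 2 * Real.pi := Real.two_pi_pos.le
  have hnorm : ∀ w : EuclideanSpace ℝ (Fin d), ‖(2 * Real.pi) • w‖ = 2 * Real.pi * ‖w‖ :=
    fun w => by rw [norm_smul, Real.norm_of_nonneg h2π]
  -- Mathlib's Fourier transform uses the frequency `2πw`, so the decay constant acquires the factor
  -- `(2π) ^ α`.
  have hb : 0 < b₂ * (2 * Real.pi) ^ α := mul_pos hb₂ (Real.rpow_pos_of_pos Real.two_pi_pos _)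
  have hΦb' : ∀ w : EuclideanSpace ℝ (Fin d),
      ∀ p ∈ genBernstein (sndPar lo) (sndPar hi) (sndPar ϱ),
      ‖Φ p ((2 * Real.pi) • w)‖ ≤ b₁ * Real.exp (0 * ‖w‖ - b₂ * (2 * Real.pi) ^ α * ‖w‖ ^ α) := by
    intro w p hp
    refine (hΦb _ p hp).trans_eq ?_
    rw [hnorm, Real.mul_rpow h2π (norm_nonneg w)]
    congr 2; ring
  have hmem : ∀ p ∈ Set.Icc lo hi, toC p ∈ genBernstein lo hi ϱ := fun p hp i _ =>
    ⟨(tauInv (lo i) (hi i) (p i) : ℂ),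
      ofReal_mem_bernstein (hϱ i) (tauInv_mem_Icc ⟨hp.1 i, hp.2 i⟩), by
        rw [tauC_ofReal, tau_tauInv ⟨hp.1 i, hp.2 i⟩]; rfl⟩
  have hrep : ∀ p ∈ Set.Icc lo hi,
      Integrable (fun ω => f (fstPar p) (X (sndPar p) ω)) P ∧ ((price P f X p : ℝ) : ℂ) =
        ∫ w, dampedFourier η (f (fstPar p)) (-((2 * Real.pi) • w)) *
          dampedCharFun P η (X (sndPar p)) ((2 * Real.pi) • w) := by
    intro p hp
    have h1 := fstPar_mem_Icc hp
    have h2 := sndPar_mem_Icc hp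
    refine integrable_and_integral_eq (hX _ h2) (hA3 _ h2) ?_ (hf_meas _ h1) (hA1 _ h1)
    refine ((integrable_exp_sub_rpow (a := 0) hb hα.1 volume).const_mul b₁).mono'
      ((continuous_dampedCharFun (hX _ h2) (hA3 _ h2)).comp
        (continuous_const_smul _)).aestronglyMeasurable (Filter.Eventually.of_forall fun w => ?_)
    rw [← hΦeq _ h2]
    exact hΦb' w _ (snd_mem_genBernstein (hmem p hp))
  refine ⟨fun p hp => (hrep p hp).1, ?_⟩
  have hval : ∀ p ∈ Set.Icc lo hi, ∀ w,
      F (fun i => toC p (Fin.castAdd n i)) (-((2 * Real.pi) • w)) *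
        Φ (fun i => toC p (Fin.natAdd m i)) ((2 * Real.pi) • w) =
      dampedFourier η (f (fstPar p)) (-((2 * Real.pi) • w)) *
        dampedCharFun P η (X (sndPar p)) ((2 * Real.pi) • w) := fun p hp w => by
    rw [← hFeq _ (fstPar_mem_Icc hp), ← hΦeq _ (sndPar_mem_Icc hp)]; rfl
  refine exists_analytic_extension_and_error_bound (ν := (volume : Measure (EuclideanSpace ℝ (Fin d))))
    (B := fun p w => F (fun i => p (Fin.castAdd n i)) (-((2 * Real.pi) • w)) *
      Φ (fun i => p (Fin.natAdd m i)) ((2 * Real.pi) • w)) hlohi hϱ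
    -- The growth of the payoff transform allowed by (A2) is beaten by the decay in (A4), uniformly
    -- in the parameter.
    ((integrable_exp_sub_rpow (a := a₂ * (2 * Real.pi)) hb hα.1 volume).const_mul (a₁ * b₁))
    (fun w p hp => ?_) (fun w p hp => ?_) (fun p hp => ?_) fun p hp => ?_
  · refine AnalyticAt.mul ?_ ?_
    · exact AnalyticAt.comp (g := fun q => F q (-((2 * Real.pi) • w)))
        (f := fun (p : Fin (m + n) → ℂ) i => p (Fin.castAdd n i))
        (hFa _ _ (fst_mem_genBernstein hp)) (analyticAt_pi_iff.2 fun i => analyticAt_coord _ _)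
    · exact AnalyticAt.comp (g := fun q => Φ q ((2 * Real.pi) • w))
        (f := fun (p : Fin (m + n) → ℂ) i => p (Fin.natAdd m i))
        (hΦa _ _ (snd_mem_genBernstein hp)) (analyticAt_pi_iff.2 fun i => analyticAt_coord _ _)
  · have h1 := hFb ((2 * Real.pi) • w) _ (fst_mem_genBernstein hp)
    have h2 := hΦb' w _ (snd_mem_genBernstein hp)
    rw [norm_mul]
    refine (mul_le_mul h1 h2 (norm_nonneg _) (by positivity)).trans_eq ?_
    rw [hnorm, mul_mul_mul_comm, ← Real.exp_add]
    congr 2; ring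
  · rw [funext (hval p hp)]
    have h1 := fstPar_mem_Icc hp
    have h2 := sndPar_mem_Icc hp
    exact (((continuous_dampedFourier (hA1 _ h1)).comp (continuous_const_smul _).neg).mul
      ((continuous_dampedCharFun (hX _ h2) (hA3 _ h2)).comp (continuous_const_smul _))).measurable
  · simp only [hval p hp]
    exact (hrep p hp).2.symm
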